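/- Let $S\subset\mathbb R^2$ be a finite set of $n$ points in convex position. An \emph{edge} is a straight-line segment between two distinct points of $S$. An \emph{odd matching} on $S$ is a set of pairwise non-crossing edges without common endpoints such that exactly one point of $S$ (the \emph{isolated} point) is not an endpoint of an edge. A \emph{flip} removes one edge of an odd matching and inserts a different edge, incident to the isolated point, so that the result is again an odd matching on $S$. The \emph{flip distance} $d(M,M')$ is the length of a shortest sequence of flips from $M$ to $M'$. For odd matchings $M,M'$ on $S$ an edge in $M\cap M'$ is \emph{happy}; a happy edge is \emph{good} if it lies on the boundary of the convex hull of $S$, or if the isolated point of $M$ lies on one side of it and all edges of $M\cup M'$ on the other side are happy. \textbf{Theorem.} Given two odd matchings $M,M'$ on the same convex point set $S$ and $k\in\mathbb N$, deciding whether $d(M,M')\le k$ is fixed-parameter tractable in $k$: there are a polynomial $q$ and an algorithm that decides all instances in at most $(2k)^k\, q(n)$ steps (with $0^0=1$). The model is a random access machine with unit-cost addition, subtraction and indirect addressing. Its input consists of $n$, $k$ and, for an arbitrary labelling of the points, the two arrays that give for each point its partner in $M$ and in $M'$; the points are accessed through unit-cost orientation tests on triples of labels. Moreover, let $S_0$ be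 obtained from $S$ by deleting the endpoints of all good happy edges, and let $M_0,M_0'$ be obtained from $M,M'$ by deleting all good happy edges. The set $S_0$ can be computed in time polynomial in $n$, $M_0$ and $M_0'$ are odd matchings on $S_0$, and $d(M_0,M_0')=d(M,M')$. For all $k$, if $d(M,M')\le k$, then $M_0$ and $M_0'$ have at most $k$ edges each and $|S_0|\le 2k+1$ (so an instance with more than $k$ remaining edges is a no-instance). If $M_0$ has at most $k$ edges, then for every $j\le k$ there are at most $(2k)^j$ flip sequences of length $j$ on $S_0$ that start at $M_0$; in particular there are at most $(2k)^k$ of length $k$. -/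

import Mathlib

namespace OddMatchings

/-! ### Odd matchings of point sets in the plane and the flip graph -/

/-- The Euclidean plane, with Cartesian coordinates. -/
abbrev Plane : Type := ℝ × ℝ

/-- The straight-line segment spanned by an edge. -/
def edgeSegment : Sym2 Plane → Set Plane :=
  Sym2.lift ⟨fun a b => segment ℝ a b, fun a b => segment_symm ℝ a b⟩

/-- `v` is a point of `S` that is not an endpoint of any edge of `M` (an isolated point). -/
def Isolated (S : Set Plane) (M : Set (Sym2 Plane)) (v : Plane) : Prop :=
  v ∈ S ∧ ∀ e ∈ M, v ∉ e

/-- `M` is an odd matching on the point set `S`: a set of non-degenerate edges between points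
of `S`, pairwise without common endpoints, pairwise non-crossing, that leaves exactly one point
of `S` isolated. -/
structure IsOddMatching (S : Set Plane) (M : Set (Sym2 Plane)) : Prop where
  nondegenerate : ∀ e ∈ M, ¬ e.IsDiag
  endpoints_mem : ∀ e ∈ M, ∀ x ∈ e, x ∈ S
  matching : ∀ e ∈ M, ∀ f ∈ M, e ≠ f → ∀ x ∈ e, x ∉ f
  noncrossing : ∀ e ∈ M, ∀ f ∈ M, e ≠ f → Disjoint (edgeSegment e) (edgeSegment f)
  isolated : ∃! v, Isolated S M v

/-- The type of odd matchings on `S`. -/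
def OddMatching (S : Set Plane) : Type := {M : Set (Sym2 Plane) // IsOddMatching S M}

/-- A flip: an edge `e` of `M` is removed and an edge `f` incident to the isolated point of `M`
is inserted. That the result is again an odd matching is part of the type of `N`. -/
def IsFlip {S : Set Plane} (M N : OddMatching S) : Prop :=
  ∃ v, Isolated S M.1 v ∧ ∃ e ∈ M.1, ∃ f : Sym2 Plane, v ∈ f ∧ N.1 = (M.1 \ {e}) ∪ {f}

/-- The flip graph of `S`: two distinct odd matchings are adjacent if they differ by a flip. -/
def flipGraph (S : Set Plane) : SimpleGraph (OddMatching S) :=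
  SimpleGraph.fromRel IsFlip

/-- The flip distance: the length of a shortest path in the flip graph (`⊤` if there is none). -/
noncomputable def flipDist {S : Set Plane} (M N : OddMatching S) : ℕ∞ :=
  (flipGraph S).edist M N

/-- The flip sequences of length `j` that start at `M`. -/
def flipSequences {S : Set Plane} (M : OddMatching S) (j : ℕ) : Set (Fin (j + 1) → OddMatching S) :=
  {w | w 0 = M ∧ ∀ i : Fin j, (flipGraph S).Adj (w i.castSucc) (w i.succ)}

/-! ### Good happy edges -/

/-- Twice the signed area of the triangle `a b c`; it is positive iff `a, b, c` is a
counterclockwise turn. -/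
def turn (a b c : Plane) : ℝ :=
  (b.1 - a.1) * (c.2 - a.2) - (b.2 - a.2) * (c.1 - a.1)

/-- The open half-plane to the left of the line directed from `u` to `v`. -/
def leftOf (u v : Plane) : Set Plane := {x | 0 < turn u v x}

/-- An edge is happy if it lies in both matchings. -/
def IsHappy (M M' : Set (Sym2 Plane)) (e : Sym2 Plane) : Prop := e ∈ M ∧ e ∈ M'

/-- `e` is an edge of the convex hull of `S` (for `S` in convex position and `e` an edge between
points of `S`): no point of `S` lies on one of the two sides of `e`. -/
def IsHullEdge (S : Set Plane) (e : Sym2 Plane) : Prop :=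
  ∃ u v, e = s(u, v) ∧ S ∩ leftOf u v = ∅

/-- Good happy edges: happy edges on the convex hull, and happy edges `uv` such that the isolated
point lies on one side of `uv` and all edges on the other side of `uv` are happy. -/
def IsGoodHappy (S : Set Plane) (M M' : Set (Sym2 Plane)) (e : Sym2 Plane) : Prop :=
  IsHappy M M' e ∧
    (IsHullEdge S e ∨
      ∃ u v, e = s(u, v) ∧ (∃ x, Isolated S M x ∧ x ∈ leftOf v u) ∧
        ∀ f ∈ M ∪ M', (∀ y ∈ f, y ∈ leftOf u v) → IsHappy M M' f)

/-- The points that remain when the good happy edges are removed with their endpoints. -/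
def kernelPoints (S : Set Plane) (M M' : Set (Sym2 Plane)) : Set Plane :=
  {x ∈ S | ∀ e, IsGoodHappy S M M' e → x ∉ e}

/-- The edges of `N` that remain when the good happy edges of `M` and `M'` are removed. -/
def kernelEdges (S : Set Plane) (M M' N : Set (Sym2 Plane)) : Set (Sym2 Plane) :=
  {e ∈ N | ¬ IsGoodHappy S M M' e}

/-! ### The machine model

Programs run on a random access machine with natural number cells, indirect addressing, addition
and truncated subtraction at unit cost. The input points are real points of the plane; a program
has access to them by the usual geometric predicate, the orientation of a triple of input points,
at unit cost. -/

/-- The contents of the memory cells. -/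
abbrev Memory : Type := ℕ → ℕ

/-- Expressions: constants, the contents of the cell whose address is given by an expression,
sums, truncated differences, and the orientation test for three input points given by their
labels. -/
inductive Expr : Type
  | const (c : ℕ)
  | load (a : Expr)
  | add (a b : Expr)
  | sub (a b : Expr)
  | orient (a b c : Expr)

/-- The value of an expression; `o` answers the orientation tests. -/
def Expr.eval (o : ℕ → ℕ → ℕ → ℕ) (s : Memory) : Expr → ℕ
  | .const c => c
  | .load a => s (a.eval o s)
  | .add a b => a.eval o s + b.eval o s
  | .sub a b => a.eval o s - b.eval o s
  | .orient a b c => o (a.eval o s) (b.eval o s) (c.eval o s)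

/-- The number of steps to evaluate an expression: one for each node. -/
def Expr.cost : Expr → ℕ
  | .const _ => 1
  | .load a => a.cost + 1
  | .add a b => a.cost + b.cost + 1
  | .sub a b => a.cost + b.cost + 1
  | .orient a b c => a.cost + b.cost + c.cost + 1

/-- Programs. `store a e` writes the value of `e` to the cell with the address `a`; a condition
holds if its value is not `0`. -/
inductive Prog : Type
  | skip
  | store (a e : Expr)
  | seq (P Q : Prog)
  | ite (c : Expr) (P Q : Prog)
  | loop (c : Expr) (P : Prog)

/-- `Exec o P s t s'`: started with memory `s`, the program `P` halts after exactly `t` steps with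
memory `s'`. -/
inductive Exec (o : ℕ → ℕ → ℕ → ℕ) : Prog → Memory → ℕ → Memory → Prop
  | skip (s : Memory) : Exec o .skip s 1 s
  | store (a e : Expr) (s : Memory) :
      Exec o (.store a e) s (a.cost + e.cost + 1)
        (Function.update s (a.eval o s) (e.eval o s))
  | seq {P Q : Prog} {s s₁ s₂ : Memory} {t₁ t₂ : ℕ} :
      Exec o P s t₁ s₁ → Exec o Q s₁ t₂ s₂ → Exec o (.seq P Q) s (t₁ + t₂) s₂
  | iteTrue {c : Expr} {P Q : Prog} {s s₁ : Memory} {t : ℕ} :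
      c.eval o s ≠ 0 → Exec o P s t s₁ → Exec o (.ite c P Q) s (c.cost + t + 1) s₁
  | iteFalse {c : Expr} {P Q : Prog} {s s₁ : Memory} {t : ℕ} :
      c.eval o s = 0 → Exec o Q s t s₁ → Exec o (.ite c P Q) s (c.cost + t + 1) s₁
  | loopStop {c : Expr} {P : Prog} {s : Memory} :
      c.eval o s = 0 → Exec o (.loop c P) s (c.cost + 1) s
  | loopStep {c : Expr} {P : Prog} {s s₁ s₂ : Memory} {t₁ t₂ : ℕ} :
      c.eval o s ≠ 0 → Exec o P s t₁ s₁ → Exec o (.loop c P) s₁ t₂ s₂ →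
      Exec o (.loop c P) s (c.cost + t₁ + t₂ + 1) s₂

/-! ### Instances as inputs of programs -/

open Classical in
/-- The orientation test for the labelled points `p`: `1` if `p a, p b, p c` is a counterclockwise
turn, and `0` otherwise (also if some label is out of range). -/
noncomputable def orientTest {n : ℕ} (p : Fin n → Plane) (a b c : ℕ) : ℕ :=
  if ∃ (ha : a < n) (hb : b < n) (hc : c < n), 0 < turn (p ⟨a, ha⟩) (p ⟨b, hb⟩) (p ⟨c, hc⟩)
  then 1 else 0

open Classical in
/-- The label of the point to which `p i` is matched in `M`, and `i` itself if `p i` is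
isolated. -/
noncomputable def mate {n : ℕ} (p : Fin n → Plane) (M : Set (Sym2 Plane)) (i : Fin n) : Fin n :=
  if h : ∃ j, s(p i, p j) ∈ M then h.choose else i

/-- The input: cell `0` holds the number `n` of points, cell `1` the parameter `k`, the next `n`
cells the array of mates in `M`, the next `n` cells the array of mates in `M'`, and all other
cells hold `0`. -/
noncomputable def inputMemory {n : ℕ} (p : Fin n → Plane) (M M' : Set (Sym2 Plane)) (k : ℕ) :
    Memory := fun a =>
  if a = 0 then n
  else if a = 1 then k
  else if h : a - 2 < n then mate p M ⟨a - 2, h⟩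
  else if h : a - 2 - n < n then mate p M' ⟨a - 2 - n, h⟩
  else 0

/-- Deciding whether the flip distance of two odd matchings on the same convex point set is at most
`k` is fixed-parameter tractable in `k`, with parameter dependence `f`: the function `f` is
computable, and there is one program that decides all instances (with the points labelled in any
order), in at most `f k` times a polynomial in the number `n` of points many steps. The answer is
left in cell `0`. -/
def FlipDistanceFPT (f : ℕ → ℕ) : Prop :=
  Computable f ∧ ∃ (P : Prog) (q : Polynomial ℕ),
    ∀ (n : ℕ) (p : Fin n → Plane), ConvexIndependent ℝ p →
    ∀ (M M' : OddMatching (Set.range p)) (k : ℕ),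
      ∃ (t : ℕ) (s : Memory), Exec (orientTest p) P (inputMemory p M.1 M'.1 k) t s ∧
        t ≤ f k * q.eval n ∧ s 0 ≤ 1 ∧ (s 0 = 1 ↔ flipDist M M' ≤ k)

/-- The removal of the good happy edges with their endpoints can be done in polynomial time: there
is a program that halts after at most polynomially many steps in the number `n` of points and then
holds, in the cells `2, …, n + 1`, the indicator function of the set of the remaining points. -/
def KernelPolyTime : Prop :=
  ∃ (P : Prog) (q : Polynomial ℕ),
    ∀ (n : ℕ) (p : Fin n → Plane), ConvexIndependent ℝ p →
    ∀ (M M' : OddMatching (Set.range p)) (k : ℕ),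
      ∃ (t : ℕ) (s : Memory), Exec (orientTest p) P (inputMemory p M.1 M'.1 k) t s ∧
        t ≤ q.eval n ∧ ∀ i : Fin n, s (2 + i) ≤ 1 ∧
          (s (2 + i) = 1 ↔ p i ∈ kernelPoints (Set.range p) M.1 M'.1)

end OddMatchings

namespace OddMatchings

/-! ### Combinatorial odd matchings on cyclically ordered points -/

/-! Points in convex position matter only through their cyclic order. An odd matching becomes a
non-crossing involution `m` with one fixed point `v`, and a flip becomes `flipAt m v w`: `v` is
joined to `w`, and the old partner of `w` becomes isolated.

Removing good edges is safe because a happy hull edge `uw` never has to be touched. Contracting `uw`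
turns every odd matching on `S` into one on `S \ {u, w}`: the partners of `u` and `w` are joined,
and if `u` or `w` is isolated, the partner of the other one becomes isolated. A flip then becomes a
flip or nothing at all (`PairFlip.contract`), so flip sequences project without getting longer;
conversely, `uw` can be added to every matching of a sequence on the smaller set
(`PairFlip.addEdge`). Call a point bad if no common edge covers it, and a common edge good if all
bad points lie on one side of it. If there is a good edge, then an innermost edge on its side
without bad points is a good hull edge (`exists_hull_of_good`). Removing it leaves the bad points as
they are, so all good edges can be removed in turn (`core_reduction`).

The kernel is small because each flip destroys a single edge, so `k` flips destroy edges with at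
most `2k` endpoints. A surviving edge keeps the isolated point on the same side throughout; hence
nothing changes on the other side, and the edge is good (`exists_touched`). At most `2k + 1` points
remain (`core_encard_le`). A flip is determined by the new partner of the isolated point, so an odd
matching with at most `k` edges has at most `2k` neighbours, which counts the flip sequences.

The algorithm computes the kernel and rejects if it has `c > 2k + 1` points. Otherwise it tries all
`c ^ k` words over the kernel; a letter is the next partner of the isolated point, and an impossible
flip is skipped (`pairReach_iff_exists_word`). Since `(2k + 1) ^ k ≤ 2 * (2k) ^ k`, the extra letter
costs a factor 2, and `pow_mul_le` absorbs the factor `k + 1` in the time per word. Correctness and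
running time are proved for a structured language `Cmd`, which compiles to machine programs. -/

/-- The cyclic order on `ℕ`. -/
def Cyc (a b c : ℕ) : Prop := a < b ∧ b < c ∨ b < c ∧ c < a ∨ c < a ∧ a < b

/-- The involution `m` describes a non-crossing matching on the points `S` in the cyclic order
given by the ranks `r`, with the unique isolated point `v`. -/
structure IsPairing {α : Type*} (r : α → ℕ) (S : Set α) (m : α → α) (v : α) : Prop where
  inv : ∀ x, m (m x) = x
  off : ∀ x, x ∉ S → m x = x
  mem : v ∈ S
  iso : m v = v
  uniq : ∀ x ∈ S, m x = x → x = v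
  nc : ∀ x ∈ S, ∀ y ∈ S, Cyc (r x) (r (m x)) (r y) ↔ Cyc (r x) (r (m x)) (r (m y))

section

variable {α : Type*} {r : α → ℕ} {S T : Set α} {m m' : α → α} {v v' u w : α}

theorem IsPairing.maps (h : IsPairing r S m v) {x : α} (hx : x ∈ S) : m x ∈ S := by
  by_contra hc
  have := h.off _ hc
  rw [h.inv] at this
  rw [← this] at hc
  exact hc hx

open Classical in
/-- The flip that connects the isolated point `v` to `w`. -/
noncomputable def flipAt (m : α → α) (v w : α) : α → α := fun x =>
  if x = v then w else if x = w then v else if x = m w then x else m x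

/-- A flip between pairings with their isolated points, with the new partner and the new isolated
point in `T`. -/
def PairFlip (r : α → ℕ) (T S : Set α) (p q : (α → α) × α) : Prop :=
  ∃ w ∈ T, w ∈ S ∧ p.1 w ∈ T ∧ w ≠ p.2 ∧ q = (flipAt p.1 p.2 w, p.1 w) ∧ IsPairing r S q.1 q.2

/-- `q` is reached from `p` by at most `k` flips. -/
def PairReach (r : α → ℕ) (T S : Set α) (k : ℕ) (p q : (α → α) × α) : Prop :=
  ∃ f : ℕ → (α → α) × α, f 0 = p ∧ f k = q ∧
    ∀ i < k, f (i + 1) = f i ∨ PairFlip r T S (f i) (f (i + 1))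

theorem pairReach_isPairing {f : ℕ → (α → α) × α} {k : ℕ}
    (h0 : IsPairing r S (f 0).1 (f 0).2)
    (hf : ∀ i < k, f (i + 1) = f i ∨ PairFlip r T S (f i) (f (i + 1))) :
    ∀ i ≤ k, IsPairing r S (f i).1 (f i).2 := by
  intro i
  induction i with
  | zero => intro _; exact h0
  | succ i ih =>
    intro hi
    rcases hf i (by omega) with h | ⟨w, _, _, _, _, _, h⟩
    · rw [h]; exact ih (by omega)
    · exact h

open Classical in
/-- The pairing induced on `S \ {u, w}` when the edge `uw` is contracted. -/
noncomputable def contract (u w : α) (p : (α → α) × α) : (α → α) × α :=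
  (fun x => if x = u ∨ x = w then x
    else if p.1 x = u then (if p.1 w = w then x else p.1 w)
    else if p.1 x = w then (if p.1 u = u then x else p.1 u)
    else p.1 x,
   if p.2 = u then p.1 w else if p.2 = w then p.1 u else p.2)

/-- Here `uw` is a hull edge, and `a`, `b` are the partners of `u`, `w`. The chord `xy` has both
ends on the same side of `uw`, so it does not separate `u` from `w`. Since it separates neither `u`
from `a` nor `w` from `b`, it does not separate `a` from `b`. -/
theorem cyc_contract {a b u w x y : ℕ} (hx : ¬ Cyc u w x) (hy : ¬ Cyc u w y)
    (h1 : Cyc x y u ↔ Cyc x y a) (h2 : Cyc x y w ↔ Cyc x y b)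
    (hne : u ≠ w ∧ a ≠ u ∧ a ≠ w ∧ b ≠ u ∧ b ≠ w ∧ x ≠ u ∧ x ≠ w ∧ y ≠ u ∧ y ≠ w) :
    Cyc x y a ↔ Cyc x y b := by
  unfold Cyc at *
  omega

/-- Crossing is a symmetric relation between two chords. -/
theorem cyc_contract_swap {a b x y : ℕ} (hne : a ≠ x ∧ a ≠ y ∧ b ≠ x ∧ b ≠ y)
    (h : Cyc x y a ↔ Cyc x y b) : Cyc a b x ↔ Cyc a b y := by
  unfold Cyc at *
  omega

/-- The only new edge joins `m u` to `m w`. It can be drawn along the two old edges and the hull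
edge `uw`, so it crosses nothing. -/
theorem IsPairing.contract (hr : Set.InjOn r S) (h : IsPairing r S m v) (hu : u ∈ S) (hw : w ∈ S)
    (huw : u ≠ w) (hull : ∀ x ∈ S, ¬ Cyc (r u) (r w) (r x)) :
    IsPairing r (S \ {u, w}) (contract u w (m, v)).1 (contract u w (m, v)).2 := by
  have hm := fun x => h.maps (x := x)
  obtain ⟨inv, off, mem, iso, uniq, nc⟩ := h
  constructor
  · intro x
    simp only [OddMatchings.contract]
    grind
  · intro x hx
    simp only [OddMatchings.contract]
    grind
  · simp only [OddMatchings.contract]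
    grind
  · simp only [OddMatchings.contract]
    grind
  · intro x hx
    simp only [OddMatchings.contract]
    grind
  · have key : ∀ x ∈ S \ {u, w}, ∀ z, (OddMatchings.contract u w (m, v)).1 x = z →
        z = x ∨ (z = m x ∧ z ≠ u ∧ z ≠ w) ∨ (x = m u ∧ z = m w ∧ z ≠ u ∧ z ≠ w) ∨
          (x = m w ∧ z = m u ∧ z ≠ u ∧ z ≠ w) := by
      intro x hx z
      simp only [OddMatchings.contract]
      grind
    have hne : ∀ a ∈ S, ∀ b ∈ S, a ≠ b → r a ≠ r b := fun a ha b hb hab hc => hab (hr ha hb hc)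
    have edge : ∀ x ∈ S, x ≠ u → x ≠ w → m x ≠ u → m x ≠ w → m u ≠ u → m u ≠ w → m w ≠ u →
        m w ≠ w → (Cyc (r x) (r (m x)) (r (m u)) ↔ Cyc (r x) (r (m x)) (r (m w))) := by
      intro x hx h1 h2 h3 h4 h5 h6 h7 h8
      exact cyc_contract (hull x hx) (hull _ (hm x hx)) (nc x hx u hu) (nc x hx w hw)
        ⟨hne _ hu _ hw huw, hne _ (hm _ hu) _ hu h5, hne _ (hm _ hu) _ hw h6,
          hne _ (hm _ hw) _ hu h7, hne _ (hm _ hw) _ hw h8, hne _ hx _ hu h1, hne _ hx _ hw h2,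
          hne _ (hm _ hx) _ hu h3, hne _ (hm _ hx) _ hw h4⟩
    have edge_swap : ∀ x ∈ S, x ≠ u → x ≠ w → m x ≠ u → m x ≠ w → m u ≠ u → m u ≠ w → m w ≠ u →
        m w ≠ w → (Cyc (r (m u)) (r (m w)) (r x) ↔ Cyc (r (m u)) (r (m w)) (r (m x))) := by
      intro x hx h1 h2 h3 h4 h5 h6 h7 h8
      refine cyc_contract_swap ⟨hne _ (hm _ hu) _ hx ?_, hne _ (hm _ hu) _ (hm _ hx) ?_,
        hne _ (hm _ hw) _ hx ?_, hne _ (hm _ hw) _ (hm _ hx) ?_⟩ (edge x hx h1 h2 h3 h4 h5 h6 h7 h8)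
      all_goals grind
    have flipc : ∀ a b c : ℕ, c ≠ a → c ≠ b → a ≠ b → (Cyc a b c ↔ ¬ Cyc b a c) := by
      intro a b c; unfold Cyc; omega
    have hirr : ∀ a b : ℕ, ¬ Cyc a a b ∧ ¬ Cyc a b a ∧ ¬ Cyc a b b := by
      intro a b; unfold Cyc; omega
    intro x hx y hy
    generalize hx' : (OddMatchings.contract u w (m, v)).1 x = x'
    generalize hy' : (OddMatchings.contract u w (m, v)).1 y = y'
    have kx := key x hx x' hx'
    have ky := key y hy y' hy'
    have hxS := hx.1
    have hyS := hy.1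
    have hxu : x ≠ u ∧ x ≠ w := by grind
    have hyu : y ≠ u ∧ y ≠ w := by grind
    rcases kx with rfl | ⟨rfl, kx1, kx2⟩ | ⟨rfl, rfl, kx1, kx2⟩ | ⟨rfl, rfl, kx1, kx2⟩ <;>
    rcases ky with rfl | ⟨rfl, ky1, ky2⟩ | ⟨rfl, rfl, ky1, ky2⟩ | ⟨rfl, rfl, ky1, ky2⟩
    · rfl
    · simp [hirr]
    · simp [hirr]
    · simp [hirr]
    · rfl
    · exact nc x hxS y hyS
    · exact edge x hxS hxu.1 hxu.2 kx1 kx2 hyu.1 hyu.2 ky1 ky2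
    · exact (edge x hxS hxu.1 hxu.2 kx1 kx2 ky1 ky2 hyu.1 hyu.2).symm
    · rfl
    · exact edge_swap y hyS hyu.1 hyu.2 ky1 ky2 hxu.1 hxu.2 kx1 kx2
    · simp [hirr]
    · simp [hirr]
    · rfl
    -- The new edge is now traversed from `m w` to `m u`; `flipc` complements both sides of
    -- `edge_swap`.
    · have := edge_swap y hyS hyu.1 hyu.2 ky1 ky2 kx1 kx2 hxu.1 hxu.2
      by_cases hyx : y = m w
      · subst hyx; simp [hirr, inv] at *
      by_cases hyx2 : y = m u
      · subst hyx2; simp [hirr, inv] at *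
      have h1 : m y ≠ m w := by grind
      have h2 : m y ≠ m u := by grind
      have h3 : m u ≠ m w := by grind
      rw [flipc _ _ _ (hne _ hyS _ hxS hyx) (hne _ hyS _ (hm _ hu) hyx2)
          (hne _ hxS _ (hm _ hu) h3.symm),
        flipc _ _ _ (hne _ (hm _ hyS) _ hxS h1) (hne _ (hm _ hyS) _ (hm _ hu) h2)
          (hne _ hxS _ (hm _ hu) h3.symm), this]
    · simp [hirr]
    · simp [hirr]

/-- Contraction identifies matchings that differ only along the path formed by `uw` and the edges at
its ends. Flips inside this path disappear; every other flip remains a flip. -/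
theorem PairFlip.contract (h0 : IsPairing r S m v) (hr : Set.InjOn r S)
    (hu : u ∈ S) (hw : w ∈ S)
    (huw : u ≠ w) (hull : ∀ x ∈ S, ¬ Cyc (r u) (r w) (r x))
    (h : PairFlip r S S (m, v) (m', v')) :
    OddMatchings.contract u w (m', v') = OddMatchings.contract u w (m, v) ∨
    PairFlip r (S \ {u, w}) (S \ {u, w})
      (OddMatchings.contract u w (m, v)) (OddMatchings.contract u w (m', v')) := by
  obtain ⟨x, _, hx, _, hxv, he, hp⟩ := h
  have hcm := fun x => (h0.contract hr hu hw huw hull).maps (x := x)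
  have hc := hp.contract hr hu hw huw hull
  have hm := fun x => h0.maps (x := x)
  obtain ⟨inv, off, mem, iso, uniq, nc⟩ := h0
  simp only [Prod.mk.injEq] at he hxv hp hc
  obtain ⟨rfl, rfl⟩ := he
  -- The flips that disappear: `uw` itself is removed, or `u` or `w` is isolated and gets joined to
  -- the other one or to the partner of the other one.
  by_cases hE : (x = u ∧ m u = w) ∨ (x = w ∧ m w = u) ∨ (v = u ∧ (x = w ∨ x = m w)) ∨
      (v = w ∧ (x = u ∨ x = m u))
  · left
    simp only [OddMatchings.contract, flipAt, Prod.mk.injEq]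
    refine ⟨?_, ?_⟩
    · funext y
      clear hp hc hull nc
      grind
    · clear hp hc hull nc
      grind
  · right
    classical
    -- The partner in the contracted flip: if `v` is joined to `u`, then after the contraction it is
    -- joined to whatever `w` was matched to, and symmetrically.
    have hx' : ∃ z, z = if x = u then m w else if x = w then m u else x := ⟨_, rfl⟩
    obtain ⟨z, hz⟩ := hx'
    have hzS : z ∈ S \ {u, w} := by
      clear hp hc hull nc
      grind
    refine ⟨z, hzS, hzS, hcm z hzS, ?_, ?_, hc⟩
    · simp only [OddMatchings.contract]
      clear hp hc hull nc
      grind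
    · simp only [OddMatchings.contract, flipAt, Prod.mk.injEq]
      refine ⟨?_, ?_⟩
      · funext y
        simp only [flipAt]
        clear hp hc hull nc
        have hinj : ∀ a b, m a = m b → a = b := fun a b h => by rw [← inv a, h, inv]
        by_cases hvu : v = u
        · have hxu : x ≠ u ∧ x ≠ w ∧ m x ≠ u ∧ m x ≠ w := by grind
          subst hvu
          rw [if_neg hxu.1, if_neg hxu.2.1] at hz
          subst hz
          grind
        by_cases hvw : v = w
        · have hxu : x ≠ u ∧ x ≠ w ∧ m x ≠ u ∧ m x ≠ w := by grind
          subst hvw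
          rw [if_neg hxu.1, if_neg hxu.2.1] at hz
          subst hz
          grind
        have hmu : m u ≠ u := by grind
        have hmw : m w ≠ w := by grind
        by_cases hxu : x = u
        · rw [if_pos hxu] at hz
          subst hxu hz
          grind
        by_cases hxw : x = w
        · rw [if_neg hxu, if_pos hxw] at hz
          subst hxw hz
          grind
        rw [if_neg hxu, if_neg hxw] at hz
        subst hz
        grind
      · clear hp hc hull nc
        grind
end
end OddMatchings

/-! ### Adding a hull edge, good points, and the reduction to the core -/

namespace OddMatchings

section

variable {α : Type*} {r : α → ℕ} {S T : Set α} {m m' : α → α} {v v' u w : α}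

open Classical in
/-- The pairing with the additional edge `uw`. -/
noncomputable def addEdge (u w : α) (p : (α → α) × α) : (α → α) × α :=
  (fun x => if x = u then w else if x = w then u else p.1 x, p.2)

/-- All other points lie on one side of the hull edge `uw`, so no edge crosses it, and no chord
separates `u` from `w`. -/
theorem IsPairing.addEdge (h : IsPairing r (S \ {u, w}) m v) (hr : Set.InjOn r S)
    (hu : u ∈ S) (hw : w ∈ S) (huw : u ≠ w) (hull : ∀ x ∈ S, ¬ Cyc (r u) (r w) (r x)) :
    IsPairing r S (addEdge u w (m, v)).1 (addEdge u w (m, v)).2 := by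
  have hm := fun x => h.maps (x := x)
  obtain ⟨inv, off, mem, iso, uniq, nc⟩ := h
  have hmu : m u = u := off u (by simp)
  have hmw : m w = w := off w (by simp)
  have hne : ∀ a ∈ S, ∀ b ∈ S, a ≠ b → r a ≠ r b := fun a ha b hb hab hc => hab (hr ha hb hc)
  constructor
  · intro x
    simp only [OddMatchings.addEdge]
    grind
  · intro x hx
    simp only [OddMatchings.addEdge]
    grind
  · exact mem.1
  · simp only [OddMatchings.addEdge]
    grind
  · intro x hx
    simp only [OddMatchings.addEdge]
    grind
  · intro x hx y hy
    have hirr : ∀ a b : ℕ, ¬ Cyc a a b ∧ ¬ Cyc a b a ∧ ¬ Cyc a b b := by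
      intro a b; unfold Cyc; omega
    have hside : ∀ a b c : ℕ, c ≠ a → c ≠ b → a ≠ b → ¬ Cyc a b c → Cyc b a c := by
      intro a b c; unfold Cyc; omega
    have hadj : ∀ a b x y : ℕ, x ≠ a → x ≠ b → y ≠ a → y ≠ b → a ≠ b → ¬ Cyc a b x →
        ¬ Cyc a b y → (Cyc x y a ↔ Cyc x y b) := by
      intro a b x y; unfold Cyc; omega
    by_cases hxu : x = u
    · subst hxu
      simp only [OddMatchings.addEdge, if_true]
      split_ifs
      all_goals grind
    by_cases hxw : x = w
    · subst hxw
      by_cases hyu : y = u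
      · subst hyu
        simp [OddMatchings.addEdge, hirr, huw.symm]
      by_cases hyw : y = x
      · subst hyw
        simp [OddMatchings.addEdge, hirr, huw.symm]
      simp only [OddMatchings.addEdge, if_true, if_neg hxu, if_neg hyu, if_neg hyw]
      have hy' := hm y ⟨hy, by simp [hyu, hyw]⟩
      have h1 := hside _ _ _ (hne _ hy _ hu hyu) (hne _ hy _ hw hyw) (hne _ hu _ hw huw) (hull y hy)
      have h2 := hside _ _ _ (hne _ hy'.1 _ hu (by grind)) (hne _ hy'.1 _ hw (by grind))
        (hne _ hu _ hw huw) (hull _ hy'.1)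
      simp [h1, h2]
    have hx' := hm x ⟨hx, by simp [hxu, hxw]⟩
    have ha := hadj (r u) (r w) (r x) (r (m x)) (hne _ hx _ hu hxu) (hne _ hx _ hw hxw)
      (hne _ hx'.1 _ hu (by grind)) (hne _ hx'.1 _ hw (by grind)) (hne _ hu _ hw huw)
      (hull x hx) (hull _ hx'.1)
    simp only [OddMatchings.addEdge, if_neg hxu, if_neg hxw]
    by_cases hyu : y = u
    · subst hyu; simpa using ha
    by_cases hyw : y = w
    · subst hyw; simpa [hyu] using ha.symm
    simp only [if_neg hyu, if_neg hyw]
    exact nc x ⟨hx, by simp [hxu, hxw]⟩ y ⟨hy, by simp [hyu, hyw]⟩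

theorem PairFlip.addEdge {p q : (α → α) × α} (hp : IsPairing r (S \ {u, w}) p.1 p.2)
    (h : PairFlip r T (S \ {u, w}) p q) (hr : Set.InjOn r S)
    (hu : u ∈ S) (hw : w ∈ S) (huw : u ≠ w) (hull : ∀ x ∈ S, ¬ Cyc (r u) (r w) (r x)) :
    PairFlip r T S (addEdge u w p) (addEdge u w q) := by
  obtain ⟨x, hxT, hx, hxm, hxv, rfl, hq⟩ := h
  obtain ⟨m, v⟩ := p
  have hm := fun x => hp.maps (x := x)
  refine ⟨x, hxT, hx.1, ?_, hxv, ?_, hq.addEdge hr hu hw huw hull⟩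
  · simp only [OddMatchings.addEdge]
    grind
  have hmu : m u = u := hp.off u (by simp)
  have hmw : m w = w := hp.off w (by simp)
  have inv := hp.inv
  have mem := hp.mem
  simp only [OddMatchings.addEdge, Prod.mk.injEq]
  refine ⟨?_, ?_⟩
  · funext y
    simp only [flipAt]
    clear hull hr hq hp
    grind
  · grind

/-- A point that is not covered by an edge of both matchings. -/
def IsBad (m m' : α → α) (x : α) : Prop := ¬ (m x = m' x ∧ m x ≠ x)

/-- A point on an edge of both matchings with all bad points on one side. -/
def IsGood (r : α → ℕ) (S : Set α) (m m' : α → α) (x : α) : Prop :=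
  x ∈ S ∧ ¬ IsBad m m' x ∧
    ((∀ y ∈ S, IsBad m m' y → ¬ Cyc (r x) (r (m x)) (r y)) ∨
      (∀ y ∈ S, IsBad m m' y → ¬ Cyc (r (m x)) (r x) (r y)))

/-- The points that are not good. -/
def core (r : α → ℕ) (S : Set α) (m m' : α → α) : Set α := {x ∈ S | ¬ IsGood r S m m' x}

open Classical in
/-- The pairing `m` on `A`, and the identity elsewhere. -/
noncomputable def restrictTo (A : Set α) (m : α → α) : α → α := fun x => if x ∈ A then m x else x

theorem IsGood.symm_edge (h : IsPairing r S m v) (h' : IsPairing r S m' v') {x : α}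
    (hx : IsGood r S m m' x) : IsGood r S m m' (m x) := by
  obtain ⟨h1, h2, h3⟩ := hx
  have i1 := h.inv x
  have i2 := h'.inv x
  refine ⟨h.maps h1, ?_, ?_⟩
  · unfold IsBad at *
    grind
  · rw [i1]; exact h3.symm

/-- On a side without bad points every point is covered by a common edge, and none of these edges
crosses the given one. An innermost edge there has no point of `S` behind it. -/
theorem exists_hull_of_good (hS : S.Finite) (hr : Set.InjOn r S)
    (h : IsPairing r S m v) (h' : IsPairing r S m' v') {x : α} (hx : IsGood r S m m' x) :
    ∃ u, IsGood r S m m' u ∧ ∀ y ∈ S, ¬ Cyc (r u) (r (m u)) (r y) := by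
  have hne : ∀ a ∈ S, ∀ b ∈ S, a ≠ b → r a ≠ r b := fun a ha b hb hab hc => hab (hr ha hb hc)
  -- Induction on the number of points to the left of the directed edge from `u` to `m u`, where no
  -- bad point lies.
  have key : ∀ N : ℕ, ∀ u, IsGood r S m m' u →
      (∀ y ∈ S, IsBad m m' y → ¬ Cyc (r u) (r (m u)) (r y)) →
      {y ∈ S | Cyc (r u) (r (m u)) (r y)}.ncard ≤ N →
      ∃ u, IsGood r S m m' u ∧ ∀ y ∈ S, ¬ Cyc (r u) (r (m u)) (r y) := by
    intro N
    induction N with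
    | zero =>
      intro u hu _ hN
      refine ⟨u, hu, fun y hy hc => ?_⟩
      have := (Set.ncard_eq_zero (hS.subset (Set.sep_subset _ _))).1 (Nat.le_zero.1 hN)
      have hmem : y ∈ {y ∈ S | Cyc (r u) (r (m u)) (r y)} := ⟨hy, hc⟩
      rw [this] at hmem
      exact hmem
    | succ N ih =>
      intro u hu hb hN
      by_cases hex : ∃ y ∈ S, Cyc (r u) (r (m u)) (r y)
      swap
      · exact ⟨u, hu, fun y hy hc => hex ⟨y, hy, hc⟩⟩
      obtain ⟨y, hy, hc⟩ := hex
      have hgy : ¬ IsBad m m' y := fun hbad => hb y hy hbad hc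
      have hc' := (h.nc u hu.1 y hy).1 hc
      have hmy := h.maps hy
      have hmu := h.maps hu.1
      have hyne : m y ≠ y := by unfold IsBad at hgy; tauto
      have hune : m u ≠ u := by have := hu.2.1; unfold IsBad at this; tauto
      have hry := hne _ hmy _ hy hyne
      have hru := hne _ hmu _ hu.1 hune
      have main : ∀ z, z ∈ S → ¬ IsBad m m' z → Cyc (r u) (r (m u)) (r z) →
          Cyc (r u) (r (m u)) (r (m z)) → ¬ Cyc (r z) (r (m z)) (r u) → r z ≠ r (m z) →
          ∃ u, IsGood r S m m' u ∧ ∀ y ∈ S, ¬ Cyc (r u) (r (m u)) (r y) := by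
        intro z hz hgz h1 h2 h3 h4
        have hsub : ∀ t : ℕ, Cyc (r z) (r (m z)) t → Cyc (r u) (r (m u)) t := by
          intro t; unfold Cyc at *; omega
        have hbz : ∀ y ∈ S, IsBad m m' y → ¬ Cyc (r z) (r (m z)) (r y) :=
          fun y hy hbad hcy => hb y hy hbad (hsub _ hcy)
        refine ih z ⟨hz, hgz, Or.inl hbz⟩ hbz ?_
        have hlt : {y ∈ S | Cyc (r z) (r (m z)) (r y)} ⊂ {y ∈ S | Cyc (r u) (r (m u)) (r y)} := by
          refine ⟨fun t ht => ⟨ht.1, hsub _ ht.2⟩, fun hcon => ?_⟩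
          have := (hcon (show z ∈ {y ∈ S | Cyc (r u) (r (m u)) (r y)} from ⟨hz, h1⟩)).2
          unfold Cyc at this
          omega
        have := Set.ncard_lt_ncard hlt (hS.subset (Set.sep_subset _ _))
        omega
      -- The edge at `y` is directed so that `u` is not on its left; then its left side is strictly
      -- contained in that of the edge at `u`.
      by_cases hcu : Cyc (r y) (r (m y)) (r u)
      · refine main (m y) hmy ?_ hc' ?_ ?_ ?_
        · have e1 := h.inv y
          have e2 := h'.inv y
          unfold IsBad at *
          grind
        · rw [h.inv]; exact hc
        · rw [h.inv]; unfold Cyc at *; omega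
        · rw [h.inv]; exact hry
      · exact main y hy hgy hc hc' hcu hry.symm
  rcases hx.2.2 with hb | hb
  · exact key _ x hx hb le_rfl
  · refine key _ (m x) (hx.symm_edge h h') ?_ le_rfl
    rw [h.inv]; exact hb

theorem PairReach.contract {k : ℕ} {p q : (α → α) × α} (h : PairReach r S S k p q)
    (h0 : IsPairing r S p.1 p.2) (hr : Set.InjOn r S) (hu : u ∈ S) (hw : w ∈ S)
    (huw : u ≠ w) (hull : ∀ x ∈ S, ¬ Cyc (r u) (r w) (r x)) :
    PairReach r (S \ {u, w}) (S \ {u, w}) k (OddMatchings.contract u w p)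
      (OddMatchings.contract u w q) := by
  obtain ⟨f, rfl, rfl, hf⟩ := h
  have hp := pairReach_isPairing h0 hf
  refine ⟨fun i => OddMatchings.contract u w (f i), rfl, rfl, fun i hi => ?_⟩
  rcases hf i hi with h | h
  · left; simp only [h]
  · exact PairFlip.contract (hp i hi.le) hr hu hw huw hull h

/-- `T` stays fixed while `S` grows. With `T` the core, this records that the lifted flips use core
points only, which is what restricts the letters in the search. -/
theorem PairReach.addEdge {k : ℕ} {p q : (α → α) × α} (h : PairReach r T (S \ {u, w}) k p q)
    (h0 : IsPairing r (S \ {u, w}) p.1 p.2) (hr : Set.InjOn r S) (hu : u ∈ S) (hw : w ∈ S)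
    (huw : u ≠ w) (hull : ∀ x ∈ S, ¬ Cyc (r u) (r w) (r x)) :
    PairReach r T S k (OddMatchings.addEdge u w p) (OddMatchings.addEdge u w q) := by
  obtain ⟨f, rfl, rfl, hf⟩ := h
  have hp := pairReach_isPairing h0 hf
  refine ⟨fun i => OddMatchings.addEdge u w (f i), rfl, rfl, fun i hi => ?_⟩
  rcases hf i hi with h | h
  · left; simp only [h]
  · exact Or.inr (PairFlip.addEdge (hp i hi.le) h hr hu hw huw hull)

theorem addEdge_contract (h : IsPairing r S m v) (huw : u ≠ w) (he : m u = w) :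
    OddMatchings.addEdge u w (OddMatchings.contract u w (m, v)) = (m, v) := by
  have inv := h.inv
  have iso := h.iso
  simp only [OddMatchings.addEdge, OddMatchings.contract, Prod.mk.injEq]
  refine ⟨funext fun x => ?_, ?_⟩ <;> grind

theorem contract_eq_restrictTo (h : IsPairing r S m v) (huw : u ≠ w) (he : m u = w) :
    OddMatchings.contract u w (m, v) = (restrictTo (S \ {u, w}) m, v) := by
  have inv := h.inv
  have iso := h.iso
  have off := h.off
  simp only [OddMatchings.contract, Prod.mk.injEq]
  refine ⟨funext fun x => ?_, ?_⟩
  · simp only [restrictTo]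
    grind
  · grind

/-- Removing the good edges preserves the pairings and the reachability by flips. -/
theorem core_reduction (hS : S.Finite) (hr : Set.InjOn r S)
    (h : IsPairing r S m v) (h' : IsPairing r S m' v') :
    IsPairing r (core r S m m') (restrictTo (core r S m m') m) v ∧
    IsPairing r (core r S m m') (restrictTo (core r S m m') m') v' ∧
    (∀ k, PairReach r S S k (m, v) (m', v') →
      PairReach r (core r S m m') (core r S m m') k (restrictTo (core r S m m') m, v)
        (restrictTo (core r S m m') m', v')) ∧
    (∀ k T, PairReach r T (core r S m m') k (restrictTo (core r S m m') m, v)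
        (restrictTo (core r S m m') m', v') → PairReach r T S k (m, v) (m', v')) := by
  induction hN : S.ncard using Nat.strong_induction_on generalizing S m m' with
  | _ N ih =>
  by_cases hex : ∃ x, IsGood r S m m' x
  swap
  · have hcore : core r S m m' = S := by
      ext x
      simp only [core, Set.mem_sep_iff, and_iff_left_iff_imp]
      exact fun _ hx => hex ⟨x, hx⟩
    have hres : ∀ {m v}, IsPairing r S m v → restrictTo S m = m := by
      intro m v h
      funext x
      have := h.off x
      simp only [restrictTo]
      grind
    rw [hcore, hres h, hres h']
    exact ⟨h, h', fun _ h => h, fun _ _ h => h⟩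
  obtain ⟨x, hx⟩ := hex
  obtain ⟨u, hgu, hull⟩ := exists_hull_of_good hS hr h h' hx
  have hgw := hgu.symm_edge h h'
  obtain ⟨w, hw⟩ : ∃ w, w = m u := ⟨_, rfl⟩
  rw [← hw] at hull hgw
  have hbu := hgu.2.1
  have huw : u ≠ w := by unfold IsBad at hbu; grind
  have he' : m' u = w := by unfold IsBad at hbu; grind
  have huS := hgu.1
  have hwS := hgw.1
  have hwu : m w = u := by rw [hw, h.inv]
  have hwu' : m' w = u := by rw [← he', h'.inv]
  set S₁ := S \ {u, w} with hS₁
  have hc := h.contract hr huS hwS huw hull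
  have hc' := h'.contract hr huS hwS huw hull
  have e := contract_eq_restrictTo h huw hw.symm
  have e' := contract_eq_restrictTo h' huw he'
  have a := addEdge_contract h huw hw.symm
  have a' := addEdge_contract h' huw he'
  rw [e] at hc a
  rw [e'] at hc' a'
  have hbad : ∀ y ∈ S₁, (IsBad (restrictTo S₁ m) (restrictTo S₁ m') y ↔ IsBad m m' y) := by
    intro y hy
    simp only [IsBad, restrictTo, if_pos hy]
  -- No bad point is removed with `uw`, so a remaining point is good in `S₁` exactly if it is good
  -- in `S`, and both instances have the same core.
  have hbad2 : ∀ y ∈ S, IsBad m m' y → y ∈ S₁ := by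
    intro y hy hb
    refine ⟨hy, ?_⟩
    rintro (rfl | rfl)
    · exact hgu.2.1 hb
    · exact hgw.2.1 hb
  have hgood : ∀ y ∈ S₁, (IsGood r S₁ (restrictTo S₁ m) (restrictTo S₁ m') y ↔
      IsGood r S m m' y) := by
    intro y hy
    have e1 : restrictTo S₁ m y = m y := by simp only [restrictTo, if_pos hy]
    simp only [IsGood, hbad y hy, e1, hy, hy.1]
    refine and_congr_right fun _ => and_congr_right fun _ => or_congr ?_ ?_
    · exact ⟨fun H z hz hb => H z (hbad2 z hz hb) ((hbad z (hbad2 z hz hb)).2 hb),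
        fun H z hz hb => H z hz.1 ((hbad z hz).1 hb)⟩
    · exact ⟨fun H z hz hb => H z (hbad2 z hz hb) ((hbad z (hbad2 z hz hb)).2 hb),
        fun H z hz hb => H z hz.1 ((hbad z hz).1 hb)⟩
  have hcore : core r S₁ (restrictTo S₁ m) (restrictTo S₁ m') = core r S m m' := by
    ext y
    simp only [core, Set.mem_sep_iff]
    constructor
    · rintro ⟨hy, hg⟩
      exact ⟨hy.1, fun hc => hg ((hgood y hy).2 hc)⟩
    · rintro ⟨hy, hg⟩
      have hy1 : y ∈ S₁ := by
        refine ⟨hy, ?_⟩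
        rintro (rfl | rfl)
        · exact hg hgu
        · exact hg hgw
      exact ⟨hy1, fun hc => hg ((hgood y hy1).1 hc)⟩
  have hsub : core r S m m' ⊆ S₁ := by
    rw [← hcore]; exact Set.sep_subset _ _
  have hrr : ∀ g : α → α, restrictTo (core r S m m') (restrictTo S₁ g) =
      restrictTo (core r S m m') g := by
    intro g
    funext y
    simp only [restrictTo]
    by_cases hy : y ∈ core r S m m'
    · simp only [if_pos hy, if_pos (hsub hy)]
    · simp only [if_neg hy]
  have hlt : S₁.ncard < N := by
    rw [← hN]
    exact Set.ncard_lt_ncard ⟨Set.sdiff_subset, fun hcon => (hcon huS).2 (by simp)⟩ hS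
  have IH := ih _ hlt (hS.subset Set.sdiff_subset) (hr.mono Set.sdiff_subset) hc hc' rfl
  rw [hcore, hrr, hrr] at IH
  refine ⟨IH.1, IH.2.1, fun k hk => ?_, fun k T hk => ?_⟩
  · refine IH.2.2.1 k ?_
    have := hk.contract h hr huS hwS huw hull
    rwa [e, e'] at this
  · have := (IH.2.2.2 k T hk).addEdge hc hr huS hwS huw hull
    rwa [a, a'] at this

end
end OddMatchings

/-! ### The bound on the size of the core -/

namespace OddMatchings

section

variable {α : Type*} {r : α → ℕ} {S T : Set α} {m m' : α → α} {v v' u w : α}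

theorem not_cyc_self (a b : ℕ) : ¬ Cyc a a b ∧ ¬ Cyc a b a ∧ ¬ Cyc a b b := by
  unfold Cyc; omega

/-- Each flip destroys a single edge, and edges that survive keep the side without the isolated
point unchanged. -/
theorem exists_touched {f : ℕ → (α → α) × α} {k : ℕ}
    (h : IsPairing r S (f 0).1 (f 0).2)
    (hf : ∀ i < k, f (i + 1) = f i ∨ PairFlip r T S (f i) (f (i + 1))) :
    ∀ i ≤ k, ∃ D : Finset α, D.card ≤ 2 * i ∧ ∀ x ∈ S, x ∉ D → (f 0).1 x ≠ x →
      (f i).1 x = (f 0).1 x ∧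
      (Cyc (r x) (r ((f 0).1 x)) (r (f i).2) ↔ Cyc (r x) (r ((f 0).1 x)) (r (f 0).2)) ∧
      ∀ y ∈ S, ¬ (Cyc (r x) (r ((f 0).1 x)) (r y) ↔ Cyc (r x) (r ((f 0).1 x)) (r (f 0).2)) →
        y ≠ x → y ≠ (f 0).1 x → (f i).1 y = (f 0).1 y := by
  classical
  have hp := pairReach_isPairing h hf
  intro i
  induction i with
  | zero => exact fun _ => ⟨∅, by simp, by simp⟩
  | succ i ih =>
    intro hi
    obtain ⟨D, hD, H⟩ := ih (by omega)
    rcases hf i (by omega) with e | ⟨w, _, hw, _, hwv, e, _⟩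
    · exact ⟨D, by omega, by rw [e]; exact H⟩
    have h1 := hp i (by omega)
    have h2 := hp (i + 1) hi
    -- The flip destroys the edge from `w` to its current partner; both ends are recorded.
    refine ⟨insert w (insert ((f i).1 w) D), ?_, ?_⟩
    · have := Finset.card_insert_le w (insert ((f i).1 w) D)
      have := Finset.card_insert_le ((f i).1 w) D
      omega
    · intro x hx hxD hmx
      simp only [Finset.mem_insert, not_or] at hxD
      obtain ⟨hxw, hxw', hxD⟩ := hxD
      obtain ⟨H1, H2, H3⟩ := H x hx hxD hmx
      have hiso := h1.iso
      have hxv : x ≠ (f i).2 := by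
        rintro rfl
        rw [H1] at hiso
        exact hmx hiso
      have E1 : (f (i + 1)).1 = flipAt (f i).1 (f i).2 w := by rw [e]
      have E2 : (f (i + 1)).2 = (f i).1 w := by rw [e]
      have ex : (f (i + 1)).1 x = (f 0).1 x := by
        rw [E1, ← H1]; simp [flipAt, hxw, hxw', hxv]
      have ew : (f (i + 1)).1 w = (f i).2 := by
        rw [E1]; simp [flipAt, hwv]
      -- The edge at `x` crosses neither the removed edge at `w` nor the inserted one. So `w`, the
      -- old isolated point and the new one lie on the same side of it.
      have s1 := h1.nc x hx w hw
      have s2 := h2.nc x hx w hw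
      rw [ew, ex] at s2
      rw [H1] at s1
      refine ⟨ex, ?_, ?_⟩
      · rw [E2, ← s1, s2, H2]
      · intro y hy hside hyx hyx'
        have y1 : y ≠ w := by rintro rfl; exact hside (s2.trans H2)
        have y2 : y ≠ (f i).1 w := by rintro rfl; exact hside (s1.symm.trans (s2.trans H2))
        have y3 : y ≠ (f i).2 := by rintro rfl; exact hside H2
        rw [E1, ← H3 y hy hside hyx hyx']
        simp [flipAt, y1, y2, y3]

/-- A matched point outside the set `D` of touched points is good: its edge survives, and on the
side away from `v` no partner has changed. So the core lies in `D` together with `v`. -/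
theorem core_encard_le {k : ℕ} (h : IsPairing r S m v)
    (hk : PairReach r T S k (m, v) (m', v')) :
    (core r S m m').encard ≤ 2 * k + 1 := by
  classical
  obtain ⟨f, f0, fk, hf⟩ := hk
  obtain ⟨D, hD, H⟩ := exists_touched (by rw [f0]; exact h) hf k le_rfl
  rw [f0, fk] at H
  simp only at H
  have hsub : core r S m m' ⊆ (insert v D : Finset α) := by
    rintro x ⟨hx, hg⟩
    by_contra hcon
    simp only [Finset.coe_insert, Set.mem_insert_iff, Finset.mem_coe, not_or] at hcon
    have hmx : m x ≠ x := fun e => hcon.1 (h.uniq x hx e)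
    obtain ⟨H1, -, H3⟩ := H x hx hcon.2 hmx
    -- On the other side all partners agree, so a bad point there would be fixed by `m` and hence
    -- equal to `v`.
    have hbad : ∀ y ∈ S, IsBad m m' y → y ≠ x → y ≠ m x →
        (Cyc (r x) (r (m x)) (r y) ↔ Cyc (r x) (r (m x)) (r v)) := by
      intro y hy hb hyx hyx'
      by_contra hside
      have e := H3 y hy hside hyx hyx'
      have hyv : m y = y := by by_contra hne; exact hb ⟨e.symm, hne⟩
      exact hside (by rw [h.uniq y hy hyv])
    refine hg ⟨hx, fun hb => hb ⟨H1.symm, hmx⟩, ?_⟩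
    by_cases hv : Cyc (r x) (r (m x)) (r v)
    · right
      intro y hy hb
      by_cases hyx : y = x
      · rw [hyx]; exact (not_cyc_self _ _).2.2
      by_cases hyx' : y = m x
      · rw [hyx']; exact (not_cyc_self _ _).2.1
      have := (hbad y hy hb hyx hyx').2 hv
      unfold Cyc at *
      omega
    · left
      intro y hy hb
      by_cases hyx : y = x
      · rw [hyx]; exact (not_cyc_self _ _).2.1
      by_cases hyx' : y = m x
      · rw [hyx']; exact (not_cyc_self _ _).2.2
      rw [hbad y hy hb hyx hyx']
      exact hv
  refine (Set.encard_le_encard hsub).trans ?_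
  rw [Set.encard_coe_eq_coe_finsetCard]
  have := Finset.card_insert_le v D
  have h3 : (insert v D).card ≤ 2 * k + 1 := by omega
  exact_mod_cast h3

/-! ### Counting edges, and flip sequences as words of points -/

/-- The edges of a pairing. -/
def edgesOf (m : α → α) : Set (Sym2 α) := {e | ∃ x, m x ≠ x ∧ e = s(x, m x)}

theorem IsPairing.mk_mem_edgesOf (h : IsPairing r S m v) {x y : α} :
    s(x, y) ∈ edgesOf m ↔ m x = y ∧ x ≠ y := by
  have inv := h.inv
  constructor
  · rintro ⟨z, hz, e⟩
    rw [Sym2.eq_iff] at e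
    grind
  · rintro ⟨rfl, hne⟩
    exact ⟨x, hne.symm, rfl⟩

theorem IsPairing.card_edgesOf (h : IsPairing r S m v) (hS : S.Finite) :
    2 * (edgesOf m).encard + 1 = S.encard := by
  classical
  have inv := h.inv
  have hfin : (edgesOf m).Finite := by
    refine (hS.image fun x => s(x, m x)).subset ?_
    rintro e ⟨x, hx, rfl⟩
    exact ⟨x, by_contra fun hc => hx (h.off x hc), rfl⟩
  have hcover : S = (insert v (hfin.toFinset.biUnion Sym2.toFinset) : Finset α) := by
    ext x
    simp only [Finset.coe_insert, Finset.coe_biUnion, Set.Finite.coe_toFinset, Set.mem_insert_iff,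
      Set.mem_iUnion, Finset.mem_coe, Sym2.mem_toFinset, exists_prop]
    constructor
    · intro hx
      by_cases hxv : x = v
      · exact Or.inl hxv
      · exact Or.inr ⟨s(x, m x), ⟨x, fun e => hxv (h.uniq x hx e), rfl⟩, Sym2.mem_mk_left _ _⟩
    · rintro (rfl | ⟨e, ⟨y, hy, rfl⟩, hxy⟩)
      · exact h.mem
      · have hyS : y ∈ S := by_contra fun hc => hy (h.off y hc)
        rcases Sym2.mem_iff.1 hxy with rfl | rfl
        · exact hyS
        · exact h.maps hyS
  have hcard : (insert v (hfin.toFinset.biUnion Sym2.toFinset)).card =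
      2 * hfin.toFinset.card + 1 := by
    rw [Finset.card_insert_of_notMem, Finset.card_biUnion]
    · rw [Finset.sum_congr rfl (g := fun _ => 2)]
      · simp [mul_comm]
      · intro e he
        obtain ⟨x, hx, rfl⟩ := hfin.mem_toFinset.1 he
        exact Sym2.card_toFinset_of_not_isDiag _ (by simpa using hx.symm)
    · intro e he e' he' hne
      obtain ⟨x, hx, rfl⟩ := hfin.mem_toFinset.1 he
      obtain ⟨y, hy, rfl⟩ := hfin.mem_toFinset.1 he'
      rw [Function.onFun, Finset.disjoint_left]
      intro z hz hz'
      simp only [Sym2.mem_toFinset, Sym2.mem_iff] at hz hz'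
      refine hne (Sym2.eq_iff.2 ?_)
      grind
    · simp only [Finset.mem_biUnion, Set.Finite.mem_toFinset, Sym2.mem_toFinset, not_exists,
        not_and]
      rintro e ⟨x, hx, rfl⟩ hv
      have iso := h.iso
      rcases Sym2.mem_iff.1 hv with rfl | rfl
      · exact hx iso
      · rw [inv] at iso; exact hx iso.symm
  have h1 : (edgesOf m).encard = hfin.toFinset.card := hfin.encard_eq_coe_toFinset_card
  rw [h1, hcover, Set.encard_coe_eq_coe_finsetCard, hcard]
  push_cast
  rfl

open Classical in
/-- The flip of the pairing `p` to the partner `w`, if it is possible. -/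
noncomputable def tryFlip (r : α → ℕ) (S : Set α) (p : (α → α) × α) (w : α) : (α → α) × α :=
  if w ≠ p.2 ∧ IsPairing r S (flipAt p.1 p.2 w) (p.1 w) then (flipAt p.1 p.2 w, p.1 w) else p

/-- The result of the attempted flips to the partners `g 0, g 1, …`. -/
noncomputable def runWord (r : α → ℕ) (S : Set α) (p : (α → α) × α) (g : ℕ → α) :
    ℕ → (α → α) × α
  | 0 => p
  | i + 1 => tryFlip r S (runWord r S p g i) (g i)

theorem runWord_congr {p : (α → α) × α} {g g' : ℕ → α} {k : ℕ} (h : ∀ i < k, g i = g' i) :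
    runWord r S p g k = runWord r S p g' k := by
  induction k with
  | zero => rfl
  | succ k ih =>
    simp only [runWord]
    rw [ih fun i hi => h i (by omega), h k (by omega)]

theorem runWord_isPairing {p : (α → α) × α} (h : IsPairing r S p.1 p.2) (g : ℕ → α) (k : ℕ) :
    IsPairing r S (runWord r S p g k).1 (runWord r S p g k).2 := by
  induction k with
  | zero => exact h
  | succ k ih =>
    simp only [runWord, tryFlip]
    split_ifs with hc
    · exact hc.2
    · exact ih

theorem runWord_reach {p : (α → α) × α} (h : IsPairing r S p.1 p.2) {g : ℕ → α} {k : ℕ}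
    (hg : ∀ i < k, g i ∈ S) : PairReach r S S k p (runWord r S p g k) := by
  refine ⟨runWord r S p g, rfl, rfl, fun i hi => ?_⟩
  simp only [runWord, tryFlip]
  split_ifs with hc
  · exact Or.inr ⟨g i, hg i hi, hg i hi, (runWord_isPairing h g i).maps (hg i hi), hc.1, rfl, hc.2⟩
  · exact Or.inl rfl

theorem PairReach.exists_word {p q : (α → α) × α} {k : ℕ} (h : PairReach r T S k p q)
    (hp : p.2 ∈ T) : ∃ g : ℕ → α, (∀ i, g i ∈ T) ∧ runWord r S p g k = q := by
  obtain ⟨f, rfl, rfl, hf⟩ := h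
  have hT : ∀ i ≤ k, (f i).2 ∈ T := by
    intro i
    induction i with
    | zero => exact fun _ => hp
    | succ i ih =>
      intro hi
      rcases hf i (by omega) with e | ⟨w, _, _, hw, _, e, _⟩
      · rw [e]; exact ih (by omega)
      · rw [e]; exact hw
  have hstep : ∀ i, ∃ w ∈ T, i < k → tryFlip r S (f i) w = f (i + 1) := by
    intro i
    by_cases hi : i < k
    · rcases hf i hi with e | ⟨w, hw, _, _, hwv, e, hq⟩
      -- A pause is encoded by the isolated point itself, a letter that `tryFlip` ignores. This is
      -- why a `PairFlip` must also leave the new isolated point in `T`.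
      · exact ⟨(f i).2, hT i hi.le, fun _ => by rw [e]; simp [tryFlip]⟩
      · refine ⟨w, hw, fun _ => ?_⟩
        rw [e] at hq ⊢
        simp only [tryFlip, if_pos (And.intro hwv hq)]
    · exact ⟨(f 0).2, hp, fun h => absurd h hi⟩
  choose g hg hgf using hstep
  refine ⟨g, hg, ?_⟩
  have : ∀ i ≤ k, runWord r S (f 0) g i = f i := by
    intro i
    induction i with
    | zero => exact fun _ => rfl
    | succ i ih =>
      intro hi
      simp only [runWord]
      rw [ih (by omega), hgf i (by omega)]
  exact this k le_rfl

end
end OddMatchings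

namespace OddMatchings

/-! ### Points in convex position -/

/-- The weights are not normalised, so that orientation determinants can serve as weights, and `b`,
`c`, `d` may coincide, so that segments are covered too. -/
theorem not_barycenter {S : Set Plane} (hS : ConvexIndependent ℝ ((↑) : S → Plane))
    {a b c d : Plane} (ha : a ∈ S) (hb : b ∈ S) (hc : c ∈ S) (hd : d ∈ S)
    (hab : b ≠ a) (hac : c ≠ a) (had : d ≠ a) {α β γ : ℝ} (hα : 0 ≤ α) (hβ : 0 ≤ β) (hγ : 0 ≤ γ)
    (hpos : 0 < α + β + γ) (h1 : (α + β + γ) * a.1 = α * b.1 + β * c.1 + γ * d.1)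
    (h2 : (α + β + γ) * a.2 = α * b.2 + β * c.2 + γ * d.2) : False := by
  rw [convexIndependent_set_iff_notMem_convexHull_sdiff] at hS
  refine hS a ha ?_
  have hmem : ∀ {x}, x ∈ S → x ≠ a → x ∈ convexHull ℝ (S \ {a}) :=
    fun hx hne => subset_convexHull ℝ _ ⟨hx, hne⟩
  have := (convex_convexHull ℝ (S \ {a})).sum_mem (t := Finset.univ)
    (w := ![α / (α + β + γ), β / (α + β + γ), γ / (α + β + γ)]) (z := ![b, c, d]) (by
      intro i _
      fin_cases i <;> simp <;> positivity) (by
      simp [Fin.sum_univ_three]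
      field_simp) (by
      intro i _
      fin_cases i
      · exact hmem hb hab
      · exact hmem hc hac
      · exact hmem hd had)
  convert this using 1
  simp only [Fin.sum_univ_three]
  ext
  · simp
    field_simp
    linarith
  · simp
    field_simp
    linarith

section

variable {S : Set Plane}

theorem turn_ne_zero (hS : ConvexIndependent ℝ ((↑) : S → Plane)) {a b c : Plane}
    (ha : a ∈ S) (hb : b ∈ S) (hc : c ∈ S) (hab : a ≠ b) (hac : a ≠ c) (hbc : b ≠ c) : turn a b c ≠ 0 := by
  intro h
  have hd : (b.1 - a.1) ^ 2 + (b.2 - a.2) ^ 2 ≠ 0 := by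
    intro h0
    apply hab
    ext <;> nlinarith [sq_nonneg (b.1 - a.1), sq_nonneg (b.2 - a.2)]
  -- By collinearity `c = a + t (b - a)`. According to whether `t ≤ 0`, `0 ≤ t ≤ 1` or `t ≥ 1`, the
  -- point in the middle is `a`, `c` or `b`.
  obtain ⟨t, ht⟩ : ∃ t, t = ((b.1 - a.1) * (c.1 - a.1) + (b.2 - a.2) * (c.2 - a.2)) /
    ((b.1 - a.1) ^ 2 + (b.2 - a.2) ^ 2) := ⟨_, rfl⟩
  unfold turn at h
  have h1 : c.1 = a.1 + t * (b.1 - a.1) := by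
    rw [ht]
    field_simp
    linear_combination (-(b.2 - a.2)) * h
  have h2 : c.2 = a.2 + t * (b.2 - a.2) := by
    rw [ht]
    field_simp
    linear_combination (b.1 - a.1) * h
  rcases le_total t 0 with h0 | h0
  · refine not_barycenter hS ha hb hc hc hab.symm hac.symm hac.symm (α := -t) (β := 1) (γ := 0)
      (by linarith) zero_le_one le_rfl (by linarith) ?_ ?_
    · rw [h1]; ring
    · rw [h2]; ring
  rcases le_total t 1 with h3 | h3
  · refine not_barycenter hS hc ha hb hb hac hbc hbc (α := 1 - t) (β := t) (γ := 0)
      (by linarith) h0 le_rfl (by linarith) ?_ ?_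
    · rw [h1]; ring
    · rw [h2]; ring
  · refine not_barycenter hS hb ha hc hc hab hbc.symm hbc.symm (α := t - 1) (β := 1) (γ := 0)
      (by linarith) zero_le_one le_rfl (by linarith) ?_ ?_
    · rw [h1]; ring
    · rw [h2]; ring

/-- In general `turn a c d • (b - a) - turn a b d • (c - a) + turn a b c • (d - a) = 0`. If `turn a
b d ≤ 0`, this writes `a` as a convex combination of the other three points. -/
theorem turn_trans (hS : ConvexIndependent ℝ ((↑) : S → Plane))
    {a b c d : Plane} (ha : a ∈ S) (hb : b ∈ S) (hc : c ∈ S) (hd : d ∈ S)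
    (h1 : 0 < turn a b c) (h2 : 0 < turn a c d) : 0 < turn a b d := by
  by_contra hcon
  have hab : b ≠ a := by rintro rfl; simp [turn] at h1
  have hac : c ≠ a := by rintro rfl; simp [turn] at h2
  have had : d ≠ a := by rintro rfl; simp [turn] at h2
  refine not_barycenter hS ha hb hc hd hab hac had (α := turn a c d) (β := - turn a b d)
    (γ := turn a b c) h2.le (by linarith) h1.le (by linarith) ?_ ?_
  · unfold turn; ring
  · unfold turn; ring

/-- Seen from a base point `o` of `S`, the sign of `turn o x y` is a strict linear order on the
other points, by `turn_trans` and `turn_ne_zero`. The rank counts predecessors in this order, with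
`o` first. -/
theorem exists_rank (hS : ConvexIndependent ℝ ((↑) : S → Plane)) (hfin : S.Finite) :
    ∃ r : Plane → ℕ, Set.InjOn r S ∧
      ∀ a ∈ S, ∀ b ∈ S, ∀ c ∈ S, (0 < turn a b c ↔ Cyc (r a) (r b) (r c)) := by
  classical
  rcases S.eq_empty_or_nonempty with rfl | ⟨o, ho⟩
  · exact ⟨fun _ => 0, by simp, by simp⟩
  have swap : ∀ a b c, turn a c b = - turn a b c := by intro a b c; unfold turn; ring
  have rot : ∀ a b c, turn b c a = turn a b c := by intro a b c; unfold turn; ring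
  obtain ⟨r, hr⟩ : ∃ r : Plane → ℕ, r = fun x => if x = o then 0 else
    1 + {y ∈ S | 0 < turn o y x}.ncard := ⟨_, rfl⟩
  have hro : r o = 0 := by simp [hr]
  have hpos : ∀ x, x ≠ o → 0 < r x := by intro x hx; simp only [hr, if_neg hx]; omega
  have hlt : ∀ x ∈ S, ∀ y ∈ S, 0 < turn o x y → r x < r y := by
    intro x hx y hy h
    have hxo : x ≠ o := by rintro rfl; simp [turn] at h
    have hyo : y ≠ o := by rintro rfl; simp [turn] at h
    simp only [hr, if_neg hxo, if_neg hyo]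
    have : {z ∈ S | 0 < turn o z x} ⊂ {z ∈ S | 0 < turn o z y} := by
      refine ⟨fun z hz => ⟨hz.1, turn_trans hS ho hz.1 hx hy hz.2 h⟩, fun hc => ?_⟩
      have := (hc (show x ∈ {z ∈ S | 0 < turn o z y} from ⟨hx, h⟩)).2
      simp [turn, mul_comm] at this
    have := Set.ncard_lt_ncard this (hfin.subset (Set.sep_subset _ _))
    omega
  have htri : ∀ x ∈ S, ∀ y ∈ S, x ≠ o → y ≠ o → x ≠ y → 0 < turn o x y ∨ 0 < turn o y x := by
    intro x hx y hy hxo hyo hxy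
    have := turn_ne_zero hS ho hx hy hxo.symm hyo.symm hxy
    rw [swap o x y]
    rcases lt_or_gt_of_ne this with h | h
    · right; linarith
    · left; exact h
  have hinj : Set.InjOn r S := by
    intro x hx y hy hxy
    by_contra hne
    by_cases hxo : x = o
    · subst hxo
      have := hpos y (Ne.symm hne)
      omega
    by_cases hyo : y = o
    · subst hyo
      have := hpos x hne
      omega
    rcases htri x hx y hy hxo hyo hne with h | h
    · have := hlt x hx y hy h; omega
    · have := hlt y hy x hx h; omega
  have hlt' : ∀ x ∈ S, ∀ y ∈ S, x ≠ o → r x < r y → 0 < turn o x y := by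
    intro x hx y hy hxo h
    have hyo : y ≠ o := by rintro rfl; omega
    rcases htri x hx y hy hxo hyo (by rintro rfl; omega) with h' | h'
    · exact h'
    · have := hlt y hy x hx h'; omega
  have hinc : ∀ a ∈ S, ∀ b ∈ S, ∀ c ∈ S, r a < r b → r b < r c → 0 < turn a b c := by
    intro a ha b hb c hc h1 h2
    have hbo : b ≠ o := by rintro rfl; omega
    by_cases hao : a = o
    · subst hao; exact hlt' b hb c hc hbo h2
    have t1 := hlt' a ha b hb hao h1
    have t2 := hlt' b hb c hc hbo h2
    rw [← rot a b c]
    -- Transitivity around `b`: the turns from `c` to `o` and from `o` to `a` are both positive.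
    refine turn_trans hS hb hc ho ha ?_ ?_
    · rwa [rot]
    · rwa [← rot]
  have hcyc : ∀ a ∈ S, ∀ b ∈ S, ∀ c ∈ S, Cyc (r a) (r b) (r c) → 0 < turn a b c := by
    rintro a ha b hb c hc (h | h | h)
    · exact hinc a ha b hb c hc h.1 h.2
    · rw [← rot]; exact hinc b hb c hc a ha h.1 h.2
    · rw [← rot, ← rot]; exact hinc c hc a ha b hb h.1 h.2
  refine ⟨r, hinj, fun a ha b hb c hc => ⟨fun h => ?_, hcyc a ha b hb c hc⟩⟩
  by_contra hcon
  have hab : a ≠ b := by rintro rfl; simp [turn] at h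
  have hac : a ≠ c := by rintro rfl; simp [turn] at h
  have hbc : b ≠ c := by rintro rfl; simp [turn, mul_comm] at h
  have h1 : r a ≠ r b := fun e => hab (hinj ha hb e)
  have h2 : r a ≠ r c := fun e => hac (hinj ha hc e)
  have h3 : r b ≠ r c := fun e => hbc (hinj hb hc e)
  have : Cyc (r a) (r c) (r b) := by unfold Cyc at *; omega
  have := hcyc a ha c hc b hb this
  rw [swap] at this
  linarith

/-- In convex position it suffices that the line through one segment separates the ends of the
other: in the cyclic order the four points then alternate, so the separation is mutual. -/
theorem disjoint_segment_iff (hS : ConvexIndependent ℝ ((↑) : S → Plane))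
    (hfin : S.Finite) {a b c d : Plane} (ha : a ∈ S) (hb : b ∈ S)
    (hc : c ∈ S) (hd : d ∈ S) (hab : a ≠ b) (hac : a ≠ c) (had : a ≠ d) (hbc : b ≠ c)
    (hbd : b ≠ d) (hcd : c ≠ d) :
    Disjoint (segment ℝ a b) (segment ℝ c d) ↔ (0 < turn a b c ↔ 0 < turn a b d) := by
  have nc := turn_ne_zero hS ha hb hc hab hac hbc
  have nd := turn_ne_zero hS ha hb hd hab had hbd
  constructor
  · intro hdis
    by_contra hcon
    obtain ⟨r, hr, hcyc⟩ := exists_rank hS hfin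
    have hcon' : ¬ (0 < turn c d a ↔ 0 < turn c d b) := by
      rw [hcyc a ha b hb c hc, hcyc a ha b hb d hd] at hcon
      rw [hcyc c hc d hd a ha, hcyc c hc d hd b hb]
      have h1 : r a ≠ r c := fun e => hac (hr ha hc e)
      have h2 : r a ≠ r d := fun e => had (hr ha hd e)
      have h3 : r b ≠ r c := fun e => hbc (hr hb hc e)
      have h4 : r b ≠ r d := fun e => hbd (hr hb hd e)
      unfold Cyc at *
      omega
    have na := turn_ne_zero hS hc hd ha hcd hac.symm had.symm
    have nb := turn_ne_zero hS hc hd hb hcd hbc.symm hbd.symm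
    have opp : ∀ s t : ℝ, s ≠ 0 → t ≠ 0 → ¬ (0 < s ↔ 0 < t) →
        0 ≤ t / (t - s) ∧ 0 ≤ - s / (t - s) ∧ t - s ≠ 0 := by
      intro s t hs ht h
      rcases lt_or_gt_of_ne hs with h1 | h1 <;> rcases lt_or_gt_of_ne ht with h2 | h2
      · exact absurd ⟨fun h => by linarith, fun h => by linarith⟩ h
      · refine ⟨?_, ?_, by linarith⟩ <;> apply div_nonneg <;> linarith
      · refine ⟨div_nonneg_of_nonpos ?_ ?_, div_nonneg_of_nonpos ?_ ?_, by linarith⟩ <;> linarith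
      · exact absurd ⟨fun _ => h2, fun _ => h1⟩ h
    obtain ⟨o1, o2, o3⟩ := opp _ _ nc nd hcon
    obtain ⟨o4, o5, o6⟩ := opp _ _ na nb hcon'
    rw [Set.disjoint_left] at hdis
    -- The intersection of the two lines, in barycentric coordinates. They are nonnegative because
    -- the two orientations have opposite signs.
    refine hdis (a := (turn c d b / (turn c d b - turn c d a)) • a +
      (- turn c d a / (turn c d b - turn c d a)) • b) ?_ ?_
    · exact ⟨_, _, o4, o5, by field_simp; ring, rfl⟩
    · refine ⟨_, _, o1, o2, by field_simp; ring, ?_⟩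
      ext
      · simp only [Prod.fst_add, Prod.smul_fst, smul_eq_mul]
        field_simp
        unfold turn; ring
      · simp only [Prod.snd_add, Prod.smul_snd, smul_eq_mul]
        field_simp
        unfold turn; ring
  · intro h
    rw [Set.disjoint_left]
    rintro z ⟨x, y, hx, hy, hxy, rfl⟩ ⟨x', y', hx', hy', hxy', e⟩
    have e1 : x' * c.1 + y' * d.1 = x * a.1 + y * b.1 := by simpa using congrArg Prod.fst e
    have e2 : x' * c.2 + y' * d.2 = x * a.2 + y * b.2 := by simpa using congrArg Prod.snd e
    -- The affine function `turn a b` vanishes on the line `ab`, hence at the common point; but its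
    -- values at `c` and `d` have the same strict sign.
    have key : x' * turn a b c + y' * turn a b d = 0 := by
      obtain rfl : x = 1 - y := by linarith
      obtain rfl : x' = 1 - y' := by linarith
      unfold turn
      linear_combination (-(b.2 - a.2)) * e1 + (b.1 - a.1) * e2
    rcases lt_or_gt_of_ne nc with h1 | h1
    · have h2 : turn a b d < 0 := lt_of_le_of_ne (not_lt.1 fun hh => by linarith [h.2 hh]) nd
      rcases hx'.lt_or_eq with h3 | h3
      · nlinarith
      · nlinarith
    · have h2 := h.1 h1
      rcases hx'.lt_or_eq with h3 | h3
      · nlinarith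
      · nlinarith

end
end OddMatchings

namespace OddMatchings

/-! ### Odd matchings as pairings -/

/-- The ranks `r` describe the cyclic order of the points `S` in convex position. -/
structure IsRank (r : Plane → ℕ) (S : Set Plane) : Prop where
  inj : Set.InjOn r S
  cyc : ∀ a ∈ S, ∀ b ∈ S, ∀ c ∈ S, (0 < turn a b c ↔ Cyc (r a) (r b) (r c))
  disj : ∀ a ∈ S, ∀ b ∈ S, ∀ c ∈ S, ∀ d ∈ S, a ≠ b → a ≠ c → a ≠ d → b ≠ c → b ≠ d → c ≠ d →
    (Disjoint (segment ℝ a b) (segment ℝ c d) ↔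
      (Cyc (r a) (r b) (r c) ↔ Cyc (r a) (r b) (r d)))

theorem exists_isRank {S : Set Plane} (hS : ConvexIndependent ℝ ((↑) : S → Plane))
    (hfin : S.Finite) : ∃ r, IsRank r S := by
  obtain ⟨r, h1, h2⟩ := exists_rank hS hfin
  refine ⟨r, h1, h2, fun a ha b hb c hc d hd h3 h4 h5 h6 h7 h8 => ?_⟩
  rw [disjoint_segment_iff hS hfin ha hb hc hd h3 h4 h5 h6 h7 h8, h2 a ha b hb c hc,
    h2 a ha b hb d hd]

theorem IsRank.mono {r : Plane → ℕ} {S T : Set Plane} (h : IsRank r S) (hT : T ⊆ S) :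
    IsRank r T :=
  ⟨h.inj.mono hT, fun a ha b hb c hc => h.cyc a (hT ha) b (hT hb) c (hT hc),
    fun a ha b hb c hc d hd => h.disj a (hT ha) b (hT hb) c (hT hc) d (hT hd)⟩

section

variable {r : Plane → ℕ} {S T : Set Plane} {m m' : Plane → Plane} {v v' : Plane}

theorem IsPairing.isolated_iff {α : Type*} {r : α → ℕ} {S : Set α} {m : α → α} {v : α}
    (h : IsPairing r S m v) {x : α} : (x ∈ S ∧ ∀ e ∈ edgesOf m, x ∉ e) ↔ x = v := by
  constructor
  · rintro ⟨hx, hiso⟩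
    by_contra hne
    exact hiso s(x, m x) ⟨x, fun e => hne (h.uniq x hx e), rfl⟩ (Sym2.mem_mk_left _ _)
  · rintro rfl
    refine ⟨h.mem, ?_⟩
    rintro e ⟨y, hy, rfl⟩ hmem
    have iso := h.iso
    have inv := h.inv
    rcases Sym2.mem_iff.1 hmem with rfl | rfl
    · exact hy iso
    · rw [inv] at iso; exact hy iso.symm

theorem IsPairing.isOddMatching (hR : IsRank r S) (h : IsPairing r S m v) :
    IsOddMatching S (edgesOf m) := by
  have inv := h.inv
  have hmem : ∀ x, m x ≠ x → x ∈ S := fun x hx => by_contra fun hc => hx (h.off x hc)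
  have hmat : ∀ e ∈ edgesOf m, ∀ f ∈ edgesOf m, e ≠ f → ∀ x ∈ e, x ∉ f := by
    rintro e ⟨x, hx, rfl⟩ f ⟨y, hy, rfl⟩ hne z hz hz'
    refine hne (Sym2.eq_iff.2 ?_)
    rw [Sym2.mem_iff] at hz hz'
    grind
  refine ⟨?_, ?_, hmat, ?_, ?_⟩
  · rintro e ⟨x, hx, rfl⟩
    simpa using hx.symm
  · rintro e ⟨x, hx, rfl⟩ y hy
    rcases Sym2.mem_iff.1 hy with rfl | rfl
    · exact hmem _ hx
    · exact h.maps (hmem x hx)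
  · rintro e ⟨x, hx, rfl⟩ f ⟨y, hy, rfl⟩ hne
    have h1 := hmat _ ⟨x, hx, rfl⟩ _ ⟨y, hy, rfl⟩ hne x (Sym2.mem_mk_left _ _)
    have h2 := hmat _ ⟨x, hx, rfl⟩ _ ⟨y, hy, rfl⟩ hne (m x) (Sym2.mem_mk_right _ _)
    rw [Sym2.mem_iff, not_or] at h1 h2
    exact (hR.disj _ (hmem x hx) _ (h.maps (hmem x hx)) _ (hmem y hy) _ (h.maps (hmem y hy))
      hx.symm h1.1 h1.2 h2.1 h2.2 hy.symm).2 (h.nc x (hmem x hx) y (hmem y hy))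
  · exact ⟨v, h.isolated_iff.2 rfl, fun y hy => h.isolated_iff.1 hy⟩

theorem IsOddMatching.exists_isPairing (hR : IsRank r S) {M : Set (Sym2 Plane)}
    (h : IsOddMatching S M) : ∃ m v, IsPairing r S m v ∧ M = edgesOf m := by
  classical
  have huniq : ∀ x y z, s(x, y) ∈ M → s(x, z) ∈ M → y = z := by
    intro x y z hy hz
    by_contra hne
    exact h.matching _ hy _ hz (fun e => hne (Sym2.congr_right.1 e)) x (Sym2.mem_mk_left _ _)
      (Sym2.mem_mk_left _ _)
  have hS : ∀ x y, s(x, y) ∈ M → x ∈ S ∧ y ∈ S := fun x y hxy =>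
    ⟨h.endpoints_mem _ hxy x (Sym2.mem_mk_left _ _), h.endpoints_mem _ hxy y (Sym2.mem_mk_right _ _)⟩
  obtain ⟨m, hm⟩ : ∃ m : Plane → Plane, ∀ x, (s(x, m x) ∈ M) ∨ (m x = x ∧ ∀ y, s(x, y) ∉ M) := by
    refine ⟨fun x => if h : ∃ y, s(x, y) ∈ M then h.choose else x, fun x => ?_⟩
    by_cases hx : ∃ y, s(x, y) ∈ M
    · left
      simp only [dif_pos hx]
      exact hx.choose_spec
    · right
      simp only [dif_neg hx, true_and]
      exact fun y hy => hx ⟨y, hy⟩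
  have hnd : ∀ x y, s(x, y) ∈ M → x ≠ y := fun x y hxy e => h.nondegenerate _ hxy (by simpa using e)
  have hedge : ∀ x y, s(x, y) ∈ M ↔ m x = y ∧ x ≠ y := by
    intro x y
    constructor
    · intro hxy
      rcases hm x with h1 | h1
      · exact ⟨huniq x _ _ h1 hxy, hnd x y hxy⟩
      · exact absurd hxy (h1.2 y)
    · rintro ⟨rfl, hne⟩
      rcases hm x with h1 | h1
      · exact h1
      · exact absurd h1.1.symm hne
  have hM : M = edgesOf m := by
    ext e
    induction e with
    | _ x y =>
    rw [hedge]
    constructor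
    · rintro ⟨rfl, hne⟩
      exact ⟨x, hne.symm, rfl⟩
    · rintro ⟨z, hz, e⟩
      rw [← hedge, e, hedge]
      exact ⟨rfl, hz.symm⟩
  have hinv : ∀ x, m (m x) = x := by
    intro x
    by_cases hx : m x = x
    · rw [hx, hx]
    · have := (hedge x (m x)).2 ⟨rfl, Ne.symm hx⟩
      rw [Sym2.eq_swap] at this
      exact ((hedge _ _).1 this).1
  obtain ⟨v, hv, hvu⟩ := h.isolated
  have hmv : m v = v := by
    by_contra hne
    exact hv.2 _ ((hedge v (m v)).2 ⟨rfl, Ne.symm hne⟩) (Sym2.mem_mk_left _ _)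
  have hmaps : ∀ x ∈ S, m x ∈ S := by
    intro x hx
    by_cases hmx : m x = x
    · rwa [hmx]
    · exact (hS _ _ ((hedge x (m x)).2 ⟨rfl, Ne.symm hmx⟩)).2
  refine ⟨m, v, ⟨hinv, ?_, hv.1, hmv, ?_, ?_⟩, hM⟩
  · intro x hx
    by_contra hne
    exact hx (hS _ _ ((hedge x (m x)).2 ⟨rfl, Ne.symm hne⟩)).1
  · intro x hx hmx
    refine hvu x ⟨hx, fun e he hxe => ?_⟩
    obtain ⟨y, rfl⟩ := hxe
    have := (hedge x y).1 he
    grind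
  · intro x hx y hy
    by_cases hmx : m x = x
    · simp [hmx, not_cyc_self]
    by_cases hmy : m y = y
    · rw [hmy]
    by_cases hyx : y = x
    · subst hyx; simp [not_cyc_self]
    by_cases hyx' : y = m x
    · subst hyx'; simp [not_cyc_self, hinv]
    have e1 := (hedge x (m x)).2 ⟨rfl, Ne.symm hmx⟩
    have e2 := (hedge y (m y)).2 ⟨rfl, Ne.symm hmy⟩
    refine (hR.disj x hx _ (hmaps x hx) y hy _ (hmaps y hy) (Ne.symm hmx) (Ne.symm hyx) ?_
      (Ne.symm hyx') ?_ (Ne.symm hmy)).1 (h.noncrossing _ e1 _ e2 ?_)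
    · grind
    · grind
    · intro e
      rw [Sym2.eq_iff] at e
      grind

theorem IsPairing.eq_of_edgesOf_eq (h : IsPairing r S m v) (h' : IsPairing r S m' v')
    (e : edgesOf m = edgesOf m') : (m, v) = (m', v') := by
  have hm : m = m' := by
    funext x
    by_cases hx : m x = x
    · by_contra hne
      have := h'.mk_mem_edgesOf.2 ⟨rfl, fun h0 => hne (hx.trans h0)⟩
      rw [← e, h.mk_mem_edgesOf] at this
      exact hne this.1
    · have := h.mk_mem_edgesOf.2 ⟨rfl, Ne.symm hx⟩
      rw [e, h'.mk_mem_edgesOf] at this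
      exact this.1.symm
  subst hm
  rw [h'.uniq v h.mem h.iso]

/-- The reverse flip joins the new isolated point to the same `w`, which frees the old isolated
point. -/
theorem PairFlip.symm {p q : (Plane → Plane) × Plane} (hp : IsPairing r S p.1 p.2)
    (h : PairFlip r S S p q) : PairFlip r S S q p := by
  obtain ⟨m, v⟩ := p
  obtain ⟨w, hw, _, hmw, hwv, rfl, hq⟩ := h
  simp only at hwv hq hmw hp
  have inv := hp.inv
  have iso := hp.iso
  have uniq := hp.uniq
  refine ⟨w, hw, hw, ?_, ?_, ?_, hp⟩
  · simp only [flipAt]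
    have := hp.mem
    grind
  · simp only
    grind
  · simp only [Prod.mk.injEq]
    refine ⟨?_, ?_⟩
    · funext x
      simp only [flipAt]
      clear hq
      grind
    · simp only [flipAt]
      grind

/-- The odd matching given by a pairing. -/
def IsPairing.toOddMatching (hR : IsRank r S) (h : IsPairing r S m v) : OddMatching S :=
  ⟨edgesOf m, h.isOddMatching hR⟩

theorem isFlip_iff_pairFlip (hR : IsRank r S) (h : IsPairing r S m v)
    (h' : IsPairing r S m' v') :
    IsFlip (h.toOddMatching hR) (h'.toOddMatching hR) ↔ PairFlip r S S (m, v) (m', v') := by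
  have inv := h.inv
  have inv' := h'.inv
  constructor
  · rintro ⟨v₀, hv₀, e, ⟨x, hx, rfl⟩, f, hvf, hN⟩
    obtain rfl : v₀ = v := h.isolated_iff.1 hv₀
    change edgesOf m' = edgesOf m \ _ ∪ _ at hN
    obtain ⟨w, rfl⟩ := hvf
    have hf : s(v₀, w) ∈ edgesOf m' := by rw [hN]; simp
    obtain ⟨hvw, hne⟩ := h'.mk_mem_edgesOf.1 hf
    have hwS : w ∈ S := by
      by_contra hc
      have := h'.off w hc
      rw [← hvw, inv'] at this
      exact hne (this.trans hvw)
    have hwv : m' w = v₀ := by rw [← hvw, inv']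
    have hmw : m w ≠ w := fun e => hne (h.uniq w hwS e).symm
    have iso := h.iso
    have hkeep : ∀ a b, m a = b → a ≠ b → s(a, b) ≠ s(x, m x) → m' a = b := by
      intro a b h1 h2 h3
      refine (h'.mk_mem_edgesOf.1 (?_ : s(a, b) ∈ edgesOf m')).1
      rw [hN]
      exact Or.inl ⟨h.mk_mem_edgesOf.2 ⟨h1, h2⟩, h3⟩
    -- The removed edge is the one at `w`: otherwise `w` would keep its partner, although it is now
    -- matched to `v₀`.
    have hx' : s(w, m w) = s(x, m x) := by
      by_contra hcon
      have := hkeep w (m w) rfl (Ne.symm hmw) hcon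
      grind
    rw [← hx'] at hN hkeep
    have hiso' : m' (m w) = m w := by
      by_contra hcon
      have : s(m w, m' (m w)) ∈ edgesOf m' := h'.mk_mem_edgesOf.2 ⟨rfl, Ne.symm hcon⟩
      rw [hN] at this
      rcases this with ⟨h1, h2⟩ | h1
      · have := (h.mk_mem_edgesOf.1 h1).1
        rw [inv] at this
        rw [← this] at h2
        exact h2 Sym2.eq_swap
      · rw [Set.mem_singleton_iff, Sym2.eq_iff] at h1
        grind
    refine ⟨w, hwS, hwS, h.maps hwS, hne.symm, ?_, h'⟩
    simp only [Prod.mk.injEq]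
    refine ⟨?_, (h'.uniq _ (h.maps hwS) hiso').symm⟩
    funext y
    simp only [flipAt]
    by_cases h1 : y = v₀
    · simp [h1, hvw]
    by_cases h2 : y = w
    · simp [h2, hwv, hne.symm]
    by_cases h3 : y = m w
    · subst h3
      simp [h1, hmw, hiso']
    rw [if_neg h1, if_neg h2, if_neg h3]
    by_cases h4 : m y = y
    · by_cases hyS : y ∈ S
      · exact absurd (h.uniq y hyS h4) h1
      · rw [h'.off y hyS, h4]
    · refine hkeep y (m y) rfl (Ne.symm h4) ?_
      intro e
      rw [Sym2.eq_iff] at e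
      grind
  · rintro ⟨w, hw, _, _, hwv, e, -⟩
    simp only [Prod.mk.injEq] at e hwv
    obtain ⟨rfl, rfl⟩ := e
    have iso := h.iso
    have hmw : m w ≠ w := fun e => hwv (h.uniq w hw e)
    refine ⟨v, h.isolated_iff.2 rfl, s(w, m w), ⟨w, hmw, rfl⟩, s(v, w), Sym2.mem_mk_left _ _, ?_⟩
    change edgesOf _ = edgesOf m \ _ ∪ _
    ext e
    induction e with
    | _ x y =>
    rw [h'.mk_mem_edgesOf, Set.mem_union, Set.mem_sdiff, h.mk_mem_edgesOf, Set.mem_singleton_iff,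
      Set.mem_singleton_iff, Sym2.eq_iff, Sym2.eq_iff]
    simp only [flipAt]
    clear h'
    grind

theorem adj_iff_pairFlip (hR : IsRank r S) (h : IsPairing r S m v) (h' : IsPairing r S m' v') :
    (flipGraph S).Adj (h.toOddMatching hR) (h'.toOddMatching hR) ↔
      PairFlip r S S (m, v) (m', v') := by
  rw [flipGraph, SimpleGraph.fromRel_adj, isFlip_iff_pairFlip, isFlip_iff_pairFlip]
  constructor
  · rintro ⟨-, h1 | h1⟩
    · exact h1
    · exact h1.symm h'
  · intro h1
    refine ⟨fun e => ?_, Or.inl h1⟩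
    have := h.eq_of_edgesOf_eq h' (congrArg Subtype.val e)
    obtain ⟨w, hw, _, _, hwv, e', -⟩ := h1
    rw [← this] at e'
    have e2 := congrFun (congrArg Prod.fst e') v
    have iso := h.iso
    simp only [flipAt, if_true] at e2
    exact hwv (e2.symm.trans iso)

theorem PairReach.mono_length {α : Type*} {r : α → ℕ} {S T : Set α} {k l : ℕ} (hkl : k ≤ l)
    {p q : (α → α) × α} (h : PairReach r T S k p q) : PairReach r T S l p q := by
  obtain ⟨f, h0, hk, hf⟩ := h
  refine ⟨fun i => f (min i k), by simpa using h0, by simpa [hkl] using hk, fun i hi => ?_⟩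
  by_cases hik : i < k
  · simpa [min_eq_left hik.le, min_eq_left (Nat.succ_le_of_lt hik)] using hf i hik
  · left
    simp only [min_eq_right (not_lt.1 hik), min_eq_right ((not_lt.1 hik).trans (Nat.le_succ i))]

theorem PairReach.cons {α : Type*} {r : α → ℕ} {S T : Set α} {k : ℕ}
    {p p' q : (α → α) × α} (h : PairFlip r T S p p') (hk : PairReach r T S k p' q) :
    PairReach r T S (k + 1) p q := by
  obtain ⟨f, h0, h1, hf⟩ := hk
  refine ⟨fun i => Nat.casesOn i p f, rfl, h1, fun i hi => ?_⟩
  cases i with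
  | zero => right; simpa [h0] using h
  | succ i => exact hf i (by omega)

theorem flipDist_le_iff (hR : IsRank r S) (h : IsPairing r S m v) (h' : IsPairing r S m' v')
    (k : ℕ) : flipDist (h.toOddMatching hR) (h'.toOddMatching hR) ≤ k ↔
      PairReach r S S k (m, v) (m', v') := by
  constructor
  · intro hd
    have hwalk : ∀ (A B : OddMatching S) (W : (flipGraph S).Walk A B) (m m' : Plane → Plane)
        (v v' : Plane) (h : IsPairing r S m v) (h' : IsPairing r S m' v'),
        A = h.toOddMatching hR → B = h'.toOddMatching hR →
        PairReach r S S W.length (m, v) (m', v') := by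
      intro A B W
      induction W with
      | nil =>
        intro m m' v v' h h' e1 e2
        have := h.eq_of_edgesOf_eq h' (congrArg Subtype.val (e1.symm.trans e2))
        rw [this]
        exact ⟨fun _ => (m', v'), rfl, rfl, fun i _ => Or.inl rfl⟩
      | @cons A B C hadj W ih =>
        intro m m' v v' h h' e1 e2
        obtain ⟨m₁, v₁, h₁, e⟩ := IsOddMatching.exists_isPairing hR B.2
        have e3 : B = h₁.toOddMatching hR := Subtype.ext e
        rw [e1, e3] at hadj
        exact PairReach.cons ((adj_iff_pairFlip hR h h₁).1 hadj) (ih m₁ m' v₁ v' h₁ h' e3 e2)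
    have hreach : (flipGraph S).Reachable (h.toOddMatching hR) (h'.toOddMatching hR) := by
      apply SimpleGraph.reachable_of_edist_ne_top
      intro e
      unfold flipDist at hd
      rw [e] at hd
      simp at hd
    obtain ⟨W, hW⟩ := hreach.exists_walk_length_eq_edist
    refine (hwalk _ _ W m m' v v' h h' rfl rfl).mono_length ?_
    unfold flipDist at hd
    rw [← hW] at hd
    exact_mod_cast hd
  · rintro ⟨f, h0, hk, hf⟩
    have hp := pairReach_isPairing (by rw [h0]; exact h) hf
    have key : ∀ i (hi : i ≤ k), flipDist (h.toOddMatching hR) ((hp i hi).toOddMatching hR) ≤ i := by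
      intro i
      induction i with
      | zero =>
        intro hi
        have : (hp 0 hi).toOddMatching hR = h.toOddMatching hR := by
          apply Subtype.ext
          simp [IsPairing.toOddMatching, h0]
        rw [this]
        simp [flipDist]
      | succ i ih =>
        intro hi
        have hi' : i ≤ k := by omega
        have h1 := ih hi'
        rcases hf i (by omega) with e | e
        · have : (hp (i + 1) hi).toOddMatching hR = (hp i hi').toOddMatching hR := by
            apply Subtype.ext
            simp [IsPairing.toOddMatching, e]
          rw [this]
          exact h1.trans (by exact_mod_cast Nat.le_succ i)
        · have hadj := (adj_iff_pairFlip hR (hp i hi') (hp (i + 1) hi)).2 e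
          refine (SimpleGraph.edist_triangle (v := (hp i hi').toOddMatching hR)).trans ?_
          push_cast
          exact add_le_add h1 (SimpleGraph.edist_eq_one_iff_adj.2 hadj).le
    have := key k le_rfl
    convert this using 2
    apply Subtype.ext
    simp [IsPairing.toOddMatching, hk]

end
end OddMatchings

/-! ### Good happy edges as good points, and the count of flip sequences -/

namespace OddMatchings

section

variable {r : Plane → ℕ} {S : Set Plane} {m m' : Plane → Plane} {v v' : Plane}

theorem IsPairing.isBad_isolated {α : Type*} {r : α → ℕ} {S : Set α} {m m' : α → α} {v : α}
    (h : IsPairing r S m v) : IsBad m m' v := fun hc => hc.2 h.iso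

theorem isHappy_iff (h : IsPairing r S m v) (h' : IsPairing r S m' v') (x y : Plane) :
    IsHappy (edgesOf m) (edgesOf m') s(x, y) ↔ m x = y ∧ m' x = y ∧ x ≠ y := by
  rw [IsHappy, h.mk_mem_edgesOf, h'.mk_mem_edgesOf]
  tauto

theorem cyc_swap_of_not {a b c : ℕ} (hab : a ≠ b) (hac : a ≠ c) (hbc : b ≠ c) (h : ¬ Cyc a b c) :
    Cyc b a c := by
  unfold Cyc at *; omega

theorem not_cyc_swap {a b c : ℕ} (h : Cyc a b c) : ¬ Cyc b a c := by
  unfold Cyc at *; omega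

/-- On a side without the isolated point of the first matching, every point lies on an edge of that
matching, and the edge stays on that side. So all edges there are happy exactly if no point there is
bad. -/
theorem isGoodHappy_iff (hR : IsRank r S) (h : IsPairing r S m v) (h' : IsPairing r S m' v')
    (e : Sym2 Plane) : IsGoodHappy S (edgesOf m) (edgesOf m') e ↔
      ∃ x, IsGood r S m m' x ∧ e = s(x, m x) := by
  constructor
  · rintro ⟨hhappy, ⟨u, w, rfl, hull⟩ | ⟨u, w, rfl, ⟨x, hx, hxl⟩, hall⟩⟩
    · obtain ⟨h1, h2, h3⟩ := (isHappy_iff h h' u w).1 hhappy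
      have hu : u ∈ S := by_contra fun hc => h3 ((h.off u hc).symm.trans h1)
      refine ⟨u, ⟨hu, fun hb => hb ⟨h1.trans h2.symm, by rw [h1]; exact h3.symm⟩, Or.inl ?_⟩,
        by rw [h1]⟩
      intro y hy _ hc
      rw [← hR.cyc u hu _ (h.maps hu) y hy, h1] at hc
      have : y ∈ S ∩ leftOf u w := ⟨hy, hc⟩
      rw [hull] at this
      exact this
    · obtain ⟨h1, h2, h3⟩ := (isHappy_iff h h' u w).1 hhappy
      have hu : u ∈ S := by_contra fun hc => h3 ((h.off u hc).symm.trans h1)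
      obtain rfl : x = v := h.isolated_iff.1 hx
      subst h1
      refine ⟨u, ⟨hu, fun hb => hb ⟨h2.symm, h3.symm⟩, Or.inl ?_⟩, rfl⟩
      intro y hy hb hc
      have hxl' := (hR.cyc _ (h.maps hu) u hu x h.mem).1 hxl
      have hmy : m y ≠ y := by
        intro e
        rw [h.uniq y hy e] at hc
        exact not_cyc_swap hc hxl'
      have hc' := (h.nc u hu y hy).1 hc
      have := hall s(y, m y) (Or.inl ⟨y, hmy, rfl⟩) (by
        intro z hz
        rcases Sym2.mem_iff.1 hz with rfl | rfl
        · exact (hR.cyc _ hu _ (h.maps hu) _ hy).2 hc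
        · exact (hR.cyc _ hu _ (h.maps hu) _ (h.maps hy)).2 hc')
      exact hb ⟨((isHappy_iff h h' _ _).1 this).2.1.symm, hmy⟩
  -- Even for hull edges the second alternative can be used: `v` is bad, so it lies on the side
  -- opposite to the one without bad points.
  · have main : ∀ x, x ∈ S → ¬ IsBad m m' x →
        (∀ y ∈ S, IsBad m m' y → ¬ Cyc (r x) (r (m x)) (r y)) →
        IsGoodHappy S (edgesOf m) (edgesOf m') s(x, m x) := by
      intro x hx hb hall
      obtain ⟨h1, h2⟩ := not_not.1 hb
      refine ⟨(isHappy_iff h h' _ _).2 ⟨rfl, h1.symm, h2.symm⟩, Or.inr ⟨x, m x, rfl,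
        ⟨v, h.isolated_iff.2 rfl, ?_⟩, ?_⟩⟩
      · refine (hR.cyc _ (h.maps hx) _ hx _ h.mem).2 (cyc_swap_of_not ?_ ?_ ?_
          (hall v h.mem h.isBad_isolated))
        · exact fun e => h2 (hR.inj (h.maps hx) hx e.symm)
        · intro e
          have := hR.inj hx h.mem e
          rw [this] at h2
          exact h2 h.iso
        · intro e
          have := hR.inj (h.maps hx) h.mem e
          have iso := h.iso
          rw [← this, h.inv] at iso
          exact h2 iso.symm
      · intro f hf hleft
        induction f with
        | _ a b =>
        have ha := hleft a (Sym2.mem_mk_left _ _)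
        have haS : a ∈ S := by
          by_contra hc
          rcases hf with hf | hf
          · have := h.mk_mem_edgesOf.1 hf
            exact this.2 ((h.off a hc).symm.trans this.1)
          · have := h'.mk_mem_edgesOf.1 hf
            exact this.2 ((h'.off a hc).symm.trans this.1)
        have hgood : ¬ IsBad m m' a := fun hbad =>
          hall a haS hbad ((hR.cyc _ hx _ (h.maps hx) _ haS).1 ha)
        obtain ⟨g1, g2⟩ := not_not.1 hgood
        rw [isHappy_iff h h']
        rcases hf with hf | hf
        · have := h.mk_mem_edgesOf.1 hf
          exact ⟨this.1, g1 ▸ this.1, this.2⟩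
        · have := h'.mk_mem_edgesOf.1 hf
          exact ⟨g1.trans this.1, this.1, this.2⟩
    rintro ⟨x, ⟨hx, hb, hall | hall⟩, rfl⟩
    · exact main x hx hb hall
    · have hb' : ¬ IsBad m m' (m x) := by
        have e1 := h.inv x
        have e2 := h'.inv x
        unfold IsBad at *
        grind
      have := main (m x) (h.maps hx) hb' (by rw [h.inv]; exact hall)
      rwa [h.inv, Sym2.eq_swap] at this

theorem kernelPoints_eq_core (hR : IsRank r S) (h : IsPairing r S m v)
    (h' : IsPairing r S m' v') :
    kernelPoints S (edgesOf m) (edgesOf m') = core r S m m' := by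
  ext x
  simp only [kernelPoints, core, Set.mem_sep_iff, isGoodHappy_iff hR h h']
  refine and_congr_right fun hx => ?_
  constructor
  · intro hall hg
    exact hall _ ⟨x, hg, rfl⟩ (Sym2.mem_mk_left _ _)
  · rintro hng e ⟨y, hy, rfl⟩ hxy
    rcases Sym2.mem_iff.1 hxy with rfl | rfl
    · exact hng hy
    · exact hng (hy.symm_edge h h')

theorem kernelEdges_eq {m₀ : Plane → Plane} {v₀ : Plane} (hR : IsRank r S)
    (h : IsPairing r S m v) (h' : IsPairing r S m' v') (h₀ : IsPairing r S m₀ v₀)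
    (hagree : ∀ x, IsGood r S m m' x → m₀ x = m x) :
    kernelEdges S (edgesOf m) (edgesOf m') (edgesOf m₀) =
      edgesOf (restrictTo (core r S m m') m₀) := by
  ext e
  simp only [kernelEdges, Set.mem_sep_iff, isGoodHappy_iff hR h h']
  constructor
  · rintro ⟨⟨x, hx, rfl⟩, hng⟩
    have hxS : x ∈ S := by_contra fun hc => hx (h₀.off x hc)
    have hcore : x ∈ core r S m m' :=
      ⟨hxS, fun hg => hng ⟨x, hg, by rw [hagree x hg]⟩⟩
    refine ⟨x, ?_, ?_⟩ <;> simp only [restrictTo, if_pos hcore]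
    exact hx
  · rintro ⟨x, hx, rfl⟩
    by_cases hcore : x ∈ core r S m m'
    · simp only [restrictTo, if_pos hcore] at hx ⊢
      refine ⟨⟨x, hx, rfl⟩, ?_⟩
      rintro ⟨y, hy, e⟩
      rcases Sym2.eq_iff.1 e with ⟨rfl, -⟩ | ⟨rfl, -⟩
      · exact hcore.2 hy
      · exact hcore.2 (hy.symm_edge h h')
    · simp only [restrictTo, if_neg hcore] at hx
      exact absurd rfl hx

/-- A neighbour is determined by the new partner of `v`. -/
theorem encard_neighbors_le (hR : IsRank r S) (h : IsPairing r S m v) :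
    {N | (flipGraph S).Adj (h.toOddMatching hR) N}.encard ≤ (S \ {v}).encard := by
  have hinj : Set.InjOn (fun N : OddMatching S => N.1)
      {N | (flipGraph S).Adj (h.toOddMatching hR) N} := fun a _ b _ e => Subtype.ext e
  rw [← hinj.encard_image]
  refine (Set.encard_le_encard (t := (fun w => edgesOf (flipAt m v w)) '' (S \ {v})) ?_).trans
    (Set.encard_image_le _ _)
  rintro _ ⟨N, hN, rfl⟩
  obtain ⟨m₁, v₁, h₁, e⟩ := IsOddMatching.exists_isPairing hR N.2
  have e3 : N = h₁.toOddMatching hR := Subtype.ext e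
  have hN' : (flipGraph S).Adj (h.toOddMatching hR) N := hN
  rw [e3] at hN'
  obtain ⟨w, hw, _, _, hwv, e', -⟩ := (adj_iff_pairFlip hR h h₁).1 hN'
  refine ⟨w, ⟨hw, hwv⟩, ?_⟩
  simp only [Prod.mk.injEq] at e'
  exact (congrArg edgesOf e'.1).symm.trans e.symm

theorem encard_flipSequences_le {D : ℕ}
    (hD : ∀ M : OddMatching S, {N | (flipGraph S).Adj M N}.encard ≤ D) (M : OddMatching S)
    (j : ℕ) : (flipSequences M j).encard ≤ (D : ℕ∞) ^ j := by
  induction j generalizing M with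
  | zero =>
    rw [pow_zero, Set.encard_le_one_iff]
    intro a b ha hb
    funext i
    obtain rfl : i = 0 := Fin.fin_one_eq_zero i
    rw [ha.1, hb.1]
  | succ j ih =>
    have hfin : {N | (flipGraph S).Adj M N}.Finite :=
      Set.finite_of_encard_le_coe (hD M)
    have hsub : flipSequences M (j + 1) ⊆ ⋃ N ∈ hfin.toFinset,
        (fun w : Fin (j + 1) → OddMatching S => (Fin.cons M w : Fin (j + 2) → OddMatching S)) ''
          flipSequences N j := by
      intro w hw
      simp only [Set.mem_iUnion, Set.Finite.mem_toFinset]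
      refine ⟨w 1, ?_, Fin.tail w, ⟨rfl, fun i => ?_⟩, ?_⟩
      · have := hw.2 0
        rw [Fin.castSucc_zero, hw.1] at this
        exact this
      · have := hw.2 i.succ
        simpa [Fin.tail] using this
      · change (Fin.cons M (Fin.tail w) : Fin (j + 2) → OddMatching S) = w
        rw [← hw.1, Fin.cons_self_tail]
    refine (Set.encard_le_encard hsub).trans ?_
    refine (Finset.set_encard_biUnion_le _ _).trans ?_
    calc _ ≤ ∑ N ∈ hfin.toFinset, (D : ℕ∞) ^ j :=
          Finset.sum_le_sum fun N _ => (Set.encard_image_le _ _).trans (ih N)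
      _ = (hfin.toFinset.card : ℕ∞) * (D : ℕ∞) ^ j := by simp
      _ ≤ D * (D : ℕ∞) ^ j := by
          refine mul_le_mul_left ?_ _
          rw [← hfin.encard_eq_coe_toFinset_card]
          exact hD M
      _ = _ := by rw [pow_succ, mul_comm]

theorem kernel_reduction (hfin : S.Finite) (hS : ConvexIndependent ℝ ((↑) : S → Plane))
    (M M' : OddMatching S) :
    ∃ N N' : OddMatching (kernelPoints S M.1 M'.1),
      N.1 = kernelEdges S M.1 M'.1 M.1 ∧ N'.1 = kernelEdges S M.1 M'.1 M'.1 ∧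
      flipDist N N' = flipDist M M' ∧
      (∀ k : ℕ, flipDist M M' ≤ k →
        N.1.encard ≤ k ∧ N'.1.encard ≤ k ∧ (kernelPoints S M.1 M'.1).encard ≤ 2 * k + 1) ∧
      (∀ k : ℕ, N.1.encard ≤ k → ∀ j ≤ k, (flipSequences N j).encard ≤ (2 * k) ^ j) := by
  obtain ⟨r, hR⟩ := exists_isRank hS hfin
  obtain ⟨m, v, h, e⟩ := IsOddMatching.exists_isPairing hR M.2
  obtain ⟨m', v', h', e'⟩ := IsOddMatching.exists_isPairing hR M'.2
  obtain rfl : M = h.toOddMatching hR := Subtype.ext e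
  obtain rfl : M' = h'.toOddMatching hR := Subtype.ext e'
  obtain ⟨h₀, h₀', r1, r2⟩ := core_reduction hfin hR.inj h h'
  have k1 := kernelEdges_eq hR h h' h (fun _ _ => rfl)
  have k2 := kernelEdges_eq hR h h' h' (fun x hx => (not_not.1 hx.2.1).1.symm)
  have hpts := kernelPoints_eq_core hR h h'
  -- The point set occurs in the type of `N` and `N'`, so it is replaced by a variable before it is
  -- identified with the core.
  suffices H : ∀ K, K = core r S m m' → ∃ N N' : OddMatching K,
      N.1 = edgesOf (restrictTo (core r S m m') m) ∧
      N'.1 = edgesOf (restrictTo (core r S m m') m') ∧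
      flipDist N N' = flipDist (h.toOddMatching hR) (h'.toOddMatching hR) ∧
      (∀ k : ℕ, flipDist (h.toOddMatching hR) (h'.toOddMatching hR) ≤ k →
        N.1.encard ≤ k ∧ N'.1.encard ≤ k ∧ K.encard ≤ 2 * k + 1) ∧
      (∀ k : ℕ, N.1.encard ≤ k → ∀ j ≤ k, (flipSequences N j).encard ≤ (2 * k) ^ j) by
    obtain ⟨N, N', h1, h2, h3⟩ := H _ hpts
    exact ⟨N, N', h1.trans k1.symm, h2.trans k2.symm, h3⟩
  rintro K rfl
  have hsub : core r S m m' ⊆ S := Set.sep_subset _ _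
  have hR₀ := hR.mono hsub
  have hfin₀ := hfin.subset hsub
  have hcard := h₀.card_edgesOf hfin₀
  have hcard' := h₀'.card_edgesOf hfin₀
  have half : ∀ (a : ℕ∞) (k : ℕ), 2 * a + 1 ≤ 2 * k + 1 → a ≤ k := by
    intro a k hak
    induction a using ENat.recTopCoe with
    | top =>
      rw [ENat.mul_top (by simp), top_add, top_le_iff] at hak
      exact absurd hak (by exact_mod_cast ENat.natCast_ne_top (2 * k + 1))
    | coe a => norm_cast at *; omega
  refine ⟨h₀.toOddMatching hR₀, h₀'.toOddMatching hR₀, rfl, rfl, ?_, ?_, ?_⟩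
  · have hiff : ∀ k : ℕ, flipDist (h₀.toOddMatching hR₀) (h₀'.toOddMatching hR₀) ≤ k ↔
        flipDist (h.toOddMatching hR) (h'.toOddMatching hR) ≤ k := by
      intro k
      rw [flipDist_le_iff, flipDist_le_iff]
      refine ⟨fun hk => ?_, r1 k⟩
      -- The lifted flips have their letters in the core; this extra information is dropped by
      -- enlarging `T` to `S`.
      obtain ⟨f, f0, fk, hf⟩ := r2 k _ hk
      refine ⟨f, f0, fk, fun i hi => (hf i hi).imp_right ?_⟩
      rintro ⟨w, hw, hwS, hmw, hq⟩
      exact ⟨w, hwS, hwS, hsub hmw, hq⟩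
    have hle : ∀ a b : ℕ∞, (∀ k : ℕ, b ≤ k → a ≤ k) → a ≤ b := by
      intro a b hab
      induction b using ENat.recTopCoe with
      | top => exact le_top
      | coe b => exact hab b le_rfl
    exact le_antisymm (hle _ _ fun k => (hiff k).2) (hle _ _ fun k => (hiff k).1)
  · intro k hk
    have hcore := core_encard_le h ((flipDist_le_iff hR h h' k).1 hk)
    exact ⟨half _ _ (hcard.trans_le hcore), half _ _ (hcard'.trans_le hcore), hcore⟩
  · intro k hk j _
    -- All odd matchings on the core leave the same number of candidate partners, namely all points
    -- but one, which is twice the number of edges of `N`.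
    have hD : ∀ A : OddMatching (core r S m m'), {N | (flipGraph _).Adj A N}.encard ≤
        ((2 * k : ℕ) : ℕ∞) := by
      intro A
      obtain ⟨m₁, v₁, h₁, e₁⟩ := IsOddMatching.exists_isPairing hR₀ A.2
      obtain rfl : A = h₁.toOddMatching hR₀ := Subtype.ext e₁
      refine (encard_neighbors_le hR₀ h₁).trans ?_
      have h2 := Set.encard_sdiff_singleton_add_one h₁.mem
      rw [← hcard] at h2
      have h3 := (WithTop.add_right_inj (by simp : (1 : ℕ∞) ≠ ⊤)).1 h2
      rw [h3]
      push_cast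
      exact mul_le_mul_right hk _
    have := encard_flipSequences_le hD (h₀.toOddMatching hR₀) j
    push_cast at this
    exact this

end
end OddMatchings

namespace OddMatchings

/-! ### Structured commands

The cells from `2 * n + 2` on are used as eight interleaved arrays; array `0` holds scalar
variables. -/

/-- The contents of the arrays. -/
abbrev Store : Type := ℕ → ℕ → ℕ

/-- The memory with the input `inp` in the first cells, and the arrays after it. -/
def encode (inp : Memory) (σ : Store) : Memory := fun x =>
  if x < 2 * inp 0 + 2 then inp x else σ ((x - (2 * inp 0 + 2)) % 8) ((x - (2 * inp 0 + 2)) / 8)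

/-- The store `σ` with the value `z` in cell `i` of array `a`. -/
def Store.put (σ : Store) (a i z : ℕ) : Store := fun b j => if b = a ∧ j = i then z else σ b j

/-- The expression `2 * e`. -/
def Expr.double (e : Expr) : Expr := .add e e

/-- The address of cell `i` of array `a`. -/
def Expr.addr (a : ℕ) (i : Expr) : Expr :=
  .add (.add (.add (.load (.const 0)) (.load (.const 0))) (.const 2))
    (.add i.double.double.double (.const a))

/-- The content of cell `i` of array `a`. -/
def Expr.cell (a : ℕ) (i : Expr) : Expr := .load (.addr a i)

/-- The content of the scalar variable `x`. -/
def Expr.var (x : ℕ) : Expr := .cell 0 (.const x)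

section

variable {o : ℕ → ℕ → ℕ → ℕ} {inp : Memory} {σ : Store}

theorem encode_low {x : ℕ} (hx : x < 2 * inp 0 + 2) : encode inp σ x = inp x := if_pos hx

theorem encode_array {a : ℕ} (ha : a < 8) (i : ℕ) :
    encode inp σ (2 * inp 0 + 2 + (8 * i + a)) = σ a i := by
  unfold encode
  rw [if_neg (by omega), Nat.add_sub_cancel_left]
  congr 1 <;> omega

theorem update_encode {a : ℕ} (ha : a < 8) (i z : ℕ) :
    Function.update (encode inp σ) (2 * inp 0 + 2 + (8 * i + a)) z = encode inp (σ.put a i z) := by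
  funext x
  unfold encode Store.put
  by_cases hx : x = 2 * inp 0 + 2 + (8 * i + a)
  · subst hx
    rw [Function.update_self, if_neg (by omega), if_pos (by omega)]
  · rw [Function.update_of_ne hx]
    by_cases hlow : x < 2 * inp 0 + 2
    · rw [if_pos hlow, if_pos hlow]
    · rw [if_neg hlow, if_neg hlow, if_neg (by omega)]

/-- Cell `0` is excluded because it determines where the arrays start. -/
theorem update_encode_low {i : ℕ} (h0 : i ≠ 0) (hi : i < 2 * inp 0 + 2) (z : ℕ) :
    Function.update (encode inp σ) i z = encode (Function.update inp i z) σ := by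
  funext x
  unfold encode
  rw [Function.update_of_ne (Ne.symm h0)]
  by_cases hx : x = i
  · subst hx
    rw [Function.update_self, if_pos hi, Function.update_self]
  · rw [Function.update_of_ne hx, Function.update_of_ne hx]

theorem eval_size : Expr.eval o (encode inp σ) (.load (.const 0)) = inp 0 :=
  encode_low (show 0 < _ by omega)

theorem eval_addr (a : ℕ) (i : Expr) :
    Expr.eval o (encode inp σ) (.addr a i) =
      2 * inp 0 + 2 + (8 * i.eval o (encode inp σ) + a) := by
  simp only [Expr.addr, Expr.double, Expr.eval, encode_low (σ := σ) (show 0 < 2 * inp 0 + 2 by omega)]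
  ring

theorem eval_cell {a : ℕ} (ha : a < 8) (i : Expr) :
    Expr.eval o (encode inp σ) (.cell a i) = σ a (i.eval o (encode inp σ)) := by
  rw [Expr.cell, Expr.eval, eval_addr, encode_array ha]

theorem eval_var (x : ℕ) : Expr.eval o (encode inp σ) (.var x) = σ 0 x :=
  eval_cell (by omega) _

end

/-- Structured commands, with loops whose number of rounds is given by an input cell. -/
inductive Cmd : Type
  | skip
  | setVar (x : ℕ) (e : Expr)
  | setArr (a : ℕ) (i e : Expr)
  | seq (c d : Cmd)
  | ite (e : Expr) (c d : Cmd)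
  | repeatTo (b x : ℕ) (c : Cmd)

namespace Cmd

/-- The program for a command. -/
def compile : Cmd → Prog
  | skip => .skip
  | setVar x e => .store (.addr 0 (.const x)) e
  | setArr a i e => .store (.addr (a + 1) i) e
  | seq c d => .seq c.compile d.compile
  | ite e c d => .ite e c.compile d.compile
  | repeatTo b x c => .seq (.store (.addr 0 (.const x)) (.const 0))
      (.loop (.sub (.load (.const b)) (.var x))
        (.seq c.compile (.store (.addr 0 (.const x)) (.add (.var x) (.const 1)))))

/-- The effect of a command on the store. -/
def sem (o : ℕ → ℕ → ℕ → ℕ) (inp : Memory) : Cmd → Store → Store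
  | skip, σ => σ
  | setVar x e, σ => σ.put 0 x (e.eval o (encode inp σ))
  | setArr a i e, σ => σ.put (a + 1) (i.eval o (encode inp σ)) (e.eval o (encode inp σ))
  | seq c d, σ => d.sem o inp (c.sem o inp σ)
  | ite e c d, σ => if e.eval o (encode inp σ) ≠ 0 then c.sem o inp σ else d.sem o inp σ
  | repeatTo b x c, σ =>
      Store.put (Nat.rec σ (fun i τ => c.sem o inp (Store.put τ 0 x i)) (inp b)) 0 x (inp b)

/-- A bound for the number of steps of a command. -/
def time (inp : Memory) : Cmd → ℕ
  | skip => 1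
  | setVar x e => (Expr.addr 0 (.const x)).cost + e.cost + 1
  | setArr a i e => (Expr.addr (a + 1) i).cost + e.cost + 1
  | seq c d => c.time inp + d.time inp
  | ite e c d => e.cost + max (c.time inp) (d.time inp) + 1
  | repeatTo b _ c => inp b * (c.time inp + 84) + 57

/-- The command does not assign to the scalar variable `x`. -/
def avoidsVar (x : ℕ) : Cmd → Bool
  | skip => true
  | setVar y _ => x != y
  | setArr _ _ _ => true
  | seq c d => c.avoidsVar x && d.avoidsVar x
  | ite _ c d => c.avoidsVar x && d.avoidsVar x
  | repeatTo _ y c => x != y && c.avoidsVar x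

/-- The command does not assign to array `a + 1`. -/
def avoidsArr (a : ℕ) : Cmd → Bool
  | skip => true
  | setVar _ _ => true
  | setArr b _ _ => a != b
  | seq c d => c.avoidsArr a && d.avoidsArr a
  | ite _ c d => c.avoidsArr a && d.avoidsArr a
  | repeatTo _ _ c => c.avoidsArr a

/-- Arrays are in range, and loop variables are not assigned to in the loop. -/
def wellFormed : Cmd → Bool
  | skip => true
  | setVar _ _ => true
  | setArr a _ _ => a < 7
  | seq c d => c.wellFormed && d.wellFormed
  | ite _ c d => c.wellFormed && d.wellFormed
  | repeatTo b x c => b < 2 && c.wellFormed && c.avoidsVar x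

variable {o : ℕ → ℕ → ℕ → ℕ} {inp : Memory}

theorem sem_skip (σ : Store) : skip.sem o inp σ = σ := rfl

theorem sem_seq (c d : Cmd) (σ : Store) :
    (seq c d).sem o inp σ = d.sem o inp (c.sem o inp σ) := rfl

theorem sem_setVar (x : ℕ) (e : Expr) (σ : Store) :
    (setVar x e).sem o inp σ = σ.put 0 x (e.eval o (encode inp σ)) := rfl

theorem sem_setArr (a : ℕ) (i e : Expr) (σ : Store) :
    (setArr a i e).sem o inp σ =
      σ.put (a + 1) (i.eval o (encode inp σ)) (e.eval o (encode inp σ)) := rfl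

theorem sem_ite_pos {e : Expr} {σ : Store} (h : e.eval o (encode inp σ) ≠ 0) (c d : Cmd) :
    (ite e c d).sem o inp σ = c.sem o inp σ := if_pos h

theorem sem_ite_neg {e : Expr} {σ : Store} (h : ¬ e.eval o (encode inp σ) ≠ 0) (c d : Cmd) :
    (ite e c d).sem o inp σ = d.sem o inp σ := if_neg h

theorem sem_avoidsVar {x : ℕ} {c : Cmd} (h : c.avoidsVar x = true) (σ : Store) :
    c.sem o inp σ 0 x = σ 0 x := by
  induction c generalizing σ with
  | skip => rfl
  | setVar y e =>
    simp only [avoidsVar, bne_iff_ne] at h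
    simp [sem, Store.put, h]
  | setArr a i e => simp [sem, Store.put]
  | seq c d hc hd =>
    simp only [avoidsVar, Bool.and_eq_true] at h
    simp only [sem]
    rw [hd h.2, hc h.1]
  | ite e c d hc hd =>
    simp only [avoidsVar, Bool.and_eq_true] at h
    simp only [sem]
    split_ifs
    · exact hc h.1 σ
    · exact hd h.2 σ
  | repeatTo b y c hc =>
    simp only [avoidsVar, Bool.and_eq_true, bne_iff_ne] at h
    simp only [sem, Store.put, h.1, and_false, if_false]
    induction inp b with
    | zero => rfl
    | succ n ih =>
      simp only
      rw [hc h.2]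
      simpa [Store.put, h.1] using ih

theorem sem_avoidsArr {a : ℕ} {c : Cmd} (h : c.avoidsArr a = true) (σ : Store) :
    c.sem o inp σ (a + 1) = σ (a + 1) := by
  induction c generalizing σ with
  | skip => rfl
  | setVar y e => funext j; simp [sem, Store.put]
  | setArr b i e =>
    simp only [avoidsArr, bne_iff_ne] at h
    funext j
    simp [sem, Store.put, h]
  | seq c d hc hd =>
    simp only [avoidsArr, Bool.and_eq_true] at h
    simp only [sem]
    rw [hd h.2, hc h.1]
  | ite e c d hc hd =>
    simp only [avoidsArr, Bool.and_eq_true] at h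
    simp only [sem]
    split_ifs
    · exact hc h.1 σ
    · exact hd h.2 σ
  | repeatTo b y c hc =>
    simp only [avoidsArr] at h
    funext j
    simp only [sem, Store.put, Nat.add_eq_zero_iff, one_ne_zero, and_false, false_and, if_false]
    induction inp b with
    | zero => rfl
    | succ n ih =>
      simp only
      rw [hc h]
      simpa [Store.put] using ih

/-- The invariant rule for loops. The loop variable is set before each round, and at the end it
holds the number of rounds. -/
theorem sem_repeatTo {b x : ℕ} {c : Cmd} {σ : Store} {Q : Store → Prop} (I : ℕ → Store → Prop)
    (h0 : I 0 σ) (hstep : ∀ i < inp b, ∀ τ, I i τ → I (i + 1) (c.sem o inp (τ.put 0 x i)))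
    (hend : ∀ τ, I (inp b) τ → Q (τ.put 0 x (inp b))) :
    Q ((repeatTo b x c).sem o inp σ) := by
  simp only [sem]
  apply hend
  have : ∀ n ≤ inp b, I n (Nat.rec σ (fun i τ => c.sem o inp (Store.put τ 0 x i)) n) := by
    intro n
    induction n with
    | zero => exact fun _ => h0
    | succ n ih => exact fun hn => hstep n (by omega) _ (ih (by omega))
  exact this _ le_rfl

theorem exec_compile {c : Cmd} (h : c.wellFormed = true) (σ : Store) :
    ∃ t ≤ c.time inp, Exec o c.compile (encode inp σ) t (encode inp (c.sem o inp σ)) := by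
  induction c generalizing σ with
  | skip => exact ⟨1, le_rfl, .skip _⟩
  | setVar x e =>
    refine ⟨_, le_rfl, ?_⟩
    have := Exec.store (o := o) (.addr 0 (.const x)) e (encode inp σ)
    rwa [eval_addr, update_encode (by omega)] at this
  | setArr a i e =>
    simp only [wellFormed, decide_eq_true_eq] at h
    refine ⟨_, le_rfl, ?_⟩
    have := Exec.store (o := o) (.addr (a + 1) i) e (encode inp σ)
    rwa [eval_addr, update_encode (by omega)] at this
  | seq c d hc hd =>
    simp only [wellFormed, Bool.and_eq_true] at h
    obtain ⟨t₁, h₁, e₁⟩ := hc h.1 σ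
    obtain ⟨t₂, h₂, e₂⟩ := hd h.2 (c.sem o inp σ)
    exact ⟨t₁ + t₂, add_le_add h₁ h₂, .seq e₁ e₂⟩
  | ite e c d hc hd =>
    simp only [wellFormed, Bool.and_eq_true] at h
    simp only [sem, time]
    split_ifs with he
    · obtain ⟨t, ht, e₁⟩ := hc h.1 σ
      exact ⟨_, by have := le_max_left (c.time inp) (d.time inp); omega, .iteTrue he e₁⟩
    · obtain ⟨t, ht, e₁⟩ := hd h.2 σ
      exact ⟨_, by have := le_max_right (c.time inp) (d.time inp); omega,
        .iteFalse (not_not.1 he) e₁⟩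
  | repeatTo b x c hc =>
    simp only [wellFormed, Bool.and_eq_true, decide_eq_true_eq] at h
    obtain ⟨⟨hb, hwf⟩, hx⟩ := h
    have hinit := Exec.store (o := o) (.addr 0 (.const x)) (.const 0) (encode inp σ)
    rw [eval_addr, update_encode (by omega)] at hinit
    have hcond : ∀ τ : Store, Expr.eval o (encode inp τ) (.sub (.load (.const b)) (.var x)) =
        inp b - τ 0 x := by
      intro τ
      simp only [Expr.eval, eval_var]
      rw [encode_low (by omega)]
    -- With `n` rounds left, a round costs 30 steps for the test and 54 for the increment; the
    -- failing last test costs 30. Together with 27 steps for the initialisation this gives the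
    -- constants in `time`.
    have key : ∀ n i (τ : Store), i + n = inp b → ∃ t ≤ n * (c.time inp + 84) + 30,
        Exec o (.loop (.sub (.load (.const b)) (.var x))
          (.seq c.compile (.store (.addr 0 (.const x)) (.add (.var x) (.const 1)))))
          (encode inp (τ.put 0 x i)) t
          (encode inp (Store.put (Nat.rec τ (fun j τ => c.sem o inp (Store.put τ 0 x (i + j))) n)
            0 x (inp b))) := by
      intro n
      induction n with
      | zero =>
        intro i τ hi
        obtain rfl : i = inp b := by omega
        refine ⟨_, ?_, Exec.loopStop ?_⟩
        · rw [Nat.zero_mul, Nat.zero_add]; exact le_rfl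
        · rw [hcond]; simp [Store.put]
      | succ n ih =>
        intro i τ hi
        obtain ⟨t₁, ht₁, e₁⟩ := hc hwf (τ.put 0 x i)
        have hincr := Exec.store (o := o) (.addr 0 (.const x)) (.add (.var x) (.const 1))
          (encode inp (c.sem o inp (τ.put 0 x i)))
        rw [eval_addr, update_encode (by omega)] at hincr
        simp only [Expr.eval, eval_var] at hincr
        rw [sem_avoidsVar hx] at hincr
        obtain ⟨t₂, ht₂, e₂⟩ := ih (i + 1) (c.sem o inp (τ.put 0 x i)) (by omega)
        have hval : (τ.put 0 x i) 0 x = i := by simp [Store.put]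
        rw [hval] at hincr
        -- The recursor splits off the last round, but the execution splits off the first.
        have hrec : ∀ n, (Nat.rec τ (fun j τ => c.sem o inp (Store.put τ 0 x (i + j))) (n + 1) :
            Store) = Nat.rec (c.sem o inp (τ.put 0 x i))
              (fun j τ => c.sem o inp (Store.put τ 0 x (i + 1 + j))) n := by
          intro n
          induction n with
          | zero => rfl
          | succ n ih =>
            simp only at ih ⊢
            rw [ih, show i + (n + 1) = i + 1 + n by omega]
        rw [← hrec] at e₂
        refine ⟨_, ?_, Exec.loopStep (t₂ := t₂) ?_ (.seq e₁ hincr) e₂⟩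
        · have : (Expr.sub (.load (.const b)) (.var x)).cost = 29 := rfl
          have h2 : (Expr.addr 0 (.const x)).cost = 25 := rfl
          have h3 : (Expr.add (.var x) (.const 1)).cost = 28 := rfl
          rw [this, h2, h3, Nat.succ_mul]
          omega
        · rw [hcond, hval]; omega
    obtain ⟨t, ht, e⟩ := key (inp b) 0 σ (by omega)
    simp only [Nat.zero_add] at e
    refine ⟨_, ?_, Exec.seq (t₂ := t) hinit e⟩
    · have h2 : (Expr.addr 0 (.const x)).cost = 25 := rfl
      have h3 : (Expr.const 0).cost = 1 := rfl
      rw [h2, h3, time]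
      omega

/-- The nesting depth of the loops controlled by the input cell `b`. -/
def depth (b : ℕ) : Cmd → ℕ
  | skip => 0
  | setVar _ _ => 0
  | setArr _ _ _ => 0
  | seq c d => max (c.depth b) (d.depth b)
  | ite _ c d => max (c.depth b) (d.depth b)
  | repeatTo b' _ c => c.depth b + if b' = b then 1 else 0

theorem exists_time_le {c : Cmd} (h : c.wellFormed = true) :
    ∃ A, ∀ inp, c.time inp ≤ A * ((inp 0 + 1) ^ c.depth 0 * (inp 1 + 1) ^ c.depth 1) := by
  have hmono : ∀ {A x y a b a' b' : ℕ}, a ≤ a' → b ≤ b' →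
      A * ((x + 1) ^ a * (y + 1) ^ b) ≤ A * ((x + 1) ^ a' * (y + 1) ^ b') := by
    intro A x y a b a' b' ha hb
    exact Nat.mul_le_mul le_rfl (Nat.mul_le_mul (Nat.pow_le_pow_right (by omega) ha)
      (Nat.pow_le_pow_right (by omega) hb))
  have hpos : ∀ x y a b : ℕ, 1 ≤ (x + 1) ^ a * (y + 1) ^ b := fun x y a b =>
    Nat.mul_pos (Nat.pow_pos (by omega)) (Nat.pow_pos (by omega))
  induction c with
  | skip => exact ⟨1, fun inp => by simp [time, depth]⟩
  | setVar x e => exact ⟨_, fun inp => by simp only [time, depth, pow_zero, mul_one]; exact le_rfl⟩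
  | setArr a i e => exact ⟨_, fun inp => by simp only [time, depth, pow_zero, mul_one]; exact le_rfl⟩
  | seq c d hc hd =>
    simp only [wellFormed, Bool.and_eq_true] at h
    obtain ⟨A, hA⟩ := hc h.1
    obtain ⟨B, hB⟩ := hd h.2
    refine ⟨A + B, fun inp => ?_⟩
    rw [time, Nat.add_mul]
    exact add_le_add ((hA inp).trans (hmono (le_max_left _ _) (le_max_left _ _)))
      ((hB inp).trans (hmono (le_max_right _ _) (le_max_right _ _)))
  | ite e c d hc hd =>
    simp only [wellFormed, Bool.and_eq_true] at h
    obtain ⟨A, hA⟩ := hc h.1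
    obtain ⟨B, hB⟩ := hd h.2
    refine ⟨e.cost + 1 + A + B, fun inp => ?_⟩
    have h1 := (hA inp).trans (hmono (le_max_left _ (d.depth 0)) (le_max_left _ (d.depth 1)))
    have h2 := (hB inp).trans (hmono (le_max_right (c.depth 0) _) (le_max_right (c.depth 1) _))
    have h3 : e.cost + 1 ≤ (e.cost + 1) * ((inp 0 + 1) ^ (ite e c d).depth 0 *
        (inp 1 + 1) ^ (ite e c d).depth 1) := Nat.le_mul_of_pos_right _ (hpos _ _ _ _)
    rw [time, Nat.add_mul, Nat.add_mul]
    simp only [depth] at *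
    omega
  | repeatTo b x c hc =>
    simp only [wellFormed, Bool.and_eq_true, decide_eq_true_eq] at h
    obtain ⟨A, hA⟩ := hc h.1.2
    -- The two constants in the time of a loop add up to `84 + 57 = 141`.
    refine ⟨A + 141, fun inp => ?_⟩
    have key : ∀ n X Y Z, Y ≤ A * X → 1 ≤ X → Z = X * (n + 1) →
        n * (Y + 84) + 57 ≤ (A + 141) * Z := by
      rintro n X Y Z h1 h2 rfl
      calc n * (Y + 84) + 57 ≤ n * (A * X + 84 * X) + 57 * X := by
            refine add_le_add (Nat.mul_le_mul le_rfl ?_) (Nat.le_mul_of_pos_right _ h2)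
            exact add_le_add h1 (Nat.le_mul_of_pos_right _ h2)
        _ ≤ (A + 141) * (X * (n + 1)) := by nlinarith [Nat.zero_le (A * X), Nat.zero_le (n * X)]
    refine key _ _ _ _ (hA inp) (hpos _ _ _ _) ?_
    obtain rfl | rfl : b = 0 ∨ b = 1 := by omega
    · simp only [depth, if_true, zero_ne_one, if_false, Nat.add_zero, pow_succ]
      ring
    · simp only [depth, if_true, one_ne_zero, if_false, Nat.add_zero, pow_succ]
      ring

end Cmd
end OddMatchings

namespace OddMatchings

/-! ### The program for the kernel -/

/-- The partner of the point `e` in the first matching. -/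
def Expr.mate₁ (e : Expr) : Expr := .load (.add (.const 2) e)

/-- The partner of the point `e` in the second matching. -/
def Expr.mate₂ (e : Expr) : Expr := .load (.add (.add (.const 2) (.load (.const 0))) e)

/-- An expression that is not zero iff `a` and `b` are different. -/
def Expr.ne (a b : Expr) : Expr := .add (.sub a b) (.sub b a)

/-- An expression that is not zero iff `a` and `b` are equal. -/
def Expr.eq (a b : Expr) : Expr := .sub (.const 1) (.ne a b)

/-- An expression that is not zero iff the point `e` is bad. -/
def Expr.bad (e : Expr) : Expr := .add (.ne e.mate₁ e.mate₂) (.eq e.mate₁ e)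

/-- The label `i` belongs to a bad point. -/
def InputBad (inp : Memory) (i : ℕ) : Prop :=
  ¬ (inp (2 + i) = inp (2 + inp 0 + i) ∧ inp (2 + i) ≠ i)

/-- The label `i` belongs to a point of the kernel. -/
def InputCore (o : ℕ → ℕ → ℕ → ℕ) (inp : Memory) (i : ℕ) : Prop :=
  InputBad inp i ∨
    ((∃ y < inp 0, InputBad inp y ∧ o i (inp (2 + i)) y ≠ 0) ∧
      ∃ y < inp 0, InputBad inp y ∧ o (inp (2 + i)) i y ≠ 0)

section

variable {o : ℕ → ℕ → ℕ → ℕ} {inp : Memory} {σ : Store}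

theorem eval_mate₁ {e : Expr} (h : e.eval o (encode inp σ) < inp 0) :
    e.mate₁.eval o (encode inp σ) = inp (2 + e.eval o (encode inp σ)) := by
  simp only [Expr.mate₁, Expr.eval]
  rw [encode_low (by omega)]

theorem eval_mate₂ {e : Expr} (h : e.eval o (encode inp σ) < inp 0) :
    e.mate₂.eval o (encode inp σ) = inp (2 + inp 0 + e.eval o (encode inp σ)) := by
  rw [Expr.mate₂, Expr.eval, Expr.eval, Expr.eval, eval_size, Expr.eval, encode_low (by omega)]

theorem eval_ne_ne_zero {s : Memory} {a b : Expr} :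
    (Expr.ne a b).eval o s ≠ 0 ↔ a.eval o s ≠ b.eval o s := by
  simp only [Expr.ne, Expr.eval]
  omega

theorem eval_eq_ne_zero {s : Memory} {a b : Expr} :
    (Expr.eq a b).eval o s ≠ 0 ↔ a.eval o s = b.eval o s := by
  simp only [Expr.eq, Expr.ne, Expr.eval]
  omega

theorem eval_bad_ne_zero {e : Expr} (h : e.eval o (encode inp σ) < inp 0) :
    e.bad.eval o (encode inp σ) ≠ 0 ↔ InputBad inp (e.eval o (encode inp σ)) := by
  have h1 := eval_ne_ne_zero (o := o) (s := encode inp σ) (a := e.mate₁) (b := e.mate₂)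
  have h2 := eval_eq_ne_zero (o := o) (s := encode inp σ) (a := e.mate₁) (b := e)
  rw [eval_mate₁ h, eval_mate₂ h] at h1
  rw [eval_mate₁ h] at h2
  rw [InputBad, not_and_or, not_not, ← h2, ← ne_eq, ← h1, Expr.bad, Expr.eval]
  omega

end

namespace Cmd

/-- Record in the variables `2` and `3` on which sides of the edge at the point `0` the point `1`
lies, if it is bad. -/
def testSides : Cmd :=
  ite (.bad (.var 1))
    (seq (ite (.orient (.var 0) (.mate₁ (.var 0)) (.var 1)) (setVar 2 (.const 1)) skip)
      (ite (.orient (.mate₁ (.var 0)) (.var 0) (.var 1)) (setVar 3 (.const 1)) skip))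
    skip

/-- Determine the sides of the edge at the point `0` with bad points. -/
def scanSides : Cmd :=
  seq (setVar 2 (.const 0)) (seq (setVar 3 (.const 0)) (repeatTo 0 1 testSides))

/-- Decide whether the point `0` belongs to the kernel. -/
def markPoint : Cmd :=
  ite (.bad (.var 0)) (setArr 0 (.var 0) (.const 1))
    (ite (.var 2) (ite (.var 3) (setArr 0 (.var 0) (.const 1)) (setArr 0 (.var 0) (.const 0)))
      (setArr 0 (.var 0) (.const 0)))

/-- Compute the indicator function of the kernel in array `1`. -/
def markKernel : Cmd := repeatTo 0 0 (seq scanSides markPoint)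

variable {o : ℕ → ℕ → ℕ → ℕ} {inp : Memory} {σ : Store}

theorem sem_scanSides {i : ℕ} (hi : i < inp 0)
    (hσ : σ 0 0 = i) :
    (scanSides.sem o inp σ 0 2 ≠ 0 ↔ ∃ y < inp 0, InputBad inp y ∧ o i (inp (2 + i)) y ≠ 0) ∧
    (scanSides.sem o inp σ 0 3 ≠ 0 ↔ ∃ y < inp 0, InputBad inp y ∧ o (inp (2 + i)) i y ≠ 0) := by
  simp only [scanSides, sem]
  refine sem_repeatTo (Q := fun τ => (τ 0 2 ≠ 0 ↔ _) ∧ (τ 0 3 ≠ 0 ↔ _))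
    (fun y τ => τ 0 0 = i ∧ (τ 0 2 ≠ 0 ↔ ∃ z < y, InputBad inp z ∧ o i (inp (2 + i)) z ≠ 0) ∧
      (τ 0 3 ≠ 0 ↔ ∃ z < y, InputBad inp z ∧ o (inp (2 + i)) i z ≠ 0)) ?_ ?_ ?_
  · simp [Store.put, hσ, Expr.eval]
  · rintro y hy τ ⟨h0, h2, h3⟩
    have hsucc : ∀ P : ℕ → Prop, (∃ z < y + 1, P z) ↔ (∃ z < y, P z) ∨ P y := by
      intro P
      constructor
      · rintro ⟨z, hz, hP⟩
        rcases Nat.lt_succ_iff_lt_or_eq.1 hz with h | rfl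
        · exact Or.inl ⟨z, h, hP⟩
        · exact Or.inr hP
      · rintro (⟨z, hz, hP⟩ | hP)
        · exact ⟨z, by omega, hP⟩
        · exact ⟨y, by omega, hP⟩
    have e0 : ∀ τ : Store, τ 0 0 = i → Expr.eval o (encode inp τ) (.mate₁ (.var 0)) = inp (2 + i) := by
      intro τ h
      rw [eval_mate₁] <;> rw [eval_var, h]
      exact hi
    have eb := eval_bad_ne_zero (o := o) (inp := inp) (σ := τ.put 0 1 y) (e := .var 1)
      (by rw [eval_var]; simpa [Store.put] using hy)
    rw [eval_var] at eb
    rw [hsucc, hsucc, ← h2, ← h3]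
    have hput : ∀ x, x ≠ 1 → (τ.put 0 1 y) 0 x = τ 0 x := by intro x hx; simp [Store.put, hx]
    have hput1 : (τ.put 0 1 y) 0 1 = y := by simp [Store.put]
    rw [hput1] at eb
    generalize τ.put 0 1 y = τ' at *
    rw [← hput 0 (by omega)] at h0
    rw [← hput 2 (by omega), ← hput 3 (by omega)]
    have e1 := e0 τ' h0
    by_cases hb : InputBad inp y
    · have hor : Expr.eval o (encode inp τ') (.orient (.var 0) (.mate₁ (.var 0)) (.var 1)) =
        o i (inp (2 + i)) y := by rw [Expr.eval, eval_var, eval_var, e1, h0, hput1]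
      have hor2 : ∀ τ : Store, τ 0 0 = i → τ 0 1 = y →
          Expr.eval o (encode inp τ) (.orient (.mate₁ (.var 0)) (.var 0) (.var 1)) =
          o (inp (2 + i)) i y := by
        intro τ h h'
        rw [Expr.eval, eval_var, eval_var, e0 τ h, h, h']
      -- The test for the second side, treated once for both outcomes of the first test.
      have hfst : ∀ c : Store, c 0 0 = i → c 0 1 = y → c 0 3 = τ' 0 3 →
          (c 0 2 ≠ 0 ↔ τ' 0 2 ≠ 0 ∨ o i (inp (2 + i)) y ≠ 0) →
          (ite (.orient (.mate₁ (.var 0)) (.var 0) (.var 1)) (setVar 3 (.const 1)) skip).sem o inp c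
            0 0 = i ∧
          ((ite (.orient (.mate₁ (.var 0)) (.var 0) (.var 1)) (setVar 3 (.const 1)) skip).sem o inp c
            0 2 ≠ 0 ↔ τ' 0 2 ≠ 0 ∨ InputBad inp y ∧ o i (inp (2 + i)) y ≠ 0) ∧
          ((ite (.orient (.mate₁ (.var 0)) (.var 0) (.var 1)) (setVar 3 (.const 1)) skip).sem o inp c
            0 3 ≠ 0 ↔ τ' 0 3 ≠ 0 ∨ InputBad inp y ∧ o (inp (2 + i)) i y ≠ 0) := by
        intro c c0 c1 c3 c2
        by_cases g : o (inp (2 + i)) i y ≠ 0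
        · rw [sem_ite_pos (by rw [hor2 c c0 c1]; exact g), sem_setVar]
          simp only [Store.put, Expr.eval]
          simp [c0, c2, hb, g]
        · rw [sem_ite_neg (by rw [hor2 c c0 c1]; exact g), sem_skip]
          simp [c0, c2, c3, hb, g]
      rw [testSides, sem_ite_pos (eb.2 hb), sem_seq]
      by_cases g : o i (inp (2 + i)) y ≠ 0
      · have e := sem_ite_pos (o := o) (inp := inp) (hor.trans_ne g) (setVar 2 (.const 1)) skip
        rw [sem_setVar] at e
        apply hfst <;> rw [e] <;> simp [Store.put, Expr.eval, h0, hput1, g]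
      · have e := sem_ite_neg (o := o) (inp := inp) (by rw [hor]; exact g)
          (setVar 2 (.const 1)) skip
        rw [sem_skip] at e
        apply hfst <;> rw [e] <;> simp [h0, hput1, not_not.1 g]
    · rw [testSides, sem_ite_neg (fun h => hb (eb.1 h)), sem_skip]
      simp [h0, hb]
  · rintro τ ⟨-, h2, h3⟩
    exact ⟨h2, h3⟩

open Classical in
theorem sem_markKernel :
    ∀ i < inp 0, markKernel.sem o inp σ 1 i = if InputCore o inp i then 1 else 0 := by
  refine sem_repeatTo (Q := fun τ => ∀ i < inp 0, τ 1 i = if InputCore o inp i then 1 else 0)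
    (fun j τ => ∀ i < j, τ 1 i = if InputCore o inp i then 1 else 0) (by simp) ?_ ?_
  · intro j hj τ h i hi
    have h0 : (τ.put 0 0 j) 0 0 = j := by simp [Store.put]
    have h1 : ∀ i, (τ.put 0 0 j) 1 i = τ 1 i := by simp [Store.put]
    have hs := sem_scanSides (o := o) (σ := τ.put 0 0 j) hj h0
    have e0 := sem_avoidsVar (o := o) (inp := inp) (x := 0) (c := scanSides) rfl (τ.put 0 0 j)
    have e1 := sem_avoidsArr (o := o) (inp := inp) (a := 0) (c := scanSides) rfl (τ.put 0 0 j)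
    simp only [sem]
    generalize scanSides.sem o inp (τ.put 0 0 j) = τ' at *
    rw [h0] at e0
    have hb := eval_bad_ne_zero (o := o) (inp := inp) (σ := τ') (e := .var 0)
      (by rw [eval_var, e0]; exact hj)
    rw [eval_var, e0] at hb
    have hval : ∀ z, τ'.put 1 j z 1 i = if i = j then z else τ' 1 i := by
      intro z; simp [Store.put]
    have hold : i ≠ j → τ' 1 i = if InputCore o inp i then 1 else 0 := by
      intro hne
      rw [e1, h1]
      exact h i (by omega)
    have hcase : ∀ z, (z = if InputCore o inp j then 1 else 0) →
        τ'.put 1 j z 1 i = if InputCore o inp i then 1 else 0 := by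
      intro z hz
      rw [hval]
      split_ifs with hij
      all_goals grind
    simp only [markPoint, sem, eval_var, e0, Expr.eval]
    by_cases b : InputBad inp j
    · rw [if_pos (hb.2 b)]
      apply hcase
      exact (if_pos (show InputCore o inp j from Or.inl b)).symm
    · rw [if_neg (fun h => b (hb.1 h))]
      by_cases b2 : τ' 0 2 ≠ 0
      · rw [if_pos b2]
        by_cases b3 : τ' 0 3 ≠ 0
        · rw [if_pos b3]
          apply hcase
          exact (if_pos (show InputCore o inp j from Or.inr ⟨hs.1.1 b2, hs.2.1 b3⟩)).symm
        · rw [if_neg b3]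
          apply hcase
          rw [if_neg]
          rintro (h | h)
          · exact b h
          · exact b3 (hs.2.2 h.2)
      · rw [if_neg b2]
        apply hcase
        rw [if_neg]
        rintro (h | h)
        · exact b h
        · exact b2 (hs.1.2 h.1)
  · intro τ h i hi
    simpa [Store.put] using h i hi

end Cmd
end OddMatchings

namespace OddMatchings

/-! ### Labelled points -/

section

variable {n : ℕ} {p : Fin n → Plane} {r : Plane → ℕ} {m m' : Plane → Plane} {v v' : Plane}

/-- The point with the label `i`. -/
noncomputable def label (p : Fin n → Plane) (i : ℕ) : Plane := if h : i < n then p ⟨i, h⟩ else 0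

theorem label_of_lt {i : ℕ} (h : i < n) : label p i = p ⟨i, h⟩ := dif_pos h

theorem label_mem {i : ℕ} (h : i < n) : label p i ∈ Set.range p := by
  rw [label_of_lt h]; exact ⟨_, rfl⟩

theorem label_inj (hp : Function.Injective p) {i j : ℕ} (hi : i < n) (hj : j < n) :
    label p i = label p j ↔ i = j := by
  rw [label_of_lt hi, label_of_lt hj, hp.eq_iff, Fin.mk.injEq]

theorem exists_label {x : Plane} (hx : x ∈ Set.range p) : ∃ i < n, label p i = x := by
  obtain ⟨i, rfl⟩ := hx
  exact ⟨i, i.2, label_of_lt i.2⟩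

theorem p_mate (h : IsPairing r (Set.range p) m v) (i : Fin n) :
    p (mate p (edgesOf m) i) = m (p i) := by
  unfold mate
  split_ifs with hex
  · exact (h.mk_mem_edgesOf.1 hex.choose_spec).1.symm
  · by_contra hne
    obtain ⟨j, hj⟩ := h.maps (Set.mem_range_self i)
    exact hex ⟨j, h.mk_mem_edgesOf.2 ⟨hj.symm, by rw [hj]; exact hne⟩⟩

theorem input_size (M M' : Set (Sym2 Plane)) (k : ℕ) : inputMemory p M M' k 0 = n := rfl

theorem input_parameter (M M' : Set (Sym2 Plane)) (k : ℕ) : inputMemory p M M' k 1 = k := rfl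

theorem input_mate₁ (h : IsPairing r (Set.range p) m v) (M' : Set (Sym2 Plane)) (k : ℕ) {i : ℕ}
    (hi : i < n) : inputMemory p (edgesOf m) M' k (2 + i) < n ∧
      label p (inputMemory p (edgesOf m) M' k (2 + i)) = m (label p i) := by
  have e : inputMemory p (edgesOf m) M' k (2 + i) = mate p (edgesOf m) ⟨i, hi⟩ := by
    unfold inputMemory
    rw [if_neg (by omega), if_neg (by omega), dif_pos (by omega)]
    simp only [Nat.add_sub_cancel_left]
  rw [e]
  exact ⟨Fin.is_lt _, by rw [label_of_lt (Fin.is_lt _), label_of_lt hi, Fin.eta, p_mate h]⟩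

theorem input_mate₂ (h : IsPairing r (Set.range p) m v) (M : Set (Sym2 Plane)) (k : ℕ) {i : ℕ}
    (hi : i < n) : inputMemory p M (edgesOf m) k (2 + n + i) < n ∧
      label p (inputMemory p M (edgesOf m) k (2 + n + i)) = m (label p i) := by
  have e : inputMemory p M (edgesOf m) k (2 + n + i) = mate p (edgesOf m) ⟨i, hi⟩ := by
    unfold inputMemory
    rw [if_neg (by omega), if_neg (by omega), dif_neg (by omega), dif_pos (by omega)]
    simp only [show 2 + n + i - 2 - n = i by omega]
  rw [e]
  exact ⟨Fin.is_lt _, by rw [label_of_lt (Fin.is_lt _), label_of_lt hi, Fin.eta, p_mate h]⟩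

theorem encode_input (M M' : Set (Sym2 Plane)) (k : ℕ) :
    encode (inputMemory p M M' k) (fun _ _ => 0) = inputMemory p M M' k := by
  funext x
  unfold encode
  split_ifs with hx
  · rfl
  · rw [input_size] at hx
    change 0 = inputMemory p M M' k x
    unfold inputMemory
    rw [if_neg (by omega), if_neg (by omega), dif_neg (by omega), dif_neg (by omega)]

theorem orientTest_le_one (a b c : ℕ) : orientTest p a b c ≤ 1 := by
  unfold orientTest; split_ifs <;> omega

theorem orientTest_ne_zero (hR : IsRank r (Set.range p)) {a b c : ℕ} (ha : a < n) (hb : b < n)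
    (hc : c < n) : orientTest p a b c ≠ 0 ↔
      Cyc (r (label p a)) (r (label p b)) (r (label p c)) := by
  rw [← hR.cyc _ (label_mem ha) _ (label_mem hb) _ (label_mem hc), label_of_lt ha, label_of_lt hb,
    label_of_lt hc]
  unfold orientTest
  split_ifs with h
  · obtain ⟨_, _, _, h⟩ := h
    simpa using h
  · simp only [ne_eq, not_true, false_iff]
    exact fun hc' => h ⟨ha, hb, hc, hc'⟩

theorem inputBad_iff (hp : Function.Injective p) (h : IsPairing r (Set.range p) m v)
    (h' : IsPairing r (Set.range p) m' v') (k : ℕ) {i : ℕ} (hi : i < n) :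
    InputBad (inputMemory p (edgesOf m) (edgesOf m') k) i ↔ IsBad m m' (label p i) := by
  obtain ⟨a1, a2⟩ := input_mate₁ h (edgesOf m') k hi
  obtain ⟨b1, b2⟩ := input_mate₂ h' (edgesOf m) k hi
  unfold InputBad IsBad
  rw [input_size, ← label_inj hp a1 b1, ne_eq, ← label_inj hp a1 hi, a2, b2]

/-- A point that is not bad fails to be good exactly if there are bad points on both sides of its
edge. -/
theorem inputCore_iff (hp : Function.Injective p) (hR : IsRank r (Set.range p))
    (h : IsPairing r (Set.range p) m v)
    (h' : IsPairing r (Set.range p) m' v') (k : ℕ) {i : ℕ} (hi : i < n) :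
    InputCore (orientTest p) (inputMemory p (edgesOf m) (edgesOf m') k) i ↔
      label p i ∈ core r (Set.range p) m m' := by
  obtain ⟨a1, a2⟩ := input_mate₁ h (edgesOf m') k hi
  have hex : ∀ P : Plane → Prop, (∃ y < n, InputBad (inputMemory p (edgesOf m) (edgesOf m') k) y ∧
      P (label p y)) ↔ ∃ y ∈ Set.range p, IsBad m m' y ∧ P y := by
    intro P
    constructor
    · rintro ⟨y, hy, hb, hP⟩
      exact ⟨_, label_mem hy, (inputBad_iff hp h h' k hy).1 hb, hP⟩
    · rintro ⟨x, hx, hb, hP⟩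
      obtain ⟨y, hy, rfl⟩ := exists_label hx
      exact ⟨y, hy, (inputBad_iff hp h h' k hy).2 hb, hP⟩
  have hbad := inputBad_iff hp h h' k hi
  have hsize : inputMemory p (edgesOf m) (edgesOf m') k 0 = n := rfl
  generalize inputMemory p (edgesOf m) (edgesOf m') k = inp at *
  have h1 := hex fun x => Cyc (r (label p i)) (r (m (label p i))) (r x)
  have h2 := hex fun x => Cyc (r (m (label p i))) (r (label p i)) (r x)
  have e1 : (∃ y < n, InputBad inp y ∧
      orientTest p i (inp (2 + i)) y ≠ 0) ↔
      ∃ y < n, InputBad inp y ∧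
        Cyc (r (label p i)) (r (m (label p i))) (r (label p y)) := by
    refine exists_congr fun y => and_congr_right fun hy => and_congr_right fun _ => ?_
    rw [orientTest_ne_zero hR hi a1 hy, a2]
  have e2 : (∃ y < n, InputBad inp y ∧
      orientTest p (inp (2 + i)) i y ≠ 0) ↔
      ∃ y < n, InputBad inp y ∧
        Cyc (r (m (label p i))) (r (label p i)) (r (label p y)) := by
    refine exists_congr fun y => and_congr_right fun hy => and_congr_right fun _ => ?_
    rw [orientTest_ne_zero hR a1 hi hy, a2]
  unfold InputCore
  rw [hsize, e1, h1, e2, h2, hbad]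
  simp only [core, IsGood, Set.mem_sep_iff, label_mem hi, true_and]
  have d1 : (∀ y ∈ Set.range p, IsBad m m' y → ¬ Cyc (r (label p i)) (r (m (label p i))) (r y)) ↔
      ¬ ∃ y ∈ Set.range p, IsBad m m' y ∧ Cyc (r (label p i)) (r (m (label p i))) (r y) := by
    simp only [not_exists, not_and]
  have d2 : (∀ y ∈ Set.range p, IsBad m m' y → ¬ Cyc (r (m (label p i))) (r (label p i)) (r y)) ↔
      ¬ ∃ y ∈ Set.range p, IsBad m m' y ∧ Cyc (r (m (label p i))) (r (label p i)) (r y) := by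
    simp only [not_exists, not_and]
  rw [d1, d2]
  generalize IsBad m m' (label p i) = P₁
  generalize (∃ y ∈ Set.range p, _ ∧ Cyc (r (label p i)) _ _) = P₂
  generalize (∃ y ∈ Set.range p, _ ∧ Cyc (r (m (label p i))) _ _) = P₃
  clear * -
  tauto

end

/-- Copy array `1` to the cells `2, …, n + 1`. -/
def copyLoop : Prog :=
  .loop (.sub (.load (.const 0)) (.var 0))
    (.seq (.store (.add (.const 2) (.var 0)) (.cell 1 (.var 0)))
      (.store (.addr 0 (.const 0)) (.add (.var 0) (.const 1))))

/-- The output overwrites the input array of the first matching, so `inp` varies in the induction.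
Cell `0` is preserved, so the arrays keep their place. A round takes 339 steps, rounded up to 400.
-/
theorem exec_copyLoop {o : ℕ → ℕ → ℕ → ℕ} (d : ℕ) : ∀ (i : ℕ) (inp : Memory) (σ : Store),
    i + d = inp 0 → σ 0 0 = i → ∃ t ≤ d * 400 + 30, ∃ inp' σ',
      Exec o copyLoop (encode inp σ) t (encode inp' σ') ∧ inp' 0 = inp 0 ∧
      ∀ j < inp 0, inp' (2 + j) = if i ≤ j then σ 1 j else inp (2 + j) := by
  have hcond : ∀ (inp : Memory) (τ : Store),
      Expr.eval o (encode inp τ) (.sub (.load (.const 0)) (.var 0)) = inp 0 - τ 0 0 := by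
    intro inp τ
    rw [Expr.eval, eval_size, eval_var]
  induction d with
  | zero =>
    intro i inp σ hi h0
    refine ⟨30, le_rfl, inp, σ, Exec.loopStop ?_, rfl, fun j hj => ?_⟩
    · rw [hcond]; omega
    · rw [if_neg (by omega)]
  | succ d ih =>
    intro i inp σ hi h0
    have e1 := Exec.store (o := o) (.add (.const 2) (.var 0)) (.cell 1 (.var 0)) (encode inp σ)
    rw [eval_cell (by omega), Expr.eval, Expr.eval, eval_var, h0,
      update_encode_low (by omega) (by omega)] at e1
    set inp₁ := Function.update inp (2 + i) (σ 1 i) with hinp₁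
    have hsize : inp₁ 0 = inp 0 := Function.update_of_ne (by omega) _ _
    have e2 := Exec.store (o := o) (.addr 0 (.const 0)) (.add (.var 0) (.const 1)) (encode inp₁ σ)
    rw [eval_addr, update_encode (by omega)] at e2
    simp only [Expr.eval, eval_var, h0] at e2
    obtain ⟨t, ht, inp', σ', e3, h1, h2⟩ := ih (i + 1) inp₁ (σ.put 0 0 (i + 1)) (by omega)
      (by simp [Store.put])
    refine ⟨_, ?_, inp', σ', Exec.loopStep ?_ (.seq e1 e2) e3, by rw [h1, hsize], fun j hj => ?_⟩
    · have c1 : (Expr.sub (.load (.const 0)) (.var 0)).cost = 29 := rfl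
      have c2 : (Expr.add (.const 2) (.var 0)).cost = 28 := rfl
      have c3 : (Expr.cell 1 (.var 0)).cost = 226 := rfl
      have c4 : (Expr.addr 0 (.const 0)).cost = 25 := rfl
      have c5 : (Expr.add (.var 0) (.const 1)).cost = 28 := rfl
      rw [c1, c2, c3, c4, c5]
      omega
    · rw [hcond]; omega
    · rw [h2 j (by omega)]
      by_cases hij : i ≤ j
      · rw [if_pos hij]
        by_cases hij' : i + 1 ≤ j
        · rw [if_pos hij']; simp [Store.put]
        · obtain rfl : j = i := by omega
          rw [if_neg hij', hinp₁, Function.update_self]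
      · rw [if_neg hij, if_neg (by omega), hinp₁, Function.update_of_ne (by omega)]

theorem kernelPolyTime : KernelPolyTime := by
  obtain ⟨A, hA⟩ := Cmd.exists_time_le (c := Cmd.markKernel) rfl
  have d0 : Cmd.markKernel.depth 0 = 2 := rfl
  have d1 : Cmd.markKernel.depth 1 = 0 := rfl
  -- The loop variable `0` is reset because `markKernel` leaves it at `n`. The constant 57 is 27 for
  -- this reset plus 30 for the last test of the copy loop.
  refine ⟨.seq Cmd.markKernel.compile (.seq (.store (.addr 0 (.const 0)) (.const 0)) copyLoop),
    Polynomial.C A * (Polynomial.X + 1) ^ 2 + Polynomial.C 400 * Polynomial.X + Polynomial.C 57, ?_⟩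
  intro n p hp M M' k
  have hS : ConvexIndependent ℝ ((↑) : Set.range p → Plane) := hp.range
  obtain ⟨r, hR⟩ := exists_isRank hS (Set.finite_range p)
  obtain ⟨m, v, h, e⟩ := IsOddMatching.exists_isPairing hR M.2
  obtain ⟨m', v', h', e'⟩ := IsOddMatching.exists_isPairing hR M'.2
  rw [e, e']
  set inp := inputMemory p (edgesOf m) (edgesOf m') k with hinp
  obtain ⟨t₁, ht₁, e₁⟩ := Cmd.exec_compile (o := orientTest p) (inp := inp) (c := Cmd.markKernel)
    rfl (fun _ _ => 0)
  set σ := Cmd.markKernel.sem (orientTest p) inp (fun _ _ => 0) with hσ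
  have hK : ∀ i < n, σ 1 i = _ := Cmd.sem_markKernel (o := orientTest p) (inp := inp)
    (σ := fun _ _ => 0)
  have e₂ := Exec.store (o := orientTest p) (.addr 0 (.const 0)) (.const 0) (encode inp σ)
  rw [eval_addr, update_encode (by omega)] at e₂
  simp only [Expr.eval] at e₂
  obtain ⟨t₃, ht₃, inp', σ', e₃, hsize, hcopy⟩ := exec_copyLoop (o := orientTest p) n 0 inp
    (σ.put 0 0 0) (by rw [hinp, input_size]; omega) (by simp [Store.put])
  rw [hinp, encode_input, ← hinp] at e₁
  refine ⟨_, _, .seq e₁ (.seq e₂ e₃), ?_, fun i => ?_⟩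
  · have c4 : (Expr.addr 0 (.const 0)).cost = 25 := rfl
    have c5 : (Expr.const 0).cost = 1 := rfl
    rw [c4, c5]
    have := ht₁.trans (hA inp)
    rw [d0, d1, pow_zero, mul_one, hinp, input_size] at this
    simp only [Polynomial.eval_add, Polynomial.eval_mul, Polynomial.eval_C, Polynomial.eval_pow,
      Polynomial.eval_X, Polynomial.eval_one]
    omega
  · have hi : (i : ℕ) < inp 0 := i.2
    have hval : encode inp' σ' (2 + i) = σ 1 i := by
      rw [encode_low (by omega), hcopy i hi, if_pos (Nat.zero_le _)]
      simp [Store.put]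
    have hlabel : label p i = p i := label_of_lt i.2
    rw [hval, hK i i.2]
    have hcore := inputCore_iff hp.injective hR h h' k i.2
    rw [hlabel, ← hinp] at hcore
    rw [kernelPoints_eq_core hR h h', ← hcore]
    split_ifs with hc <;> simp [hc]

end OddMatchings

namespace OddMatchings

/-! ### The search program -/

/-- Only crossings with the new edge `vw` have to be tested. The removed edge at `w` is left out,
and the isolated point passes the test because `m` fixes it. -/
theorem isPairing_flipAt_iff {α : Type*} {r : α → ℕ} {S : Set α} {m : α → α} {v w : α}
    (hr : Set.InjOn r S) (h : IsPairing r S m v) (hw : w ∈ S) (hwv : w ≠ v) :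
    IsPairing r S (flipAt m v w) (m w) ↔
      ∀ y ∈ S, y ≠ w → m y ≠ w → (Cyc (r v) (r w) (r y) ↔ Cyc (r v) (r w) (r (m y))) := by
  have inv := h.inv
  have iso := h.iso
  have mem := h.mem
  have uniq := h.uniq
  have off := h.off
  have maps := fun x => h.maps (x := x)
  constructor
  · intro h' y hy hyw hmy
    by_cases hyv : y = v
    · rw [hyv, iso]
    have e1 : flipAt m v w v = w := by simp [flipAt]
    have e2 : flipAt m v w y = m y := by
      simp only [flipAt]
      grind
    have := h'.nc v mem y hy
    rwa [e1, e2] at this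
  · intro hnc
    have hne : ∀ a ∈ S, ∀ b ∈ S, a ≠ b → r a ≠ r b := fun a ha b hb hab hc => hab (hr ha hb hc)
    refine ⟨?_, ?_, h.maps hw, ?_, ?_, ?_⟩
    · intro x
      simp only [flipAt]
      grind
    · intro x hx
      simp only [flipAt]
      grind
    · simp only [flipAt]
      grind
    · intro x hx
      simp only [flipAt]
      grind
    · intro x hx y hy
      have fv : flipAt m v w v = w := by simp [flipAt]
      have fw : flipAt m v w w = v := by simp [flipAt, hwv]
      have fm : flipAt m v w (m w) = m w := by
        simp only [flipAt]
        grind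
      have fo : ∀ x, x ≠ v → x ≠ w → x ≠ m w →
          flipAt m v w x = m x ∧ m x ≠ v ∧ m x ≠ w ∧ m x ≠ m w := by
        intro x h1 h2 h3
        simp only [flipAt]
        grind
      have hself := not_cyc_self
      by_cases hxm : x = m w
      · subst hxm; simp [fm, hself]
      by_cases hym : y = m w
      · subst hym; rw [fm]
      have hmyw : m y ≠ w := fun e => hym (by rw [← e, inv])
      have hmxw : m x ≠ w := fun e => hxm (by rw [← e, inv])
      by_cases hxv : x = v
      · subst hxv
        rw [fv]
        by_cases hyv : y = x
        · subst hyv; simp [fv, hself]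
        by_cases hyw : y = w
        · subst hyw; simp [fw, hself]
        rw [(fo y hyv hyw hym).1]
        exact hnc y hy hyw hmyw
      by_cases hxw : x = w
      · subst hxw
        rw [fw]
        by_cases hyv : y = v
        · subst hyv; simp [fv, hself]
        by_cases hyw : y = x
        · subst hyw; simp [fw, hself]
        obtain ⟨f1, f2, f3, f4⟩ := fo y hyv hyw hym
        rw [f1]
        have := hnc y hy hyw hmyw
        have q1 := hne _ hy _ mem hyv
        have q2 := hne _ hy _ hw hyw
        have q3 := hne _ (maps y hy) _ mem f2
        have q4 := hne _ (maps y hy) _ hw f3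
        have q5 := hne _ hw _ mem hwv
        unfold Cyc at *
        omega
      obtain ⟨f1, f2, f3, f4⟩ := fo x hxv hxw hxm
      rw [f1]
      have hswap : Cyc (r x) (r (m x)) (r v) ↔ Cyc (r x) (r (m x)) (r w) :=
        cyc_contract_swap ⟨hne _ hx _ mem hxv, hne _ hx _ hw hxw, hne _ (maps x hx) _ mem f2,
          hne _ (maps x hx) _ hw f3⟩ (hnc x hx hxw hmxw)
      by_cases hyv : y = v
      · subst hyv; rw [fv]; exact hswap
      by_cases hyw : y = w
      · subst hyw; rw [fw]; exact hswap.symm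
      rw [(fo y hyv hyw hym).1]
      exact h.nc x hx y hy

namespace Cmd

/-- List the points of the kernel in array `2`, with their number in variable `4`, and put the
isolated point of the first matching into variable `5`. -/
def listKernel : Cmd :=
  seq (setVar 4 (.const 0)) (repeatTo 0 0 (seq
    (ite (.cell 1 (.var 0))
      (seq (setArr 1 (.var 4) (.var 0)) (setVar 4 (.add (.var 4) (.const 1)))) skip)
    (ite (.eq (.mate₁ (.var 0)) (.var 0)) (setVar 5 (.var 0)) skip)))

/-- Clear variable `8` if the edge at the point `1` in array `3` crosses the edge between the points
`6` and `7`. -/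
def testCrossing : Cmd :=
  ite (.ne (.var 1) (.var 7)) (ite (.ne (.cell 3 (.var 1)) (.var 7))
    (ite (.ne (.orient (.var 6) (.var 7) (.var 1)) (.orient (.var 6) (.var 7) (.cell 3 (.var 1))))
      (setVar 8 (.const 0)) skip) skip) skip

/-- Connect the isolated point `6` to the point `7` in array `3`. -/
def doFlip : Cmd :=
  seq (setVar 13 (.cell 3 (.var 7))) (seq (setArr 2 (.var 6) (.var 7))
    (seq (setArr 2 (.var 7) (.var 6)) (seq (setArr 2 (.var 13) (.var 13)) (setVar 6 (.var 13)))))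

/-- Attempt the flip to the point that is given by the letter `0` of the current word. -/
def attemptFlip : Cmd :=
  seq (setVar 7 (.cell 2 (.cell 4 (.var 0)))) (ite (.ne (.var 7) (.var 6))
    (seq (setVar 8 (.const 1)) (seq (repeatTo 0 1 testCrossing) (ite (.var 8) doFlip skip))) skip)

/-- Attempt the flips of the current word, in array `4`. -/
def simulate : Cmd :=
  seq (repeatTo 0 0 (setArr 2 (.var 0) (.mate₁ (.var 0))))
    (seq (setVar 6 (.var 5)) (repeatTo 1 0 attemptFlip))

/-- Set variable `10` if the matching in array `3` is the second one. -/
def compare : Cmd :=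
  seq (setVar 9 (.const 1)) (seq
    (repeatTo 0 0 (ite (.ne (.cell 3 (.var 0)) (.mate₂ (.var 0))) (setVar 9 (.const 0)) skip))
    (ite (.var 9) (setVar 10 (.const 1)) skip))

/-- Increase the digit `0` of the current word if there is a carry. -/
def carryDigit : Cmd :=
  ite (.var 12) (ite (.eq (.add (.cell 4 (.var 0)) (.const 1)) (.var 4))
    (setArr 3 (.var 0) (.const 0))
    (seq (setArr 3 (.var 0) (.add (.cell 4 (.var 0)) (.const 1))) (setVar 12 (.const 0)))) skip

/-- Proceed to the next word, or set variable `11` after the last one. -/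
def nextWord : Cmd :=
  seq (setVar 12 (.const 1)) (seq (repeatTo 1 0 carryDigit)
    (ite (.var 12) (setVar 11 (.const 1)) skip))

/-- Test the current word and proceed to the next one. -/
def testWord : Cmd := seq simulate (seq compare nextWord)

variable {o : ℕ → ℕ → ℕ → ℕ} {inp : Memory} {σ : Store}

open Classical in
-- The labels are listed in strictly increasing order, so the list has no repetitions and its length
-- counts the kernel.
theorem sem_listKernel {K : ℕ → Prop} (hK : ∀ i < inp 0, σ 1 i = if K i then 1 else 0) {v : ℕ}
    (hv : v < inp 0) (hiso : ∀ i < inp 0, inp (2 + i) = i ↔ i = v) :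
    ∃ c, listKernel.sem o inp σ 0 4 = c ∧ c ≤ inp 0 ∧ listKernel.sem o inp σ 0 5 = v ∧
      (∀ j < c, listKernel.sem o inp σ 2 j < inp 0 ∧ K (listKernel.sem o inp σ 2 j)) ∧
      (∀ j < c, ∀ l < j, listKernel.sem o inp σ 2 l < listKernel.sem o inp σ 2 j) ∧
      (∀ i < inp 0, K i → ∃ j < c, listKernel.sem o inp σ 2 j = i) := by
  rw [listKernel, sem_seq]
  refine sem_repeatTo (Q := fun τ => ∃ c, τ 0 4 = c ∧ c ≤ inp 0 ∧ τ 0 5 = v ∧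
      (∀ j < c, τ 2 j < inp 0 ∧ K (τ 2 j)) ∧ (∀ j < c, ∀ l < j, τ 2 l < τ 2 j) ∧
      (∀ i < inp 0, K i → ∃ j < c, τ 2 j = i))
    (fun i τ => (∀ i < inp 0, τ 1 i = if K i then 1 else 0) ∧ (v < i → τ 0 5 = v) ∧ τ 0 4 ≤ i ∧
      (∀ j < τ 0 4, τ 2 j < i ∧ K (τ 2 j)) ∧ (∀ j < τ 0 4, ∀ l < j, τ 2 l < τ 2 j) ∧
      (∀ l < i, K l → ∃ j < τ 0 4, τ 2 j = l)) ?_ ?_ ?_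
  · simp only [sem_setVar, Expr.eval]
    refine ⟨?_, ?_, ?_, ?_, ?_, ?_⟩ <;> simp [Store.put]
    exact hK
  · rintro i hi τ ⟨h1, h2, h3, h4, h5, h6⟩
    rw [sem_seq]
    have hrest : ∀ τ : Store, τ 0 0 = i → (∀ i < inp 0, τ 1 i = if K i then 1 else 0) →
        (v < i → τ 0 5 = v) → τ 0 4 ≤ i + 1 →
        (∀ j < τ 0 4, τ 2 j < i + 1 ∧ K (τ 2 j)) → (∀ j < τ 0 4, ∀ l < j, τ 2 l < τ 2 j) →
        (∀ l < i + 1, K l → ∃ j < τ 0 4, τ 2 j = l) →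
        ∀ τ', τ' = (ite (.eq (.mate₁ (.var 0)) (.var 0)) (setVar 5 (.var 0)) skip).sem o inp τ →
        (∀ i < inp 0, τ' 1 i = if K i then 1 else 0) ∧ (v < i + 1 → τ' 0 5 = v) ∧
        τ' 0 4 ≤ i + 1 ∧ (∀ j < τ' 0 4, τ' 2 j < i + 1 ∧ K (τ' 2 j)) ∧
        (∀ j < τ' 0 4, ∀ l < j, τ' 2 l < τ' 2 j) ∧
        (∀ l < i + 1, K l → ∃ j < τ' 0 4, τ' 2 j = l) := by
      intro τ g0 g1 g2 g3 g4 g5 g6 τ' hτ'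
      have e1 : Expr.eval o (encode inp τ) (.mate₁ (.var 0)) = inp (2 + i) := by
        rw [eval_mate₁] <;> rw [eval_var, g0]
        exact hi
      have hcond : Expr.eval o (encode inp τ) (.eq (.mate₁ (.var 0)) (.var 0)) ≠ 0 ↔ i = v := by
        rw [eval_eq_ne_zero, e1, eval_var, g0, hiso i hi]
      by_cases hiv : i = v
      · rw [sem_ite_pos (hcond.2 hiv), sem_setVar, eval_var, g0] at hτ'
        subst hτ'
        simp only [Store.put]
        simp only [one_ne_zero, false_and, if_false, OfNat.ofNat_ne_zero, and_true,
          true_and, if_true, Nat.reduceEqDiff]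
        exact ⟨g1, fun _ => hiv, g3, g4, g5, g6⟩
      · rw [sem_ite_neg (fun hc => hiv (hcond.1 hc)), sem_skip] at hτ'
        subst hτ'
        exact ⟨g1, fun hlt => g2 (by omega), g3, g4, g5, g6⟩
    obtain ⟨τ₁, hτ₁⟩ : ∃ τ₁, τ₁ = (ite (.cell 1 (.var 0)) (seq (setArr 1 (.var 4) (.var 0))
      (setVar 4 (.add (.var 4) (.const 1)))) skip).sem o inp (τ.put 0 0 i) := ⟨_, rfl⟩
    rw [← hτ₁]
    have hcell : Expr.eval o (encode inp (τ.put 0 0 i)) (.cell 1 (.var 0)) = if K i then 1 else 0 := by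
      rw [eval_cell (by omega), eval_var, ← h1 i hi]
      simp [Store.put]
    have hfacts : τ₁ 0 0 = i ∧ τ₁ 1 = τ 1 ∧ τ₁ 0 5 = τ 0 5 ∧
        (K i → τ₁ 0 4 = τ 0 4 + 1 ∧ ∀ j, τ₁ 2 j = if j = τ 0 4 then i else τ 2 j) ∧
        (¬ K i → τ₁ 0 4 = τ 0 4 ∧ ∀ j, τ₁ 2 j = τ 2 j) := by
      by_cases hKi : K i
      · rw [sem_ite_pos (by rw [hcell, if_pos hKi]; exact one_ne_zero)] at hτ₁
        simp only [sem_seq, sem_setArr, sem_setVar, eval_var, Expr.eval] at hτ₁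
        rw [hτ₁]
        refine ⟨by simp [Store.put], by funext j; simp [Store.put], by simp [Store.put],
          fun _ => ⟨by simp [Store.put], fun j => by simp [Store.put]⟩, fun h => absurd hKi h⟩
      · rw [sem_ite_neg (by rw [hcell, if_neg hKi]; simp), sem_skip] at hτ₁
        rw [hτ₁]
        refine ⟨by simp [Store.put], by funext j; simp [Store.put], by simp [Store.put],
          fun h => absurd h hKi, fun _ => ⟨by simp [Store.put], fun j => by simp [Store.put]⟩⟩
    clear hτ₁
    obtain ⟨f0, f1, f5, fK, fK'⟩ := hfacts
    by_cases hKi : K i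
    · obtain ⟨q4, q2⟩ := fK hKi
      refine hrest τ₁ f0 (by rw [f1]; exact h1) (by rw [f5]; exact h2) (by omega) ?_ ?_ ?_ _ rfl
      · intro j hj
        rw [q2]
        split_ifs with hj4
        · exact ⟨by omega, hKi⟩
        · have := h4 j (by omega)
          exact ⟨by omega, this.2⟩
      · intro j hj l hl
        rw [q2, q2, if_neg (by omega)]
        split_ifs with hj4
        · exact (h4 l (by omega)).1
        · exact h5 j (by omega) l hl
      · intro l hl hKl
        rcases Nat.lt_succ_iff_lt_or_eq.1 hl with hl | rfl
        · obtain ⟨j, hj, hjl⟩ := h6 l hl hKl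
          exact ⟨j, by omega, by rw [q2, if_neg (by omega), hjl]⟩
        · exact ⟨τ 0 4, by omega, by rw [q2, if_pos rfl]⟩
    · obtain ⟨q4, q2⟩ := fK' hKi
      refine hrest τ₁ f0 (by rw [f1]; exact h1) (by rw [f5]; exact h2) (by omega) ?_ ?_ ?_ _ rfl
      · intro j hj
        rw [q2]
        have := h4 j (by omega)
        exact ⟨by omega, this.2⟩
      · intro j hj l hl
        rw [q2, q2]
        exact h5 j (by omega) l hl
      · intro l hl hKl
        rcases Nat.lt_succ_iff_lt_or_eq.1 hl with hl | rfl
        · obtain ⟨j, hj, hjl⟩ := h6 l hl hKl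
          exact ⟨j, by omega, by rw [q2, hjl]⟩
        · exact absurd hKl hKi
  · rintro τ ⟨h1, h2, h3, h4, h5, h6⟩
    refine ⟨τ 0 4, ?_, h3, ?_, ?_, ?_, ?_⟩
    · simp [Store.put]
    · simpa [Store.put] using h2 hv
    · simpa [Store.put] using h4
    · simpa [Store.put] using h5
    · simpa [Store.put] using h6

theorem sem_testCrossing_loop {v w : ℕ} {C : ℕ → ℕ} (hv : σ 0 6 = v) (hw : σ 0 7 = w)
    (hC : σ 3 = C) (h8 : σ 0 8 ≠ 0) :
    (repeatTo 0 1 testCrossing).sem o inp σ 0 8 ≠ 0 ↔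
      ∀ y < inp 0, y ≠ w → C y ≠ w → o v w y = o v w (C y) := by
  refine sem_repeatTo (Q := fun τ => τ 0 8 ≠ 0 ↔ _)
    (fun i τ => τ 0 6 = v ∧ τ 0 7 = w ∧ τ 3 = C ∧
      (τ 0 8 ≠ 0 ↔ ∀ y < i, y ≠ w → C y ≠ w → o v w y = o v w (C y))) ?_ ?_ ?_
  · exact ⟨hv, hw, hC, by simp [h8]⟩
  · rintro i hi τ ⟨h6, h7, h3, h8⟩
    have hsucc : (∀ y < i + 1, y ≠ w → C y ≠ w → o v w y = o v w (C y)) ↔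
        (∀ y < i, y ≠ w → C y ≠ w → o v w y = o v w (C y)) ∧
          (i ≠ w → C i ≠ w → o v w i = o v w (C i)) := by
      constructor
      · exact fun H => ⟨fun y hy => H y (by omega), H i (by omega)⟩
      · rintro ⟨H1, H2⟩ y hy
        rcases Nat.lt_succ_iff_lt_or_eq.1 hy with hlt | rfl
        · exact H1 y hlt
        · exact H2
    rw [hsucc, ← h8]
    have e6 : (τ.put 0 1 i) 0 6 = v := by simpa [Store.put] using h6
    have e7 : (τ.put 0 1 i) 0 7 = w := by simpa [Store.put] using h7
    have e1 : (τ.put 0 1 i) 0 1 = i := by simp [Store.put]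
    have e8 : (τ.put 0 1 i) 0 8 = τ 0 8 := by simp [Store.put]
    have e3 : (τ.put 0 1 i) 3 = C := by rw [← h3]; funext j; simp [Store.put]
    rw [← e8]
    generalize τ.put 0 1 i = τ' at *
    have c1 : Expr.eval o (encode inp τ') (.ne (.var 1) (.var 7)) ≠ 0 ↔ i ≠ w := by
      rw [eval_ne_ne_zero, eval_var, eval_var, e1, e7]
    have c2 : Expr.eval o (encode inp τ') (.ne (.cell 3 (.var 1)) (.var 7)) ≠ 0 ↔ C i ≠ w := by
      rw [eval_ne_ne_zero, eval_cell (by omega), eval_var, eval_var, e1, e7, e3]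
    have c3 : Expr.eval o (encode inp τ') (.ne (.orient (.var 6) (.var 7) (.var 1))
        (.orient (.var 6) (.var 7) (.cell 3 (.var 1)))) ≠ 0 ↔ o v w i ≠ o v w (C i) := by
      rw [eval_ne_ne_zero, Expr.eval, Expr.eval, eval_cell (by omega), eval_var, eval_var, eval_var,
        e1, e6, e7, e3]
    rw [testCrossing]
    by_cases d1 : i ≠ w
    · rw [sem_ite_pos (c1.2 d1)]
      by_cases d2 : C i ≠ w
      · rw [sem_ite_pos (c2.2 d2)]
        by_cases d3 : o v w i ≠ o v w (C i)
        · rw [sem_ite_pos (c3.2 d3), sem_setVar]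
          refine ⟨by simpa [Store.put] using e6, by simpa [Store.put] using e7, ?_, ?_⟩
          · rw [← e3]; funext j; simp [Store.put]
          · simp [Store.put, Expr.eval, d1, d2, d3]
        · rw [sem_ite_neg (fun h => d3 (c3.1 h)), sem_skip]
          exact ⟨e6, e7, e3, by simp [not_not.1 d3]⟩
      · rw [sem_ite_neg (fun h => d2 (c2.1 h)), sem_skip]
        exact ⟨e6, e7, e3, by simp [not_not.1 d2]⟩
    · rw [sem_ite_neg (fun h => d1 (c1.1 h)), sem_skip]
      exact ⟨e6, e7, e3, by simp [not_not.1 d1]⟩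
  · rintro τ ⟨-, -, -, h⟩
    simpa [Store.put] using h

open Classical in
-- The order of the cases in the new array is the reverse of the order of the assignments in
-- `doFlip`: the last assignment wins.
theorem sem_attemptFlip {v w : ℕ} {C : ℕ → ℕ} (hv : σ 0 6 = v) (hw : σ 2 (σ 4 (σ 0 0)) = w)
    (hC : σ 3 = C) :
    if w ≠ v ∧ ∀ y < inp 0, y ≠ w → C y ≠ w → o v w y = o v w (C y) then
      attemptFlip.sem o inp σ 0 6 = C w ∧ ∀ i, attemptFlip.sem o inp σ 3 i =
        if i = C w then C w else if i = w then v else if i = v then w else C i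
    else attemptFlip.sem o inp σ 0 6 = v ∧ attemptFlip.sem o inp σ 3 = C := by
  rw [attemptFlip, sem_seq, sem_setVar, eval_cell (by omega), eval_cell (by omega), eval_var, hw]
  have e6 : (σ.put 0 7 w) 0 6 = v := by simpa [Store.put] using hv
  have e7 : (σ.put 0 7 w) 0 7 = w := by simp [Store.put]
  have e3 : (σ.put 0 7 w) 3 = C := by rw [← hC]; funext j; simp [Store.put]
  generalize σ.put 0 7 w = τ at *
  have hcond : Expr.eval o (encode inp τ) (.ne (.var 7) (.var 6)) ≠ 0 ↔ w ≠ v := by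
    rw [eval_ne_ne_zero, eval_var, eval_var, e6, e7]
  by_cases hwv : w ≠ v
  · rw [sem_ite_pos (hcond.2 hwv), sem_seq, sem_seq, sem_setVar]
    have f6 : (τ.put 0 8 (Expr.eval o (encode inp τ) (.const 1))) 0 6 = v := by
      simpa [Store.put] using e6
    have f7 : (τ.put 0 8 (Expr.eval o (encode inp τ) (.const 1))) 0 7 = w := by
      simpa [Store.put] using e7
    have f3 : (τ.put 0 8 (Expr.eval o (encode inp τ) (.const 1))) 3 = C := by
      rw [← e3]; funext j; simp [Store.put]
    have f8 : (τ.put 0 8 (Expr.eval o (encode inp τ) (.const 1))) 0 8 ≠ 0 := by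
      simp [Store.put, Expr.eval]
    generalize τ.put 0 8 (Expr.eval o (encode inp τ) (.const 1)) = τ₁ at *
    have hloop := sem_testCrossing_loop (o := o) (inp := inp) f6 f7 f3 f8
    have g6 := sem_avoidsVar (o := o) (inp := inp) (x := 6) (c := repeatTo 0 1 testCrossing) rfl τ₁
    have g7 := sem_avoidsVar (o := o) (inp := inp) (x := 7) (c := repeatTo 0 1 testCrossing) rfl τ₁
    have g3 := sem_avoidsArr (o := o) (inp := inp) (a := 2) (c := repeatTo 0 1 testCrossing) rfl τ₁
    rw [f6] at g6
    rw [f7] at g7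
    rw [f3] at g3
    generalize (repeatTo 0 1 testCrossing).sem o inp τ₁ = τ₂ at *
    by_cases hall : ∀ y < inp 0, y ≠ w → C y ≠ w → o v w y = o v w (C y)
    · rw [if_pos ⟨hwv, hall⟩, sem_ite_pos (by rw [eval_var]; exact hloop.2 hall)]
      simp only [doFlip, sem_seq, sem_setVar, sem_setArr, eval_var, eval_cell (show 3 < 8 by omega)]
      simp only [Store.put]
      simp only [Nat.reduceAdd] at g3
      simp [g6, g7, g3]
    · rw [if_neg (fun h => hall h.2),
        sem_ite_neg (by rw [eval_var]; exact fun h => hall (hloop.1 h)), sem_skip]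
      exact ⟨g6, g3⟩
  · rw [if_neg (fun h => hwv h.1), sem_ite_neg (fun h => hwv (hcond.1 h)), sem_skip]
    exact ⟨e6, e3⟩

open Classical in
theorem sem_compare (h10 : σ 0 10 ≤ 1) :
    compare.sem o inp σ 0 10 ≤ 1 ∧ (compare.sem o inp σ 0 10 = 1 ↔
      σ 0 10 = 1 ∨ ∀ i < inp 0, σ 3 i = inp (2 + inp 0 + i)) := by
  rw [compare, sem_seq, sem_seq, sem_setVar]
  have e10 : (σ.put 0 9 (Expr.eval o (encode inp σ) (.const 1))) 0 10 = σ 0 10 := by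
    simp [Store.put]
  have e3 : (σ.put 0 9 (Expr.eval o (encode inp σ) (.const 1))) 3 = σ 3 := by
    funext j; simp [Store.put]
  have e9 : (σ.put 0 9 (Expr.eval o (encode inp σ) (.const 1))) 0 9 ≠ 0 := by
    simp [Store.put, Expr.eval]
  generalize σ.put 0 9 (Expr.eval o (encode inp σ) (.const 1)) = τ at *
  set c := repeatTo 0 0 (ite (.ne (.cell 3 (.var 0)) (.mate₂ (.var 0))) (setVar 9 (.const 0)) skip)
    with hc
  have g10 := sem_avoidsVar (o := o) (inp := inp) (x := 10) (c := c) rfl τ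
  have hloop : c.sem o inp τ 0 9 ≠ 0 ↔ ∀ i < inp 0, σ 3 i = inp (2 + inp 0 + i) := by
    rw [hc]
    refine sem_repeatTo (Q := fun τ => τ 0 9 ≠ 0 ↔ _)
      (fun i τ => τ 3 = σ 3 ∧ (τ 0 9 ≠ 0 ↔ ∀ j < i, σ 3 j = inp (2 + inp 0 + j))) ?_ ?_ ?_
    · exact ⟨e3, by simp [e9]⟩
    · rintro i hi τ ⟨h3, h9⟩
      have hsucc : (∀ j < i + 1, σ 3 j = inp (2 + inp 0 + j)) ↔
          (∀ j < i, σ 3 j = inp (2 + inp 0 + j)) ∧ σ 3 i = inp (2 + inp 0 + i) := by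
        constructor
        · exact fun H => ⟨fun y hy => H y (by omega), H i (by omega)⟩
        · rintro ⟨H1, H2⟩ y hy
          rcases Nat.lt_succ_iff_lt_or_eq.1 hy with hlt | rfl
          · exact H1 y hlt
          · exact H2
      rw [hsucc, ← h9]
      have f0 : (τ.put 0 0 i) 0 0 = i := by simp [Store.put]
      have f9 : (τ.put 0 0 i) 0 9 = τ 0 9 := by simp [Store.put]
      have f3 : (τ.put 0 0 i) 3 = σ 3 := by rw [← h3]; funext j; simp [Store.put]
      rw [← f9]
      generalize τ.put 0 0 i = τ' at *
      have hm : Expr.eval o (encode inp τ') (.mate₂ (.var 0)) = inp (2 + inp 0 + i) := by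
        rw [eval_mate₂] <;> rw [eval_var, f0]
        exact hi
      have hcond : Expr.eval o (encode inp τ') (.ne (.cell 3 (.var 0)) (.mate₂ (.var 0))) ≠ 0 ↔
          σ 3 i ≠ inp (2 + inp 0 + i) := by
        rw [eval_ne_ne_zero, hm, eval_cell (by omega), eval_var, f0, f3]
      by_cases hd : σ 3 i ≠ inp (2 + inp 0 + i)
      · rw [sem_ite_pos (hcond.2 hd), sem_setVar]
        refine ⟨?_, ?_⟩
        · rw [← f3]; funext j; simp [Store.put]
        · simp [Store.put, Expr.eval, hd]
      · rw [sem_ite_neg (fun h => hd (hcond.1 h)), sem_skip]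
        exact ⟨f3, by simp [not_not.1 hd]⟩
    · rintro τ ⟨-, h⟩
      simpa [Store.put] using h
  rw [e10] at g10
  generalize c.sem o inp τ = τ' at *
  by_cases hall : ∀ i < inp 0, σ 3 i = inp (2 + inp 0 + i)
  · rw [sem_ite_pos (by rw [eval_var]; exact hloop.2 hall), sem_setVar]
    refine ⟨?_, ?_⟩
    · simp [Store.put, Expr.eval]
    · simp only [Store.put, Expr.eval]
      simpa using Or.inr hall
  · rw [sem_ite_neg (by rw [eval_var]; exact fun h => hall (hloop.1 h)), sem_skip, g10]
    exact ⟨h10, by simp [hall]⟩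

/-- The counter in array `4` is increased by one. -/
theorem sem_nextWord {c x : ℕ} (hc : 0 < c) (h4 : σ 0 4 = c)
    (hW : ∀ i < inp 1, σ 4 i = x / c ^ i % c) :
    (∀ i < inp 1, nextWord.sem o inp σ 4 i = (x + 1) / c ^ i % c) ∧
    (nextWord.sem o inp σ 0 11 = if c ^ inp 1 ∣ x + 1 then 1 else σ 0 11) := by
  rw [nextWord, sem_seq, sem_seq, sem_setVar]
  have e4 : (σ.put 0 12 (Expr.eval o (encode inp σ) (.const 1))) 0 4 = c := by
    simpa [Store.put] using h4
  have e11 : (σ.put 0 12 (Expr.eval o (encode inp σ) (.const 1))) 0 11 = σ 0 11 := by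
    simp [Store.put]
  have e12 : (σ.put 0 12 (Expr.eval o (encode inp σ) (.const 1))) 0 12 ≠ 0 := by
    simp [Store.put, Expr.eval]
  have eW : (σ.put 0 12 (Expr.eval o (encode inp σ) (.const 1))) 4 = σ 4 := by
    funext j; simp [Store.put]
  generalize σ.put 0 12 (Expr.eval o (encode inp σ) (.const 1)) = τ at *
  have g11 := sem_avoidsVar (o := o) (inp := inp) (x := 11) (c := repeatTo 1 0 carryDigit) rfl τ
  rw [e11] at g11
  have hloop : (∀ i < inp 1, (repeatTo 1 0 carryDigit).sem o inp τ 4 i = (x + 1) / c ^ i % c) ∧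
      ((repeatTo 1 0 carryDigit).sem o inp τ 0 12 ≠ 0 ↔ c ^ inp 1 ∣ x + 1) := by
    refine sem_repeatTo (Q := fun τ => (∀ i < inp 1, τ 4 i = (x + 1) / c ^ i % c) ∧
        (τ 0 12 ≠ 0 ↔ c ^ inp 1 ∣ x + 1))
      -- The word is a number `x` in base `c`, least significant digit first. A carry reaches digit
      -- `i` exactly if `c ^ i` divides `x + 1`; the digits before it are already those of `x + 1`,
      -- the others still those of `x`.
      (fun i τ => τ 0 4 = c ∧ (τ 0 12 ≠ 0 ↔ c ^ i ∣ x + 1) ∧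
        (∀ j < i, τ 4 j = (x + 1) / c ^ j % c) ∧
        (∀ j, i ≤ j → j < inp 1 → τ 4 j = x / c ^ j % c)) ?_ ?_ ?_
    · exact ⟨e4, by simp [e12], by simp, fun j _ hj => by rw [eW]; exact hW j hj⟩
    · rintro i hi τ ⟨h4, h12, hlt, hge⟩
      have f0 : (τ.put 0 0 i) 0 0 = i := by simp [Store.put]
      have f4 : (τ.put 0 0 i) 0 4 = c := by simpa [Store.put] using h4
      have f12 : (τ.put 0 0 i) 0 12 = τ 0 12 := by simp [Store.put]
      have fW : (τ.put 0 0 i) 4 = τ 4 := by funext j; simp [Store.put]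
      rw [← f12] at h12
      rw [← fW] at hlt hge
      generalize τ.put 0 0 i = τ' at *
      have hdig := hge i le_rfl hi
      have hmod : x / c ^ i % c < c := Nat.mod_lt _ hc
      have hdvd : c ^ i ∣ x + 1 → (c ^ (i + 1) ∣ x + 1 ↔ x / c ^ i % c + 1 = c) ∧
          (x + 1) / c ^ i % c = if x / c ^ i % c + 1 = c then 0 else x / c ^ i % c + 1 := by
        intro hd
        have hs : (x + 1) / c ^ i = x / c ^ i + 1 := Nat.succ_div_of_dvd hd
        have hmodeq : (x / c ^ i + 1) % c =
            if x / c ^ i % c + 1 = c then 0 else x / c ^ i % c + 1 := by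
          have hdiv := Nat.div_add_mod (x / c ^ i) c
          split_ifs with he
          · have : x / c ^ i + 1 = c * (x / c ^ i / c + 1) := by rw [Nat.mul_add, Nat.mul_one]; omega
            rw [this, Nat.mul_mod_right]
          · have : x / c ^ i + 1 = c * (x / c ^ i / c) + (x / c ^ i % c + 1) := by omega
            rw [this, Nat.mul_add_mod, Nat.mod_eq_of_lt (by omega)]
        refine ⟨?_, by rw [hs, hmodeq]⟩
        rw [pow_succ, ← Nat.dvd_div_iff_mul_dvd hd, hs, Nat.dvd_iff_mod_eq_zero, hmodeq]
        split_ifs with he <;> simp [he]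
      have hndvd : ¬ c ^ i ∣ x + 1 → ¬ c ^ (i + 1) ∣ x + 1 ∧
          (x + 1) / c ^ i % c = x / c ^ i % c := by
        intro hd
        refine ⟨fun h => hd ((pow_dvd_pow c (Nat.le_succ i)).trans h), ?_⟩
        rw [Nat.succ_div_of_not_dvd hd]
      have c2 : Expr.eval o (encode inp τ') (.eq (.add (.cell 4 (.var 0)) (.const 1)) (.var 4)) ≠ 0 ↔
          x / c ^ i % c + 1 = c := by
        rw [eval_eq_ne_zero, Expr.eval, eval_cell (by omega), eval_var, eval_var, Expr.eval, f0, f4,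
          hdig]
      rw [carryDigit]
      by_cases hd : c ^ i ∣ x + 1
      · obtain ⟨k1, k2⟩ := hdvd hd
        rw [sem_ite_pos (by rw [eval_var]; exact h12.2 hd)]
        by_cases he : x / c ^ i % c + 1 = c
        · rw [sem_ite_pos (c2.2 he), sem_setArr, eval_var, f0, Expr.eval]
          rw [if_pos he] at k2
          refine ⟨by simpa [Store.put] using f4, ?_, ?_, ?_⟩
          · rw [k1, ← (show τ' 0 12 ≠ 0 ↔ _ from ⟨fun _ => he, fun _ => h12.2 hd⟩)]
            simp [Store.put]
          · intro j hj
            simp only [Store.put, Nat.reduceAdd, true_and]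
            grind
          · intro j hj hj'
            simp only [Store.put, Nat.reduceAdd, true_and]
            grind
        · rw [sem_ite_neg (fun h => he (c2.1 h)), sem_seq, sem_setArr, sem_setVar]
          simp only [eval_cell (show 4 < 8 by omega), eval_var, f0, Expr.eval, hdig]
          rw [if_neg he] at k2
          refine ⟨by simpa [Store.put] using f4, ?_, ?_, ?_⟩
          · rw [k1]
            simp [Store.put, he]
          · intro j hj
            simp only [Store.put, Nat.reduceAdd, true_and]
            grind
          · intro j hj hj'
            simp only [Store.put, Nat.reduceAdd, true_and]
            grind
      · obtain ⟨k1, k2⟩ := hndvd hd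
        rw [sem_ite_neg (by rw [eval_var]; exact fun h => hd (h12.1 h)), sem_skip]
        refine ⟨f4, ?_, ?_, fun j hj hj' => hge j (by omega) hj'⟩
        · rw [h12]; exact ⟨fun h => absurd h hd, fun h => absurd h k1⟩
        · intro j hj
          rcases Nat.lt_succ_iff_lt_or_eq.1 hj with hj | rfl
          · exact hlt j hj
          · rw [hdig, k2]
    · rintro τ ⟨-, h12, hlt, -⟩
      refine ⟨?_, ?_⟩
      · simpa [Store.put] using hlt
      · simpa [Store.put] using h12
  generalize (repeatTo 1 0 carryDigit).sem o inp τ = τ' at *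
  by_cases hd : c ^ inp 1 ∣ x + 1
  · rw [sem_ite_pos (by rw [eval_var]; exact hloop.2.2 hd), sem_setVar, if_pos hd]
    refine ⟨?_, by simp [Store.put, Expr.eval]⟩
    simpa [Store.put] using hloop.1
  · rw [sem_ite_neg (by rw [eval_var]; exact fun h => hd (hloop.2.1 h)), sem_skip, if_neg hd]
    exact ⟨hloop.1, g11⟩

end Cmd
end OddMatchings

namespace OddMatchings

/-! ### Correctness and running time of the search -/

section

variable {n : ℕ} {p : Fin n → Plane} {r : Plane → ℕ} {m m' : Plane → Plane} {v v' : Plane}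

/-- The array `C` holds the labels of the partners in the pairing `m`. -/
def Represents (p : Fin n → Plane) (C : ℕ → ℕ) (m : Plane → Plane) : Prop :=
  ∀ i < n, C i < n ∧ label p (C i) = m (label p i)

/-- Orientation tests return only `0` or `1`, so equal answers mean that both ends of an edge lie on
the same side of the new edge. -/
theorem Represents.flip_iff {C : ℕ → ℕ} (hC : Represents p C m) (hp : Function.Injective p)
    (hR : IsRank r (Set.range p)) (h : IsPairing r (Set.range p) m v) {a w : ℕ} (ha : a < n)
    (hav : label p a = v) (hw : w < n) :
    (w ≠ a ∧ ∀ y < n, y ≠ w → C y ≠ w → orientTest p a w y = orientTest p a w (C y)) ↔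
      label p w ≠ v ∧ IsPairing r (Set.range p) (flipAt m v (label p w)) (m (label p w)) := by
  have hwa : w ≠ a ↔ label p w ≠ v := by rw [← hav, ne_eq, ne_eq, label_inj hp hw ha]
  rw [hwa]
  refine and_congr_right fun hne => ?_
  rw [isPairing_flipAt_iff hR.inj h (label_mem hw) hne]
  have key : ∀ y < n, (orientTest p a w y = orientTest p a w (C y) ↔
      (Cyc (r v) (r (label p w)) (r (label p y)) ↔
        Cyc (r v) (r (label p w)) (r (m (label p y))))) := by
    intro y hy
    have e1 := orientTest_ne_zero hR ha hw hy
    have e2 := orientTest_ne_zero hR ha hw (hC y hy).1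
    rw [hav] at e1 e2
    rw [(hC y hy).2] at e2
    rw [← e1, ← e2]
    have := orientTest_le_one (p := p) a w y
    have := orientTest_le_one (p := p) a w (C y)
    omega
  constructor
  · intro H x hx hxw hmx
    obtain ⟨y, hy, rfl⟩ := exists_label hx
    refine (key y hy).1 (H y hy (fun e => hxw (by rw [e])) fun e => hmx ?_)
    rw [← (hC y hy).2, e]
  · intro H y hy hyw hCy
    refine (key y hy).2 (H _ (label_mem hy) (fun e => hyw ((label_inj hp hy hw).1 e)) fun e => ?_)
    rw [← (hC y hy).2] at e
    exact hCy ((label_inj hp (hC y hy).1 hw).1 e)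

theorem Represents.flipAt {C : ℕ → ℕ} (hC : Represents p C m) (hp : Function.Injective p)
    (h : IsPairing r (Set.range p) m v) {a w : ℕ} (ha : a < n)
    (hav : label p a = v) (hw : w < n) (hwa : w ≠ a) :
    Represents p (fun i => if i = C w then C w else if i = w then a else if i = a then w else C i)
      (OddMatchings.flipAt m v (label p w)) := by
  have hne : label p w ≠ v := by rw [← hav, ne_eq, label_inj hp hw ha]; exact hwa
  have iso := h.iso
  have inv := h.inv
  intro i hi
  have hCw := hC w hw
  have q1 : i = C w ↔ label p i = m (label p w) := by rw [← hCw.2, label_inj hp hi hCw.1]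
  have q2 : i = w ↔ label p i = label p w := by rw [label_inj hp hi hw]
  have q3 : i = a ↔ label p i = v := by rw [← hav, label_inj hp hi ha]
  have q4 : m (label p w) ≠ v := fun e => hne (by rw [← inv (label p w), e, iso])
  have q5 : m (label p w) ≠ label p w := fun e => hne (h.uniq _ (label_mem hw) e)
  have hCi := hC i hi
  simp only [OddMatchings.flipAt]
  by_cases h1 : i = C w
  · have := q1.1 h1
    rw [if_pos h1, if_neg (by rw [this]; exact q4), if_neg (by rw [this]; exact q5), if_pos this]
    exact ⟨hCw.1, by rw [hCw.2, this]⟩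
  rw [if_neg h1]
  by_cases h2 : i = w
  · rw [if_pos h2, if_neg (by rw [q2.1 h2]; exact hne), if_pos (q2.1 h2)]
    exact ⟨ha, hav⟩
  rw [if_neg h2]
  by_cases h3 : i = a
  · rw [if_pos h3, if_pos (q3.1 h3)]
    exact ⟨hw, rfl⟩
  rw [if_neg h3, if_neg (mt q3.2 h3), if_neg (mt q2.2 h2), if_neg (mt q1.2 h1)]
  exact hCi

theorem Represents.eq_iff {C D : ℕ → ℕ} (hC : Represents p C m) (hD : Represents p D m')
    (hp : Function.Injective p) (h : IsPairing r (Set.range p) m v)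
    (h' : IsPairing r (Set.range p) m' v') :
    (∀ i < n, C i = D i) ↔ (m, v) = (m', v') := by
  constructor
  · intro H
    have e : m = m' := by
      funext x
      by_cases hx : x ∈ Set.range p
      · obtain ⟨i, hi, rfl⟩ := exists_label hx
        rw [← (hC i hi).2, ← (hD i hi).2, H i hi]
      · rw [h.off x hx, h'.off x hx]
    subst e
    rw [h'.uniq v h.mem h.iso]
  · intro H i hi
    obtain ⟨rfl, -⟩ := Prod.mk.inj H
    rw [← label_inj hp (hC i hi).1 (hD i hi).1, (hC i hi).2, (hD i hi).2]

/-- The flips are carried out on the full point set, starting from a fresh copy of the first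
matching. Only the letters, read through array `2`, are restricted to the kernel. -/
theorem Cmd.sem_simulate {inp : Memory} {σ : Store} (hp : Function.Injective p)
    (hR : IsRank r (Set.range p)) (h : IsPairing r (Set.range p) m v) (hsize : inp 0 = n)
    (hinp : Represents p (fun i => inp (2 + i)) m) (hv : σ 0 5 < n) (hvl : label p (σ 0 5) = v)
    (hL : ∀ i < inp 1, σ 2 (σ 4 i) < n) :
    Represents p (simulate.sem (orientTest p) inp σ 3)
      (runWord r (Set.range p) (m, v) (fun i => label p (σ 2 (σ 4 i))) (inp 1)).1 := by
  rw [simulate, sem_seq, sem_seq]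
  obtain ⟨τ, hτ⟩ : ∃ τ, τ = (repeatTo 0 0 (setArr 2 (.var 0) (.mate₁ (.var 0)))).sem
    (orientTest p) inp σ := ⟨_, rfl⟩
  have t3 : ∀ i < inp 0, τ 3 i = inp (2 + i) := by
    rw [hτ]
    refine sem_repeatTo (Q := fun τ => ∀ i < inp 0, τ 3 i = inp (2 + i))
      (fun j τ => ∀ i < j, τ 3 i = inp (2 + i)) (fun i hi => absurd hi (Nat.not_lt_zero i)) ?_ ?_
    · intro j hj τ ih i hi
      have g0 : (τ.put 0 0 j) 0 0 = j := by simp [Store.put]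
      rw [sem_setArr, eval_mate₁ (by rw [eval_var, g0]; exact hj), eval_var, g0]
      by_cases hij : i = j
      · subst hij; simp [Store.put]
      · simpa [Store.put, hij] using ih i (by omega)
    · intro τ ih i hi
      simpa [Store.put] using ih i hi
  have t5 : τ 0 5 = σ 0 5 := by rw [hτ]; exact sem_avoidsVar rfl σ
  have t2 : τ 2 = σ 2 := by rw [hτ]; exact sem_avoidsArr (a := 1) rfl σ
  have t4 : τ 4 = σ 4 := by rw [hτ]; exact sem_avoidsArr (a := 3) rfl σ
  rw [← hτ, sem_setVar, eval_var, t5]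
  obtain ⟨g, hg⟩ : ∃ g, g = fun i => label p (σ 2 (σ 4 i)) := ⟨_, rfl⟩
  rw [← hg]
  refine sem_repeatTo (Q := fun ρ => Represents p (ρ 3)
      (runWord r (Set.range p) (m, v) g (inp 1)).1)
    (fun i ρ => ρ 2 = σ 2 ∧ ρ 4 = σ 4 ∧ ρ 0 6 < n ∧
      label p (ρ 0 6) = (runWord r (Set.range p) (m, v) g i).2 ∧
      Represents p (ρ 3) (runWord r (Set.range p) (m, v) g i).1) ?_ ?_ ?_
  · refine ⟨?_, ?_, ?_, ?_, ?_⟩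
    · rw [← t2]; funext j; simp [Store.put]
    · rw [← t4]; funext j; simp [Store.put]
    · simpa [Store.put] using hv
    · simpa [Store.put, runWord] using hvl
    · intro i hi
      have : (τ.put 0 6 (σ 0 5)) 3 i = inp (2 + i) := by
        simpa [Store.put] using t3 i (by omega)
      rw [this]
      exact hinp i hi
  · rintro i hi ρ ⟨r2, r4, r6, rv, rC⟩
    have hpair : IsPairing r (Set.range p) (runWord r (Set.range p) (m, v) g i).1
      (runWord r (Set.range p) (m, v) g i).2 := runWord_isPairing (p := (m, v)) h g i
    have s0 : (ρ.put 0 0 i) 0 0 = i := by simp [Store.put]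
    have s2 : (ρ.put 0 0 i) 2 = σ 2 := by rw [← r2]; funext j; simp [Store.put]
    have s3 : (ρ.put 0 0 i) 3 = ρ 3 := by funext j; simp [Store.put]
    have s4 : (ρ.put 0 0 i) 4 = σ 4 := by rw [← r4]; funext j; simp [Store.put]
    have s6 : (ρ.put 0 0 i) 0 6 = ρ 0 6 := by simp [Store.put]
    have hw := hL i hi
    have hstep := sem_attemptFlip (o := orientTest p) (inp := inp) s6 (w := σ 2 (σ 4 i))
      (by rw [s0, s2, s4]) s3
    have hiff := rC.flip_iff hp hR hpair r6 rv hw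
    have hgi : label p (σ 2 (σ 4 i)) = g i := by rw [hg]
    rw [hgi] at hiff
    rw [hsize] at hstep
    refine ⟨?_, ?_, ?_⟩
    · rw [sem_avoidsArr (a := 1) rfl, s2]
    · rw [sem_avoidsArr (a := 3) rfl, s4]
    simp only [runWord, tryFlip]
    by_cases hc : σ 2 (σ 4 i) ≠ ρ 0 6 ∧ ∀ y < n, y ≠ σ 2 (σ 4 i) → ρ 3 y ≠ σ 2 (σ 4 i) →
        orientTest p (ρ 0 6) (σ 2 (σ 4 i)) y = orientTest p (ρ 0 6) (σ 2 (σ 4 i)) (ρ 3 y)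
    · rw [if_pos hc] at hstep
      rw [if_pos (hiff.1 hc), hstep.1, funext hstep.2]
      refine ⟨(rC _ hw).1, by rw [(rC _ hw).2, hgi], ?_⟩
      rw [← hgi]
      exact rC.flipAt hp hpair r6 rv hw hc.1
    · rw [if_neg hc] at hstep
      rw [if_neg (mt hiff.2 hc), hstep.1, hstep.2]
      exact ⟨r6, rv, rC⟩
  · rintro ρ ⟨-, -, -, -, rC⟩
    have : (ρ.put 0 0 (inp 1)) 3 = ρ 3 := by funext j; simp [Store.put]
    rw [this]
    exact rC

end

/-- Every word of length `k` is met by the counter. -/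
theorem exists_digits {c : ℕ} (k : ℕ) (d : ℕ → ℕ) (hd : ∀ i < k, d i < c) :
    ∃ x < c ^ k, ∀ i < k, x / c ^ i % c = d i := by
  induction k generalizing d with
  | zero => exact ⟨0, by simp, fun i hi => absurd hi (Nat.not_lt_zero i)⟩
  | succ k ih =>
    obtain ⟨x, hx, hxd⟩ := ih (fun i => d (i + 1)) fun i hi => hd (i + 1) (by omega)
    have h0 := hd 0 (by omega)
    refine ⟨d 0 + c * x, ?_, fun i hi => ?_⟩
    · rw [pow_succ]
      nlinarith
    · cases i with
      | zero => simp [Nat.add_mul_mod_self_left, Nat.mod_eq_of_lt h0]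
      | succ i =>
        rw [pow_succ, mul_comm (c ^ i) c, ← Nat.div_div_eq_div_mul,
          Nat.add_mul_div_left _ _ (by omega), Nat.div_eq_of_lt h0, zero_add]
        exact hxd i (by omega)

theorem two_mul_add_one_pow_le (k : ℕ) : (2 * k + 1) ^ k ≤ 2 * (2 * k) ^ k := by
  -- With `b = 2k`, this is `(b + 1) ^ j - b ^ j ≤ j (b + 1) ^ (j - 1)`, multiplied by `b + 1`. For
  -- `j = k` it gives `(k + 1) (b + 1) ^ k ≤ (2k + 1) b ^ k`.
  have key : ∀ j, (2 * k + 1) ^ j * (2 * k + 1) ≤ (2 * k) ^ j * (2 * k + 1) + j * (2 * k + 1) ^ j := by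
    intro j
    induction j with
    | zero => simp
    | succ j ih =>
      have h1 := Nat.mul_le_mul_right (2 * k) ih
      rw [pow_succ, pow_succ]
      generalize (2 * k + 1) ^ j = A at *
      generalize (2 * k) ^ j = B at *
      generalize 2 * k = b at *
      nlinarith [Nat.zero_le (j * A)]
  have := key k
  generalize (2 * k + 1) ^ k = A at *
  generalize (2 * k) ^ k = B at *
  by_contra hc
  nlinarith [Nat.zero_le (k * B)]

/-- For `k ≤ n` the factor `k + 1` is polynomial in `n`. For `k > n` the alphabet has fewer than `k`
letters, and `k + 1 ≤ 2 ^ k` pays for the factor. -/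
theorem pow_mul_le {c k n : ℕ} (h1 : c ≤ 2 * k + 1) (h2 : c ≤ n) :
    c ^ k * (k + 1) ≤ 2 * (n + 1) * (2 * k) ^ k := by
  by_cases hkn : k ≤ n
  · calc c ^ k * (k + 1) ≤ (2 * k + 1) ^ k * (n + 1) :=
          Nat.mul_le_mul (Nat.pow_le_pow_left h1 k) (by omega)
      _ ≤ 2 * (2 * k) ^ k * (n + 1) := Nat.mul_le_mul_right _ (two_mul_add_one_pow_le k)
      _ = _ := by ring
  · have h3 : c ≤ k := by omega
    calc c ^ k * (k + 1) ≤ k ^ k * 2 ^ k :=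
          Nat.mul_le_mul (Nat.pow_le_pow_left h3 k) (Nat.lt_two_pow_self)
      _ = 1 * (2 * k) ^ k := by rw [mul_pow]; ring
      _ ≤ 2 * (n + 1) * (2 * k) ^ k := Nat.mul_le_mul_right _ (by omega)

theorem computable_two_mul_pow_self : Computable fun k : ℕ => (2 * k) ^ k :=
  ((Primrec₂.unpaired'.1 Nat.Primrec.pow).comp
    (Primrec.nat_mul.comp (Primrec.const 2) Primrec.id) Primrec.id).to_comp

theorem testWord_step {o : ℕ → ℕ → ℕ → ℕ} {inp : Memory} {c v₀ : ℕ} {L : ℕ → ℕ} (hc : 0 < c)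
    {good : ℕ → Prop} (hgood : ∀ x (σ : Store), σ 0 5 = v₀ → σ 2 = L →
      (∀ i < inp 1, σ 4 i = x / c ^ i % c) →
      ((∀ i < inp 0, Cmd.simulate.sem o inp σ 3 i = inp (2 + inp 0 + i)) ↔ good x))
    {x : ℕ} {σ : Store} (hx : x + 1 ≤ c ^ inp 1) (h4 : σ 0 4 = c) (h5 : σ 0 5 = v₀) (h2 : σ 2 = L)
    (hW : ∀ i < inp 1, σ 4 i = x / c ^ i % c) (h11 : σ 0 11 = 0) (h10 : σ 0 10 ≤ 1) :
    Cmd.testWord.sem o inp σ 0 4 = c ∧ Cmd.testWord.sem o inp σ 0 5 = v₀ ∧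
      Cmd.testWord.sem o inp σ 2 = L ∧
      (Cmd.testWord.sem o inp σ 0 10 ≤ 1 ∧
        (Cmd.testWord.sem o inp σ 0 10 = 1 ↔ σ 0 10 = 1 ∨ good x)) ∧
      (∀ i < inp 1, Cmd.testWord.sem o inp σ 4 i = (x + 1) / c ^ i % c) ∧
      Cmd.testWord.sem o inp σ 0 11 = if x + 1 = c ^ inp 1 then 1 else 0 := by
  refine ⟨?_, ?_, ?_, ?_⟩
  · rw [Cmd.sem_avoidsVar rfl, h4]
  · rw [Cmd.sem_avoidsVar rfl, h5]
  · rw [Cmd.sem_avoidsArr (a := 1) rfl, h2]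
  rw [Cmd.testWord, Cmd.sem_seq, Cmd.sem_seq]
  obtain ⟨τ, hτ⟩ : ∃ τ, τ = Cmd.simulate.sem o inp σ := ⟨_, rfl⟩
  have hg := hgood x σ h5 h2 hW
  rw [← hτ] at hg ⊢
  have t10 : τ 0 10 = σ 0 10 := by rw [hτ]; exact Cmd.sem_avoidsVar rfl σ
  have t11 : τ 0 11 = 0 := by rw [hτ, Cmd.sem_avoidsVar rfl, h11]
  have t4 : τ 0 4 = c := by rw [hτ, ← h4]; exact Cmd.sem_avoidsVar rfl σ
  have tW : τ 4 = σ 4 := by rw [hτ]; exact Cmd.sem_avoidsArr (a := 3) rfl σ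
  have hcmp := Cmd.sem_compare (o := o) (inp := inp) (σ := τ) (by omega)
  obtain ⟨ρ, hρ⟩ : ∃ ρ, ρ = Cmd.compare.sem o inp τ := ⟨_, rfl⟩
  rw [← hρ] at hcmp ⊢
  have r11 : ρ 0 11 = 0 := by rw [hρ, Cmd.sem_avoidsVar rfl, t11]
  have r4 : ρ 0 4 = c := by rw [hρ, ← t4]; exact Cmd.sem_avoidsVar rfl τ
  have rW : ρ 4 = σ 4 := by rw [hρ, ← tW]; exact Cmd.sem_avoidsArr (a := 3) rfl τ
  obtain ⟨n1, n2⟩ := Cmd.sem_nextWord (o := o) (inp := inp) (σ := ρ) hc r4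
    (by rw [rW]; exact hW)
  refine ⟨?_, n1, ?_⟩
  · rw [Cmd.sem_avoidsVar rfl, ← hg, ← t10]
    exact hcmp
  · rw [n2, r11]
    -- The counter overflows for the first time after the last word.
    have : c ^ inp 1 ∣ x + 1 ↔ x + 1 = c ^ inp 1 :=
      ⟨fun hd => le_antisymm hx (Nat.le_of_dvd (by omega) hd), fun e => e ▸ dvd_rfl⟩
    simp only [this]

/-- Test all words from the current one on. -/
def searchLoop : Prog := .loop (.sub (.const 1) (.var 11)) Cmd.testWord.compile

/-- Here `d` words follow the current word `x`, so there are `d + 1` rounds. For `k = 0` there is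
one round, which tests the empty word. -/
theorem exec_searchLoop {o : ℕ → ℕ → ℕ → ℕ} {inp : Memory} {c v₀ : ℕ} {L : ℕ → ℕ} (hc : 0 < c)
    {good : ℕ → Prop} (hgood : ∀ x (σ : Store), σ 0 5 = v₀ → σ 2 = L →
      (∀ i < inp 1, σ 4 i = x / c ^ i % c) →
      ((∀ i < inp 0, Cmd.simulate.sem o inp σ 3 i = inp (2 + inp 0 + i)) ↔ good x)) (d : ℕ) :
    ∀ x (σ : Store), x + d + 1 = c ^ inp 1 → σ 0 4 = c → σ 0 5 = v₀ → σ 2 = L →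
      (∀ i < inp 1, σ 4 i = x / c ^ i % c) → σ 0 11 = 0 → σ 0 10 ≤ 1 →
      ∃ t ≤ (d + 1) * (Cmd.testWord.time inp + 29) + 29, ∃ σ' : Store,
        Exec o searchLoop (encode inp σ) t (encode inp σ') ∧ σ' 0 10 ≤ 1 ∧
        (σ' 0 10 = 1 ↔ σ 0 10 = 1 ∨ ∃ y, x ≤ y ∧ y < c ^ inp 1 ∧ good y) := by
  have hcond : ∀ τ : Store,
      Expr.eval o (encode inp τ) (.sub (.const 1) (.var 11)) = 1 - τ 0 11 := by
    intro τ
    rw [Expr.eval, eval_var, Expr.eval]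
  have hcost : (Expr.sub (.const 1) (.var 11)).cost = 28 := rfl
  induction d with
  | zero =>
    intro x σ hx h4 h5 h2 hW h11 h10
    obtain ⟨t₁, ht₁, e₁⟩ := Cmd.exec_compile (o := o) (inp := inp) (c := Cmd.testWord) rfl σ
    obtain ⟨s1, s2, s3, s4, s5, s6⟩ := testWord_step hc hgood hx.le h4 h5 h2 hW h11 h10
    rw [if_pos (by omega)] at s6
    refine ⟨_, ?_, _, Exec.loopStep ?_ e₁ (Exec.loopStop ?_), s4.1, ?_⟩
    · rw [hcost]; omega
    · rw [hcond, h11]; omega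
    · rw [hcond, s6]
    · rw [s4.2]
      refine or_congr_right ⟨fun hg => ⟨x, le_rfl, by omega, hg⟩, fun ⟨y, h1, h2, hg⟩ => ?_⟩
      obtain rfl : y = x := by omega
      exact hg
  | succ d ih =>
    intro x σ hx h4 h5 h2 hW h11 h10
    obtain ⟨t₁, ht₁, e₁⟩ := Cmd.exec_compile (o := o) (inp := inp) (c := Cmd.testWord) rfl σ
    obtain ⟨s1, s2, s3, s4, s5, s6⟩ := testWord_step hc hgood (by omega) h4 h5 h2 hW h11 h10
    rw [if_neg (by omega)] at s6
    obtain ⟨t₂, ht₂, σ', e₂, u1, u2⟩ := ih (x + 1) _ (by omega) s1 s2 s3 s5 s6 s4.1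
    refine ⟨_, ?_, σ', Exec.loopStep ?_ e₁ e₂, u1, ?_⟩
    · rw [hcost, Nat.succ_mul]; omega
    · rw [hcond, h11]; omega
    · rw [u2, s4.2, or_assoc]
      refine or_congr_right ⟨?_, ?_⟩
      · rintro (hg | ⟨y, h1, h2, hg⟩)
        · exact ⟨x, le_rfl, by omega, hg⟩
        · exact ⟨y, by omega, h2, hg⟩
      · rintro ⟨y, h1, h2, hg⟩
        rcases Nat.eq_or_lt_of_le h1 with rfl | hlt
        · exact Or.inl hg
        · exact Or.inr ⟨y, hlt, h2, hg⟩

theorem core_subset {α : Type*} {r : α → ℕ} {S : Set α} {m m' : α → α} : core r S m m' ⊆ S :=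
  fun _ hx => hx.1

theorem IsPairing.isolated_mem_core {α : Type*} {r : α → ℕ} {S : Set α} {m m' : α → α} {v : α}
    (h : IsPairing r S m v) : v ∈ core r S m m' :=
  ⟨h.mem, fun hg => hg.2.1 h.isBad_isolated⟩

/-- A flip sequence on `S` is projected to the core and lifted back; after this detour all its
letters lie in the core. -/
theorem pairReach_iff_exists_word {α : Type*} {r : α → ℕ} {S : Set α} {m m' : α → α} {v v' : α}
    (hS : S.Finite) (hr : Set.InjOn r S) (h : IsPairing r S m v) (h' : IsPairing r S m' v')
    (k : ℕ) : PairReach r S S k (m, v) (m', v') ↔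
      ∃ g : ℕ → α, (∀ i < k, g i ∈ core r S m m') ∧ runWord r S (m, v) g k = (m', v') := by
  constructor
  · intro hk
    obtain ⟨-, -, h1, h2⟩ := core_reduction hS hr h h'
    obtain ⟨g, hg, e⟩ := (h2 k _ (h1 k hk)).exists_word h.isolated_mem_core
    exact ⟨g, fun i _ => hg i, e⟩
  · rintro ⟨g, hg, e⟩
    rw [← e]
    exact runWord_reach (p := (m, v)) h fun i hi => core_subset (hg i hi)

/-- Compute the kernel, and test all words of length `k` over its points if there are at most
`2 * k + 1` of them. -/
def searchProgram : Prog :=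
  .seq (Cmd.seq Cmd.markKernel Cmd.listKernel).compile
    (.seq (.ite (.sub (.var 4) (.add (.add (.load (.const 1)) (.load (.const 1))) (.const 1)))
      .skip searchLoop) (.store (.const 0) (.var 10)))

/-- The 100 steps are room for the size test and the output; 129 also includes the last test of the
search loop. Here `1 ≤ (2 * k) ^ k` holds for `k = 0` too, as `0 ^ 0 = 1`. -/
theorem search_time_le {A B n k c t₁ t₂ : ℕ} (h1 : t₁ ≤ A * (n + 1) ^ 2)
    (h2 : t₂ ≤ c ^ k * (B * ((n + 1) * (k + 1)) + 29) + 29) (hc : c ≤ 2 * k + 1) (hn : c ≤ n) :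
    t₁ + (t₂ + 100) ≤ (2 * k) ^ k * ((A + 2 * (B + 29) + 129) * (n + 1) ^ 2) := by
  have hE : 1 ≤ (2 * k) ^ k := by
    rcases Nat.eq_zero_or_pos k with rfl | hk
    · simp
    · exact Nat.pow_pos (by omega)
  have hN : 1 ≤ (n + 1) ^ 2 := Nat.pow_pos (by omega)
  have h3 := pow_mul_le hc hn
  have h4 : c ^ k * (B * ((n + 1) * (k + 1)) + 29) ≤
      (2 * k) ^ k * (2 * (B + 29) * (n + 1) ^ 2) := by
    calc c ^ k * (B * ((n + 1) * (k + 1)) + 29)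
        ≤ c ^ k * ((B + 29) * ((n + 1) * (k + 1))) := by
          refine Nat.mul_le_mul_left _ ?_
          have : 1 ≤ (n + 1) * (k + 1) := Nat.mul_pos (by omega) (by omega)
          rw [add_mul B]
          omega
      _ = (B + 29) * (n + 1) * (c ^ k * (k + 1)) := by ring
      _ ≤ (B + 29) * (n + 1) * (2 * (n + 1) * (2 * k) ^ k) := Nat.mul_le_mul_left _ h3
      _ = _ := by ring
  have h5 : A * (n + 1) ^ 2 ≤ (2 * k) ^ k * (A * (n + 1) ^ 2) := Nat.le_mul_of_pos_left _ hE
  have h6 : 129 ≤ (2 * k) ^ k * (129 * (n + 1) ^ 2) := by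
    have := Nat.mul_le_mul hE hN
    nlinarith
  calc t₁ + (t₂ + 100) ≤ A * (n + 1) ^ 2 + c ^ k * (B * ((n + 1) * (k + 1)) + 29) + 129 := by omega
    _ ≤ (2 * k) ^ k * (A * (n + 1) ^ 2) + (2 * k) ^ k * (2 * (B + 29) * (n + 1) ^ 2) +
        (2 * k) ^ k * (129 * (n + 1) ^ 2) := by omega
    _ = _ := by ring

theorem flipDistanceFPT : FlipDistanceFPT fun k => (2 * k) ^ k := by
  classical
  obtain ⟨A, hA⟩ := Cmd.exists_time_le (c := .seq Cmd.markKernel Cmd.listKernel) rfl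
  obtain ⟨B, hB⟩ := Cmd.exists_time_le (c := Cmd.testWord) rfl
  have a0 : (Cmd.seq Cmd.markKernel Cmd.listKernel).depth 0 = 2 := rfl
  have a1 : (Cmd.seq Cmd.markKernel Cmd.listKernel).depth 1 = 0 := rfl
  have b0 : Cmd.testWord.depth 0 = 1 := rfl
  have b1 : Cmd.testWord.depth 1 = 1 := rfl
  refine ⟨computable_two_mul_pow_self, searchProgram,
    Polynomial.C (A + 2 * (B + 29) + 129) * (Polynomial.X + 1) ^ 2, ?_⟩
  intro n p hp M M' k
  have hS : ConvexIndependent ℝ ((↑) : Set.range p → Plane) := hp.range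
  obtain ⟨r, hR⟩ := exists_isRank hS (Set.finite_range p)
  obtain ⟨m, v, h, e⟩ := IsOddMatching.exists_isPairing hR M.2
  obtain ⟨m', v', h', e'⟩ := IsOddMatching.exists_isPairing hR M'.2
  obtain rfl : M = h.toOddMatching hR := Subtype.ext e
  obtain rfl : M' = h'.toOddMatching hR := Subtype.ext e'
  rw [flipDist_le_iff hR h h' k]
  change ∃ t s, Exec _ _ (inputMemory p (edgesOf m) (edgesOf m') k) t s ∧ _
  have hmate : Represents p (fun i => inputMemory p (edgesOf m) (edgesOf m') k (2 + i)) m :=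
    fun i hi => input_mate₁ h (edgesOf m') k hi
  have hmate' : Represents p (fun i => inputMemory p (edgesOf m) (edgesOf m') k (2 + n + i)) m' :=
    fun i hi => input_mate₂ h' (edgesOf m) k hi
  have hcore : ∀ i < n, (InputCore (orientTest p) (inputMemory p (edgesOf m) (edgesOf m') k) i ↔
      label p i ∈ core r (Set.range p) m m') := fun i hi => inputCore_iff hp.injective hR h h' k hi
  have henc := encode_input (p := p) (edgesOf m) (edgesOf m') k
  have hsize := input_size (p := p) (edgesOf m) (edgesOf m') k
  have hpar := input_parameter (p := p) (edgesOf m) (edgesOf m') k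
  generalize inputMemory p (edgesOf m) (edgesOf m') k = inp at *
  obtain ⟨v₀, hv₀, hvl⟩ := exists_label h.mem
  have hiso : ∀ i < inp 0, inp (2 + i) = i ↔ i = v₀ := by
    intro i hi
    rw [hsize] at hi
    have := hmate i hi
    rw [← label_inj hp.injective this.1 hi, ← label_inj hp.injective hi hv₀, this.2, hvl]
    exact ⟨h.uniq _ (label_mem hi), fun e => by rw [e, h.iso]⟩
  obtain ⟨t₁, ht₁, e₁⟩ := Cmd.exec_compile (o := orientTest p) (inp := inp)
    (c := .seq Cmd.markKernel Cmd.listKernel) rfl (fun _ _ => 0)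
  obtain ⟨c, hc4, hcn, hc5, hc2, hcmono, hcsurj⟩ := Cmd.sem_listKernel (o := orientTest p)
    (Cmd.sem_markKernel (o := orientTest p) (inp := inp) (σ := fun _ _ => 0))
    (by rw [hsize]; exact hv₀) hiso
  have z4 : (Cmd.seq Cmd.markKernel Cmd.listKernel).sem (orientTest p) inp (fun _ _ => 0) 4 =
    fun _ => 0 := Cmd.sem_avoidsArr (a := 3) rfl _
  have z10 : (Cmd.seq Cmd.markKernel Cmd.listKernel).sem (orientTest p) inp (fun _ _ => 0) 0 10 =
    0 := Cmd.sem_avoidsVar rfl _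
  have z11 : (Cmd.seq Cmd.markKernel Cmd.listKernel).sem (orientTest p) inp (fun _ _ => 0) 0 11 =
    0 := Cmd.sem_avoidsVar rfl _
  rw [Cmd.sem_seq] at e₁ z4 z10 z11
  rw [henc] at e₁
  generalize Cmd.listKernel.sem (orientTest p) inp _ = σ at *
  have ht₁' := ht₁.trans (hA inp)
  rw [a0, a1, pow_zero, mul_one, hsize] at ht₁'
  have hcond : Expr.eval (orientTest p) (encode inp σ)
      (.sub (.var 4) (.add (.add (.load (.const 1)) (.load (.const 1))) (.const 1))) =
      c - (k + k + 1) := by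
    simp only [Expr.eval, eval_var, hc4]
    rw [encode_low (by omega), hpar]
  have hq : Polynomial.eval n (Polynomial.C (A + 2 * (B + 29) + 129) * (Polynomial.X + 1) ^ 2) =
      (A + 2 * (B + 29) + 129) * (n + 1) ^ 2 := by
    simp only [Polynomial.eval_add, Polynomial.eval_mul, Polynomial.eval_C, Polynomial.eval_pow,
      Polynomial.eval_X, Polynomial.eval_one]
  rw [hq]
  have ccost : (Expr.sub (.var 4)
    (.add (.add (.load (.const 1)) (.load (.const 1))) (.const 1))).cost = 34 := rfl
  have scost : (Expr.const 0).cost + (Expr.var 10).cost + 1 = 28 := rfl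
  rw [hsize] at hcn hc2 hcsurj
  have hfinal : ∀ τ : Store, Exec (orientTest p) (.store (.const 0) (.var 10)) (encode inp τ) 28
      (Function.update (encode inp τ) 0 (τ 0 10)) := by
    intro τ
    have := Exec.store (o := orientTest p) (.const 0) (.var 10) (encode inp τ)
    rwa [scost, eval_var] at this
  by_cases hck : c ≤ 2 * k + 1
  -- The isolated point of the first matching is bad and thus always in the kernel.
  · have hcpos : 0 < c := by
      obtain ⟨j, hj, -⟩ := hcsurj v₀ hv₀ ((hcore v₀ hv₀).2 (by rw [hvl]; exact h.isolated_mem_core))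
      omega
    have hgood : ∀ x (τ : Store), τ 0 5 = v₀ → τ 2 = σ 2 →
        (∀ i < inp 1, τ 4 i = x / c ^ i % c) →
        ((∀ i < inp 0, Cmd.simulate.sem (orientTest p) inp τ 3 i = inp (2 + inp 0 + i)) ↔
          runWord r (Set.range p) (m, v) (fun i => label p (σ 2 (x / c ^ i % c))) k =
            (m', v')) := by
      intro x τ h5 h2 hW
      rw [hpar] at hW
      have hsim := Cmd.sem_simulate (σ := τ) hp.injective hR h hsize hmate (by rw [h5]; exact hv₀)
        (by rw [h5]; exact hvl) (by
          intro i hi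
          rw [h2, hW i (by omega)]
          exact (hc2 _ (Nat.mod_lt _ hcpos)).1)
      rw [hpar, runWord_congr (g' := fun i => label p (σ 2 (x / c ^ i % c)))
        (fun i hi => by rw [h2, hW i hi])] at hsim
      rw [hsize]
      exact hsim.eq_iff hmate' hp.injective
        (runWord_isPairing (p := (m, v)) h (fun i => label p (σ 2 (x / c ^ i % c))) k) h'
    have hpow : 0 < c ^ inp 1 := Nat.pow_pos hcpos
    obtain ⟨t₂, ht₂, σ', e₂, hle, hans⟩ := exec_searchLoop hcpos hgood (c ^ inp 1 - 1) 0 σ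
      (by omega) hc4 hc5 rfl (fun i _ => by rw [z4]; simp) z11 (by omega)
    have ht₂' : t₂ ≤ c ^ k * (B * ((n + 1) * (k + 1)) + 29) + 29 := by
      refine ht₂.trans ?_
      have := hB inp
      rw [b0, b1, pow_one, pow_one, hsize, hpar] at this
      rw [Nat.sub_add_cancel hpow, hpar]
      exact Nat.add_le_add_right (Nat.mul_le_mul_left _ (by omega)) _
    refine ⟨_, _, .seq e₁ (.seq (.iteFalse (by rw [hcond]; omega) e₂) (hfinal σ')), ?_, ?_, ?_⟩
    · refine le_trans ?_ (search_time_le ht₁' ht₂' hck hcn)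
      rw [ccost]
      omega
    · rw [Function.update_self]; exact hle
    · rw [Function.update_self, hans, z10, pairReach_iff_exists_word (Set.finite_range p) hR.inj h h',
        hpar]
      constructor
      · rintro (h0 | ⟨x, -, -, hx⟩)
        · omega
        · refine ⟨_, fun i _ => ?_, hx⟩
          have := hc2 _ (Nat.mod_lt (x / c ^ i) hcpos)
          exact (hcore _ this.1).1 this.2
      · rintro ⟨g, hg, hrun⟩
        have hletter : ∀ i, ∃ j < c, i < k → label p (σ 2 j) = g i := by
          intro i
          by_cases hi : i < k
          · obtain ⟨l, hl, hlg⟩ := exists_label (core_subset (hg i hi))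
            obtain ⟨j, hj, hjl⟩ := hcsurj l hl ((hcore l hl).2 (by rw [hlg]; exact hg i hi))
            exact ⟨j, hj, fun _ => by rw [hjl, hlg]⟩
          · exact ⟨0, hcpos, fun hi' => absurd hi' hi⟩
        choose d hd hdg using hletter
        obtain ⟨x, hx, hxd⟩ := exists_digits k d fun i _ => hd i
        refine Or.inr ⟨x, Nat.zero_le _, hx, ?_⟩
        rw [← hrun]
        exact runWord_congr fun i hi => by rw [hxd i hi, hdg i hi]
  · refine ⟨_, _, .seq e₁ (.seq (.iteTrue (by rw [hcond]; omega) (.skip _)) (hfinal σ)), ?_, ?_, ?_⟩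
    -- No search takes place, so the time bound is used with an empty alphabet and no search time.
    · have := search_time_le (t₂ := 0) (c := 0) (B := B) ht₁' (Nat.zero_le _)
        (Nat.zero_le (2 * k + 1)) (Nat.zero_le n)
      refine le_trans ?_ this
      rw [ccost]
      omega
    · rw [Function.update_self, z10]; omega
    · rw [Function.update_self, z10]
      refine ⟨fun h0 => by omega, fun hk => absurd ?_ hck⟩
      have hle := core_encard_le h hk
      -- The `c` listed labels belong to distinct core points, so a yes-instance would force `c ≤ 2k
      -- + 1`.
      have hmaps : (fun j => label p (σ 2 j)) '' (Finset.range c : Set ℕ) ⊆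
          core r (Set.range p) m m' := by
        rintro _ ⟨j, hj, rfl⟩
        have hj' := hc2 j (by simpa using hj)
        exact (hcore _ hj'.1).1 hj'.2
      have hinj : Set.InjOn (fun j => label p (σ 2 j)) (Finset.range c : Set ℕ) := by
        intro i hi j hj hij
        have hi' : i < c := by simpa using hi
        have hj' : j < c := by simpa using hj
        have := (label_inj hp.injective (hc2 i hi').1 (hc2 j hj').1).1 hij
        rcases lt_trichotomy i j with hlt | heq | hlt
        · have := hcmono j hj' i hlt; omega
        · exact heq
        · have := hcmono i hi' j hlt; omega
      have := (Set.encard_le_encard hmaps).trans hle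
      rw [hinj.encard_image, Set.encard_coe_eq_coe_finsetCard, Finset.card_range] at this
      exact_mod_cast this

end OddMatchings


theorem mainTheorem5 :
    -- fixed-parameter tractability, with running time `(2k)^k` times a polynomial
    OddMatchings.FlipDistanceFPT (fun k => (2 * k) ^ k) ∧
    -- the kernel is computed in polynomial time
    OddMatchings.KernelPolyTime ∧
    ∀ (S : Set OddMatchings.Plane), S.Finite →
      ConvexIndependent ℝ ((↑) : S → OddMatchings.Plane) →
      ∀ M M' : OddMatchings.OddMatching S,
        -- removing the good happy edges with their endpoints gives an instance of the same problem
        ∃ N N' : OddMatchings.OddMatching (OddMatchings.kernelPoints S M.1 M'.1),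
          N.1 = OddMatchings.kernelEdges S M.1 M'.1 M.1 ∧
          N'.1 = OddMatchings.kernelEdges S M.1 M'.1 M'.1 ∧
          -- that is equivalent to the given one,
          OddMatchings.flipDist N N' = OddMatchings.flipDist M M' ∧
          -- has at most `k` edges and `2k + 1` points unless the answer is no,
          (∀ k : ℕ, OddMatchings.flipDist M M' ≤ k →
            N.1.encard ≤ k ∧ N'.1.encard ≤ k ∧
              (OddMatchings.kernelPoints S M.1 M'.1).encard ≤ 2 * k + 1) ∧
          -- and then leaves at most `(2k)^j` flip sequences of length `j ≤ k` to be searched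
          (∀ k : ℕ, N.1.encard ≤ k → ∀ j ≤ k,
            (OddMatchings.flipSequences N j).encard ≤ (2 * k) ^ j) := by
  exact ⟨OddMatchings.flipDistanceFPT, OddMatchings.kernelPolyTime,
    fun _ hfin hS M M' => OddMatchings.kernel_reduction hfin hS M M'⟩
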